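/- Let $\Bbbk$ be an algebraically closed field and let $\mathcal{C}$ be a spherical fusion category over $\Bbbk$: a $\Bbbk$-linear autonomous (rigid) monoidal category with finite direct sums and bilinear tensor product, with a finite family $(V_i)_{i\in I}$ of objects such that $\mathrm{Hom}(V_i,V_j)=0$ for $i\neq j$, $\mathrm{End}(V_i)=\Bbbk\,\mathrm{id}_{V_i}\cong\Bbbk$, every object is a finite direct sum of objects $V_i$, and $\mathbb{1}$ is isomorphic to some $V_i$; together with a sovereign structure (a monoidal natural isomorphism $\phi_X\colon X\to X^{**}$) whose left and right traces of endomorphisms coincide. Assume that $\dim\mathcal{C}=\sum_{i\in I}\dim_l(V_i)\dim_r(V_i)\in\mathrm{End}(\mathbb{1})=\Bbbk$ is invertible. Then the center $\mathcal{Z}(\mathcal{C})$, with its usual monoidal structure, its usual braiding $\tau_{(X,\sigma),(Y,\gamma)}=\sigma_Y$ and the $\Bbbk$-linear structure of $\mathcal{C}$, is a modular ribbon fusion category. That is: (a) $\mathcal{Z}(\mathcal{C})$ is autonomous, and is a fusion category over $\Bbbk$ (it has finite direct sums and a finite family of objects with the properties listed above); (b) $\mathcal{Z}(\mathcal{C})$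 is a ribbon category: the morphisms $$\theta_{(X,\sigma)}=\bigl(\mathrm{id}_X\otimes \mathrm{ev}_{X^*}(\phi_X\otimes\mathrm{id}_{X^*})\bigr)(\sigma_X\otimes\mathrm{id}_{X^*})(\mathrm{id}_X\otimes\mathrm{coev}_X)\colon X\to X$$ form a self-dual twist on $\mathcal{Z}(\mathcal{C})$, i.e. a natural isomorphism of the identity functor of $\mathcal{Z}(\mathcal{C})$ with $\theta_{M\otimes N}=(\theta_M\otimes\theta_N)\tau_{N,M}\tau_{M,N}$ and $(\theta_M)^*=\theta_{M^*}$; (c) $\mathcal{Z}(\mathcal{C})$ is modular: it admits a coend $A=\int^{M\in\mathcal{Z}(\mathcal{C})}M^*\otimes M$, with universal dinatural transformation $i$, and the pairing $\omega\colon A\otimes A\to\mathbb{1}$ determined by $$\omega(i_M\otimes i_N)=(\mathrm{ev}_M\otimes\mathrm{ev}_N)(\mathrm{id}_{M^*}\otimes\tau_{N^*,M}\tau_{M,N^*}\otimes\mathrm{id}_N)$$ is non-degenerate, i.e. there is $\sigma\colon\mathbb{1}\to A\otimes A$ with $(\omega\otimes\mathrm{id}_A)(\mathrm{id}_A\otimes\sigma)=\mathrm{id}_A=(\mathrm{id}_A\otimes\omega)(\sigma\otimes\mathrm{id}_A)$.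 -/

import Mathlib

open CategoryTheory MonoidalCategory Limits

universe w v u

noncomputable section

namespace CategoricalCenter

/-! ### Sovereign categories

The left dual of `X` in the sense "evaluation `X* ⊗ X ⟶ 𝟙_`, coevaluation `𝟙_ ⟶ X ⊗ X*`"
is Mathlib's right dual, written `dual X` below; `η_ X (dual X)` is the coevaluation and
`ε_ X (dual X)` the evaluation.
-/

section Sovereign

variable {C : Type u} [Category.{v} C] [MonoidalCategory C] [RightRigidCategory C]

/-- The dual `X*` of an object. -/
abbrev dual (X : C) : C := HasRightDual.rightDual X

/-- The dual `f* : Y* ⟶ X*` of a morphism `f : X ⟶ Y`. -/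
abbrev mate {X Y : C} (f : X ⟶ Y) : dual Y ⟶ dual X := rightAdjointMate f

/-- The canonical isomorphism `X** ⊗ Y** ⟶ (X ⊗ Y)**`. -/
def doubleDualTensor (X Y : C) : dual (dual X) ⊗ dual (dual Y) ⟶ dual (dual (X ⊗ Y)) :=
  (rightDualTensorIso (dual Y) (dual X)).inv ≫ mate (rightDualTensorIso X Y).hom

/-- For an object `X` that is dual to itself through the pairing `p`, the canonical isomorphism
`X ⟶ X* ⟶ X**`. It is used for the unit object with its standard self-pairing. -/
def selfDualDoubleDual (X : C) (p : ExactPairing X X) : X ⟶ dual (dual X) :=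
  (rightDualIso p HasRightDual.exact).hom ≫ mate (rightDualIso p HasRightDual.exact).inv

variable (C) in
/-- A sovereign (pivotal) structure: a monoidal natural isomorphism from the identity functor to
the double dual functor. -/
structure SovereignStructure where
  /-- The components `X ⟶ X**`. -/
  φ : ∀ X : C, X ≅ dual (dual X)
  naturality : ∀ {X Y : C} (f : X ⟶ Y), f ≫ (φ Y).hom = (φ X).hom ≫ mate (mate f)
  tensor : ∀ X Y : C,
    (φ (X ⊗ Y)).hom = ((φ X).hom ⊗ₘ (φ Y).hom) ≫ doubleDualTensor X Y
  unit : (φ (𝟙_ C)).hom = selfDualDoubleDual (𝟙_ C) exactPairingUnit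

namespace SovereignStructure

variable (S : SovereignStructure C)

/-- The right evaluation `X ⊗ X* ⟶ X** ⊗ X* ⟶ 𝟙_` determined by the sovereign structure. -/
def rightEv (X : C) : X ⊗ dual X ⟶ 𝟙_ C :=
  (S.φ X).hom ▷ (dual X) ≫ ε_ (dual X) (dual (dual X))

/-- The left trace of an endomorphism. -/
def trL {X : C} (f : X ⟶ X) : End (𝟙_ C) :=
  η_ (dual X) (dual (dual X)) ≫ (dual X) ◁ ((S.φ X).inv ≫ f) ≫ ε_ X (dual X)

/-- The right trace of an endomorphism. -/
def trR {X : C} (f : X ⟶ X) : End (𝟙_ C) :=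
  η_ X (dual X) ≫ f ▷ (dual X) ≫ S.rightEv X

/-- The left dimension of an object. -/
def dimL (X : C) : End (𝟙_ C) := S.trL (𝟙 X)

/-- The right dimension of an object. -/
def dimR (X : C) : End (𝟙_ C) := S.trR (𝟙 X)

/-- Sphericity: the left and right traces of all endomorphisms coincide. -/
def IsSpherical : Prop := ∀ (X : C) (f : X ⟶ X), S.trL f = S.trR f

end SovereignStructure

end Sovereign

/-! ### Fusion categories -/

section Fusion

variable (k : Type w) [CommRing k]
variable (C : Type u) [Category.{v} C] [MonoidalCategory C] [Preadditive C] [Linear k C]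
  [MonoidalPreadditive C] [MonoidalLinear k C]

/-- The structure which makes a `k`-linear autonomous category a fusion category over `k`:
finite direct sums exist, and there is a finite family `V` of objects with
`Hom(V i, V j) = δ_{ij} k`, such that every object is a finite direct sum of members of the family
and the unit object is isomorphic to a member of the family. -/
structure FusionStructure [RigidCategory C] where
  hasFiniteBiproducts : HasFiniteBiproducts C
  /-- The finite index set. -/
  I : Type
  [fintype : Fintype I]
  /-- The representative family of scalar objects. -/
  V : I → C
  hom_eq_zero : ∀ i j : I, i ≠ j → ∀ f : V i ⟶ V j, f = 0
  end_eq_scalars : ∀ i : I, Function.Bijective (fun a : k => a • 𝟙 (V i))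
  exists_iso_biproduct : ∀ X : C, ∃ (n : ℕ) (j : Fin n → I), Nonempty (X ≅ ⨁ fun a => V (j a))
  exists_unit_iso : ∃ i : I, Nonempty (𝟙_ C ≅ V i)

attribute [instance] FusionStructure.fintype

variable {k C} in
/-- The dimension `∑ i, dim_l (V i) * dim_r (V i)` of a sovereign fusion category. -/
def FusionStructure.dim [RigidCategory C] (F : FusionStructure k C) (S : SovereignStructure C) :
    End (𝟙_ C) :=
  ∑ i : F.I, S.dimL (F.V i) * S.dimR (F.V i)

end Fusion

/-! ### Ribbon and modular categories -/

section Braided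

variable (B : Type u) [Category.{v} B] [MonoidalCategory B] [BraidedCategory B] [RigidCategory B]

/-- A self-dual twist on a braided autonomous category, i.e. a ribbon structure. -/
structure RibbonStructure where
  /-- The twist. -/
  θ : ∀ X : B, X ≅ X
  naturality : ∀ {X Y : B} (f : X ⟶ Y), f ≫ (θ Y).hom = (θ X).hom ≫ f
  tensor : ∀ X Y : B,
    (θ (X ⊗ Y)).hom = (β_ X Y).hom ≫ (β_ Y X).hom ≫ ((θ X).hom ⊗ₘ (θ Y).hom)
  selfDual : ∀ X : B, mate (θ X).hom = (θ (dual X)).hom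

end Braided

section Coend

variable (B : Type u) [Category.{v} B] [MonoidalCategory B] [RigidCategory B]

/-- A coend of an autonomous category `B`, i.e. a coend of the functor `(X, Y) ↦ X* ⊗ Y`:
an object with a universal dinatural transformation. -/
structure CoendOf where
  /-- The underlying object. -/
  pt : B
  /-- The universal dinatural transformation. -/
  ι : ∀ X : B, dual X ⊗ X ⟶ pt
  dinatural : ∀ {X Y : B} (f : X ⟶ Y), mate f ▷ X ≫ ι X = (dual Y) ◁ f ≫ ι Y
  universal : ∀ (D : B) (d : ∀ X : B, dual X ⊗ X ⟶ D),
    (∀ {X Y : B} (f : X ⟶ Y), mate f ▷ X ≫ d X = (dual Y) ◁ f ≫ d Y) →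
      ∃! g : pt ⟶ D, ∀ X : B, ι X ≫ g = d X

variable {B}

/-- `ω` is the Hopf pairing of the coend `K` of a braided autonomous category:
`ω (i_X ⊗ i_Y) = (ev_X ⊗ ev_Y) (id ⊗ τ_{Y*,X} τ_{X,Y*} ⊗ id)` for all objects `X`, `Y`.
(As the maps `i_X ⊗ i_Y` are jointly epimorphic, `ω` is determined by this.) -/
def CoendOf.IsHopfPairing [BraidedCategory B] (K : CoendOf B) (ω : K.pt ⊗ K.pt ⟶ 𝟙_ B) : Prop :=
  ∀ X Y : B,
    (K.ι X ⊗ₘ K.ι Y) ≫ ω =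
      (α_ (dual X) X ((dual Y) ⊗ Y)).hom ≫ (dual X) ◁ (α_ X (dual Y) Y).inv ≫
        (dual X) ◁ (((β_ X (dual Y)).hom ≫ (β_ (dual Y) X).hom) ▷ Y) ≫
        (dual X) ◁ (α_ X (dual Y) Y).hom ≫ (α_ (dual X) X ((dual Y) ⊗ Y)).inv ≫
        (ε_ X (dual X) ⊗ₘ ε_ Y (dual Y)) ≫ (λ_ (𝟙_ B)).hom

/-- Non-degeneracy of a pairing `ω : A ⊗ A ⟶ 𝟙_`. -/
def IsNondegenerate {A : B} (ω : A ⊗ A ⟶ 𝟙_ B) : Prop :=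
  ∃ σ : 𝟙_ B ⟶ A ⊗ A,
    (ρ_ A).inv ≫ A ◁ σ ≫ (α_ A A A).inv ≫ ω ▷ A ≫ (λ_ A).hom = 𝟙 A ∧
    (λ_ A).inv ≫ σ ▷ A ≫ (α_ A A A).hom ≫ A ◁ ω ≫ (ρ_ A).hom = 𝟙 A

variable (B) in
/-- A braided autonomous category is modular if it admits a coend whose Hopf pairing is
non-degenerate. -/
def IsModular [BraidedCategory B] : Prop :=
  ∃ (K : CoendOf B) (ω : K.pt ⊗ K.pt ⟶ 𝟙_ B), K.IsHopfPairing ω ∧ IsNondegenerate ω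

end Coend

/-! ### The linear structure of the center, and its twist -/

section Center

variable {C : Type u} [Category.{v} C] [MonoidalCategory C]

section Preadditive

variable [Preadditive C] [MonoidalPreadditive C]

instance centerZero (X Y : Center C) : Zero (X ⟶ Y) := ⟨⟨0, fun U => by simp⟩⟩

instance centerAdd (X Y : Center C) : Add (X ⟶ Y) :=
  ⟨fun f g => ⟨f.f + g.f, fun U => by simp⟩⟩

instance centerNeg (X Y : Center C) : Neg (X ⟶ Y) :=
  ⟨fun f => ⟨-f.f, fun U => by
    have h1 : (-f.f) ▷ U = -(f.f ▷ U) := ((tensorRight U).map_neg (f := f.f))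
    have h2 : U ◁ (-f.f) = -(U ◁ f.f) := ((tensorLeft U).map_neg (f := f.f))
    rw [h1, h2, Preadditive.neg_comp, Preadditive.comp_neg, f.comm]⟩⟩

@[simp] lemma center_zero_f (X Y : Center C) : Center.Hom.f (0 : X ⟶ Y) = 0 := rfl

@[simp] lemma center_add_f {X Y : Center C} (f g : X ⟶ Y) :
    Center.Hom.f (f + g) = f.f + g.f := rfl

@[simp] lemma center_neg_f {X Y : Center C} (f : X ⟶ Y) : Center.Hom.f (-f) = -f.f := rfl

instance centerAddCommGroup (X Y : Center C) : AddCommGroup (X ⟶ Y) where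
  add_assoc f g h := Center.ext _ _ (add_assoc _ _ _)
  zero_add f := Center.ext _ _ (zero_add _)
  add_zero f := Center.ext _ _ (add_zero _)
  add_comm f g := Center.ext _ _ (add_comm _ _)
  neg_add_cancel f := Center.ext _ _ (neg_add_cancel _)
  nsmul := nsmulRec
  zsmul := zsmulRec

/-- Morphisms of the center are added in `C`. -/
instance centerPreadditive : Preadditive (Center C) where
  homGroup X Y := centerAddCommGroup X Y
  add_comp _ _ _ f f' g := Center.ext _ _ (Preadditive.add_comp _ _ _ f.f f'.f g.f)
  comp_add _ _ _ f g g' := Center.ext _ _ (Preadditive.comp_add _ _ _ f.f g.f g'.f)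

instance centerMonoidalPreadditive : MonoidalPreadditive (Center C) where
  whiskerLeft_zero {X _ _} := Center.ext _ _ (MonoidalPreadditive.whiskerLeft_zero (X := X.1))
  zero_whiskerRight {X _ _} := Center.ext _ _ (MonoidalPreadditive.zero_whiskerRight (X := X.1))
  whiskerLeft_add {X _ _} f g :=
    Center.ext _ _ (MonoidalPreadditive.whiskerLeft_add (X := X.1) f.f g.f)
  add_whiskerRight {X _ _} f g :=
    Center.ext _ _ (MonoidalPreadditive.add_whiskerRight (X := X.1) f.f g.f)

section Linear

variable {k : Type w} [CommRing k] [Linear k C] [MonoidalLinear k C]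

instance centerSMul (X Y : Center C) : SMul k (X ⟶ Y) :=
  ⟨fun a f => ⟨a • f.f, fun U => by simp⟩⟩

@[simp] lemma center_smul_f {X Y : Center C} (a : k) (f : X ⟶ Y) :
    Center.Hom.f (a • f) = a • f.f := rfl

instance centerModule (X Y : Center C) : Module k (X ⟶ Y) where
  one_smul f := Center.ext _ _ (one_smul k f.f)
  mul_smul a b f := Center.ext _ _ (mul_smul a b f.f)
  smul_zero a := Center.ext _ _ (smul_zero a)
  smul_add a f g := Center.ext _ _ (smul_add a f.f g.f)
  add_smul a b f := Center.ext _ _ (add_smul a b f.f)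
  zero_smul f := Center.ext _ _ (zero_smul k f.f)

/-- Morphisms of the center are multiplied by scalars in `C`. -/
instance centerLinear : Linear k (Center C) where
  homModule X Y := centerModule X Y
  smul_comp _ _ _ a f g := Center.ext _ _ (Linear.smul_comp _ _ _ a f.f g.f)
  comp_smul _ _ _ f a g := Center.ext _ _ (Linear.comp_smul _ _ _ f.f a g.f)

instance centerMonoidalLinear : MonoidalLinear k (Center C) where
  whiskerLeft_smul X _ _ a f := Center.ext _ _ (MonoidalLinear.whiskerLeft_smul X.1 a f.f)
  smul_whiskerRight a _ _ f X := Center.ext _ _ (MonoidalLinear.smul_whiskerRight a f.f X.1)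

end Linear

end Preadditive

variable [RightRigidCategory C]

/-- The twist of the center determined by a sovereign structure on `C`: on an object `(X, σ)` it is
the partial right trace of the self-braiding `σ_X : X ⊗ X ⟶ X ⊗ X`, that is,
`X ⟶ X ⊗ X ⊗ X* ⟶ X ⊗ X ⊗ X* ⟶ X`. -/
def SovereignStructure.centerTwist (S : SovereignStructure C) (X : Center C) : X.1 ⟶ X.1 :=
  (ρ_ X.1).inv ≫ X.1 ◁ η_ X.1 (dual X.1) ≫ (α_ X.1 X.1 (dual X.1)).inv ≫
    (X.2.β X.1).hom ▷ (dual X.1) ≫ (α_ X.1 X.1 (dual X.1)).hom ≫ X.1 ◁ S.rightEv X.1 ≫ (ρ_ X.1).hom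

end Center

end CategoricalCenter

end

noncomputable section

namespace CategoricalCenter

/-! ### Duality in sovereign categories -/

section Duality

variable {C : Type u} [Category.{v} C] [MonoidalCategory C]

/-! The engine is averaging over the scalar objects. For a morphism `f` of `C` between the
underlying objects of `M` and `N` in the center, conjugate `V i ◁ f` by the half braidings, take the
right partial trace over `V i`, and sum with weights `d (V i)`. The handle slide (`handle_slide`)
moves any object `U` across this weighted sum, so the average `avg` is a morphism of the center. It
is bilinear over center morphisms (`avgHom_comp`), sends the identity to the dimension of `C`
(`avgHom_id`) and multiplies traces by that dimension (`tr_avgHom`).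

Fusion. As the dimension is invertible, Maschke's argument applies: average a generalized inverse
taken in `C` to get one in the center (`center_exists_generalized_inverse`). Idempotents split in
the center, Hom spaces are finite dimensional and `k` is algebraically closed, so every object is a
finite sum of scalar objects (`hasScalarDecomposition`). Finitely many suffice: the induced objects
`⨁ (V i)* ⊗ W ⊗ V i` receive `W` and map to every central object extending a given morphism from
`W`, so each scalar object is hit by some `centerInd (V i)`.

Ribbon. Duals carry the transposed inverse half braiding, and the sovereign structure lifts to the
center (`centerSovereign`). In a braided sovereign category the twist compares two evaluations `X ⊗
X* ⟶ 𝟙_`, the sovereign one and the one made from `ev` and the braiding; naturality and the tensor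
formula are read off from this. Self-duality needs sphericity, and comes from non-degeneracy of the
trace of `C` (`rightEv_of_rightCv`).

Modularity. The coend of a fusion category is the induced object of the unit. If `f : N ⟶ A` is
killed by the Hopf pairing, then the double braiding with every `Z`, acting through the components
of `f`, vanishes. For `Z` an induced object, restricted to `W`, this is a statement about one half
braiding in `C`; averaging it isolates each matrix entry of each component (`sum_average_eq_zero`,
`smul_avgHom`), so `f = 0`. Hence `A ⟶ A*` is a split monomorphism, and a dimension count using `A**
≅ A` makes it an isomorphism. -/

lemma eq_of_zigzag {A A' : C} {c c' : 𝟙_ C ⟶ A' ⊗ A} {e : A ⊗ A' ⟶ 𝟙_ C}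
    (h : c ▷ A' ⊗≫ A' ◁ e = ⊗𝟙.hom) (h' : A ◁ c' ⊗≫ e ▷ A = ⊗𝟙.hom) : c = c' :=
  calc
    c = c ⊗≫ A' ◁ (A ◁ c' ⊗≫ e ▷ A) ⊗≫ 𝟙 _ := by rw [h']; monoidal
    _ = 𝟙 _ ⊗≫ (c ▷ 𝟙_ C ≫ (A' ⊗ A) ◁ c') ⊗≫ A' ◁ e ▷ A ⊗≫ 𝟙 _ := by monoidal
    _ = c' ⊗≫ (c ▷ A' ⊗≫ A' ◁ e) ▷ A ⊗≫ 𝟙 _ := by rw [← whisker_exchange]; monoidal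
    _ = c' := by rw [h]; monoidal

variable [RightRigidCategory C]

/-- The evaluation. -/
def ev (X : C) : dual X ⊗ X ⟶ 𝟙_ C := ε_ X (dual X)

/-- The coevaluation. -/
def cv (X : C) : 𝟙_ C ⟶ X ⊗ dual X := η_ X (dual X)

lemma dual_cv_ev (X : C) : dual X ◁ cv X ⊗≫ ev X ▷ dual X = ⊗𝟙.hom :=
  ExactPairing.coevaluation_evaluation'' _ _

lemma cv_ev (X : C) : cv X ▷ X ⊗≫ X ◁ ev X = ⊗𝟙.hom :=
  ExactPairing.evaluation_coevaluation'' _ _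

/-- The morphism to the dual determined by a pairing. -/
def toDual {X Y : C} (e : Y ⊗ X ⟶ 𝟙_ C) : Y ⟶ dual X :=
  𝟙 _ ⊗≫ Y ◁ cv X ⊗≫ e ▷ dual X ⊗≫ 𝟙 _

lemma toDual_ev {X Y : C} (e : Y ⊗ X ⟶ 𝟙_ C) : toDual e ▷ X ≫ ev X = e :=
  calc
    _ = 𝟙 _ ⊗≫ Y ◁ cv X ▷ X ⊗≫ (e ▷ (dual X ⊗ X) ≫ 𝟙_ C ◁ ev X) ⊗≫ 𝟙 _ := by
      dsimp only [toDual]; monoidal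
    _ = 𝟙 _ ⊗≫ Y ◁ (cv X ▷ X ⊗≫ X ◁ ev X) ⊗≫ e := by
      rw [← whisker_exchange]; monoidal
    _ = e := by rw [cv_ev]; monoidal

lemma toDual_whiskerRight_ev {X Y : C} (g : Y ⟶ dual X) : toDual (g ▷ X ≫ ev X) = g :=
  calc
    _ = 𝟙 _ ⊗≫ (Y ◁ cv X ≫ g ▷ (X ⊗ dual X)) ⊗≫ ev X ▷ dual X ⊗≫ 𝟙 _ := by
      dsimp only [toDual]; monoidal
    _ = g ⊗≫ (dual X ◁ cv X ⊗≫ ev X ▷ dual X) ⊗≫ 𝟙 _ := by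
      rw [whisker_exchange]; monoidal
    _ = g := by rw [dual_cv_ev]; monoidal

lemma dual_hom_ext {X Y : C} {g g' : Y ⟶ dual X} (h : g ▷ X ≫ ev X = g' ▷ X ≫ ev X) : g = g' := by
  rw [← toDual_whiskerRight_ev g, h, toDual_whiskerRight_ev]

lemma mate_ev {X Y : C} (f : X ⟶ Y) : mate f ▷ X ≫ ev X = dual Y ◁ f ≫ ev Y :=
  rightAdjointMate_comp_evaluation f

lemma cv_mate {X Y : C} (f : X ⟶ Y) : cv Y ≫ Y ◁ mate f = cv X ≫ f ▷ dual X :=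
  coevaluation_comp_rightAdjointMate f

lemma cv_mate_assoc {X Y Z : C} (f : X ⟶ Y) (g : Y ⊗ dual X ⟶ Z) :
    cv Y ≫ Y ◁ mate f ≫ g = cv X ≫ f ▷ dual X ≫ g := by
  rw [← Category.assoc, cv_mate, Category.assoc]

lemma mate_id (X : C) : mate (𝟙 X) = 𝟙 (dual X) := rightAdjointMate_id

lemma mate_comp {X Y Z : C} (f : X ⟶ Y) (g : Y ⟶ Z) : mate (f ≫ g) = mate g ≫ mate f :=
  comp_rightAdjointMate

/-- The composite pairing of two pairings. -/
def nest {A A' B B' : C} (a : A' ⊗ A ⟶ 𝟙_ C) (b : B' ⊗ B ⟶ 𝟙_ C) :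
    (B' ⊗ A') ⊗ (A ⊗ B) ⟶ 𝟙_ C :=
  𝟙 _ ⊗≫ B' ◁ a ▷ B ⊗≫ b

/-- The isomorphism `(X ⊗ Y)* ≅ Y* ⊗ X*`. -/
abbrev dualTensor (X Y : C) : dual (X ⊗ Y) ≅ dual Y ⊗ dual X := rightDualTensorIso X Y

lemma dualTensor_inv_ev (X Y : C) :
    (dualTensor X Y).inv ▷ (X ⊗ Y) ≫ ev (X ⊗ Y) = nest (ev X) (ev Y) :=
  (@rightAdjointMate_comp_evaluation C _ _ (X ⊗ Y) (X ⊗ Y) _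
    (@HasRightDual.mk _ _ _ _ (dual Y ⊗ dual X) ExactPairing.tensor) (𝟙 _)).trans (by
      rw [MonoidalCategory.whiskerLeft_id, Category.id_comp]
      exact ExactPairing.tensor_evaluation)

lemma dualTensor_hom_nest (X Y : C) :
    (dualTensor X Y).hom ▷ (X ⊗ Y) ≫ nest (ev X) (ev Y) = ev (X ⊗ Y) := by
  rw [← dualTensor_inv_ev, ← comp_whiskerRight_assoc]
  simp

end Duality

namespace SovereignStructure

variable {C : Type u} [Category.{v} C] [MonoidalCategory C] [RightRigidCategory C]
  (S : SovereignStructure C)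

/-- The coevaluation `𝟙_ ⟶ X* ⊗ X` determined by the sovereign structure. -/
def rightCv (X : C) : 𝟙_ C ⟶ dual X ⊗ X := cv (dual X) ≫ dual X ◁ (S.φ X).inv

lemma rightEv_eq (X : C) : S.rightEv X = (S.φ X).hom ▷ dual X ≫ ev (dual X) := rfl

lemma rightCv_rightEv (X : C) :
    S.rightCv X ▷ dual X ⊗≫ dual X ◁ S.rightEv X = ⊗𝟙.hom :=
  calc
    _ = cv (dual X) ▷ dual X ⊗≫ dual X ◁ ((S.φ X).inv ≫ (S.φ X).hom) ▷ dual X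
        ⊗≫ dual X ◁ ev (dual X) := by
      rw [rightEv_eq, rightCv]; monoidal
    _ = cv (dual X) ▷ dual X ⊗≫ dual X ◁ ev (dual X) := by
      rw [Iso.inv_hom_id]; monoidal
    _ = _ := by rw [cv_ev]

lemma self_rightCv_rightEv (X : C) :
    X ◁ S.rightCv X ⊗≫ S.rightEv X ▷ X = ⊗𝟙.hom :=
  calc
    _ = X ◁ cv (dual X) ⊗≫ (X ◁ dual X ◁ (S.φ X).inv ≫ (S.φ X).hom ▷ (dual X ⊗ X))
        ⊗≫ ev (dual X) ▷ X := by
      rw [rightEv_eq, rightCv]; monoidal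
    _ = 𝟙 _ ⊗≫ (X ◁ cv (dual X) ≫ (S.φ X).hom ▷ (dual X ⊗ dual (dual X))) ⊗≫
         ((dual (dual X) ⊗ dual X) ◁ (S.φ X).inv ≫ ev (dual X) ▷ X) ⊗≫ 𝟙 _ := by
      rw [whisker_exchange]; monoidal
    _ = 𝟙 _ ⊗≫ (S.φ X).hom ⊗≫
        (dual (dual X) ◁ cv (dual X) ⊗≫ ev (dual X) ▷ dual (dual X)) ⊗≫ (S.φ X).inv ⊗≫ 𝟙 _ := by
      rw [whisker_exchange, whisker_exchange]; monoidal
    _ = 𝟙 _ ⊗≫ ((S.φ X).hom ≫ (S.φ X).inv) ⊗≫ 𝟙 _ := by rw [dual_cv_ev]; monoidal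
    _ = _ := by rw [Iso.hom_inv_id]; monoidal

lemma mate_rightEv {X Y : C} (f : X ⟶ Y) :
    X ◁ mate f ≫ S.rightEv X = f ▷ dual Y ≫ S.rightEv Y := by
  rw [rightEv_eq, rightEv_eq, ← comp_whiskerRight_assoc, S.naturality, comp_whiskerRight_assoc,
    mate_ev, whisker_exchange_assoc]

/-- This is the tensor axiom of the sovereign structure, rephrased for evaluations so that `φ` no
longer appears. -/
lemma rightEv_tensor (X Y : C) :
    S.rightEv (X ⊗ Y) =
      (X ⊗ Y) ◁ (dualTensor X Y).hom ≫ nest (S.rightEv Y) (S.rightEv X) := by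
  have h : nest (S.rightEv Y) (S.rightEv X) =
      ((S.φ X).hom ⊗ₘ (S.φ Y).hom) ▷ _ ≫ nest (ev (dual Y)) (ev (dual X)) := by
    rw [rightEv_eq, rightEv_eq, nest, nest, tensorHom_def']
    calc
      _ = 𝟙 _ ⊗≫ X ◁ ((S.φ Y).hom ▷ dual Y ≫ ev (dual Y)) ▷ dual X ⊗≫
          ((S.φ X).hom ▷ dual X ≫ ev (dual X)) := rfl
      _ = 𝟙 _ ⊗≫ X ◁ (S.φ Y).hom ▷ dual Y ▷ dual X ⊗≫ (X ◁ (ev (dual Y) ▷ dual X) ≫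
          (S.φ X).hom ▷ (𝟙_ C ⊗ dual X)) ⊗≫ ev (dual X) := by monoidal
      _ = _ := by rw [whisker_exchange]; monoidal
  rw [h, rightEv_eq, S.tensor, doubleDualTensor]
  rw [comp_whiskerRight_assoc, comp_whiskerRight_assoc, mate_ev, whisker_exchange_assoc,
    ← whisker_exchange_assoc]
  congr 2
  exact dualTensor_inv_ev _ _

/-- The unit axiom, rephrased for evaluations: under `U ≅ U*` the left and right evaluations both
become the pairing `p`. A general `U` keeps the unitors of `𝟙_` from being simplified. -/
lemma toDual_selfDual_rightEv {U : C} (p : ExactPairing U U)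
    (h : (S.φ U).hom = selfDualDoubleDual U p) :
    U ◁ toDual p.evaluation' ≫ S.rightEv U = p.evaluation' := by
  let i : U ≅ dual U := rightDualIso p HasRightDual.exact
  have hu : toDual p.evaluation' = i.hom := by
    refine dual_hom_ext ?_
    rw [toDual_ev]
    refine Eq.trans ?_ (@rightAdjointMate_comp_evaluation C _ _ U U
      (RightRigidCategory.rightDual _) (@HasRightDual.mk _ _ _ _ U p) (𝟙 _)).symm
    rw [MonoidalCategory.whiskerLeft_id, Category.id_comp]
    rfl
  have hφ : (S.φ U).hom = i.hom ≫ mate i.inv := h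
  rw [hu, rightEv_eq, hφ, comp_whiskerRight_assoc, mate_ev, whisker_exchange_assoc,
    ← MonoidalCategory.whiskerLeft_comp_assoc, Iso.hom_inv_id, ← hu,
    MonoidalCategory.whiskerLeft_id, Category.id_comp, toDual_ev]

lemma toDual_unit_rightEv :
    𝟙_ C ◁ toDual (ρ_ (𝟙_ C)).hom ≫ S.rightEv (𝟙_ C) = (ρ_ (𝟙_ C)).hom :=
  S.toDual_selfDual_rightEv exactPairingUnit S.unit

/-- Equivalent to saying that `φ` at `X*` is inverse to the dual of `φ` at `X`. It is not an axiom: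
it follows from naturality of `φ` at the evaluation `X* ⊗ X ⟶ 𝟙_` together with the tensor and unit
axioms. -/
lemma φ_rightEv_dual (X : C) : dual X ◁ (S.φ X).hom ≫ S.rightEv (dual X) = ev X := by
  -- The coevaluation of `X*` is, up to canonical isomorphisms, the dual of the evaluation of `X`;
  -- this is what lets naturality at `ev X` apply.
  have h1 : cv (dual X) ≫ (dualTensor (dual X) X).inv =
      toDual (ρ_ (𝟙_ C)).hom ≫ mate (ev X) := by
    refine dual_hom_ext ?_
    rw [comp_whiskerRight_assoc, dualTensor_inv_ev, comp_whiskerRight_assoc, mate_ev,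
      ← whisker_exchange_assoc, toDual_ev]
    calc
      _ = 𝟙 _ ⊗≫ (cv (dual X) ▷ dual X ⊗≫ dual X ◁ ev (dual X)) ▷ X ⊗≫ ev X := by
        rw [nest]; monoidal
      _ = _ := by rw [cv_ev]; monoidal
  have h2 : toDual (ρ_ (𝟙_ C)).hom ≫ mate (ev X) ≫ (dualTensor (dual X) X).hom = cv (dual X) := by
    rw [← Category.assoc, ← h1]; simp
  have h3 : (dual X ⊗ X) ◁ cv (dual X) ≫ nest (S.rightEv X) (S.rightEv (dual X)) =
      (ρ_ _).hom ≫ ev X := by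
    rw [← h2, MonoidalCategory.whiskerLeft_comp_assoc, MonoidalCategory.whiskerLeft_comp_assoc,
      ← rightEv_tensor, mate_rightEv, whisker_exchange_assoc, toDual_unit_rightEv,
      rightUnitor_naturality]
  calc
    _ = 𝟙 _ ⊗≫ dual X ◁ (𝟙 X ⊗≫ (S.φ X).hom ⊗≫ (dual (dual X) ◁ cv (dual X) ⊗≫
          ev (dual X) ▷ dual (dual X)) ⊗≫ 𝟙 (dual (dual X))) ⊗≫ S.rightEv (dual X) := by
      rw [dual_cv_ev]; monoidal
    _ = 𝟙 _ ⊗≫ dual X ◁ (X ◁ cv (dual X) ⊗≫ ((S.φ X).hom ▷ dual X ≫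
          ev (dual X)) ▷ dual (dual X)) ⊗≫ S.rightEv (dual X) := by
      have := (whisker_exchange (S.φ X).hom (cv (dual X))).symm
      calc
        _ = 𝟙 _ ⊗≫ dual X ◁ (((S.φ X).hom ▷ 𝟙_ C ≫ dual (dual X) ◁ cv (dual X)) ⊗≫
          ev (dual X) ▷ dual (dual X)) ⊗≫ S.rightEv (dual X) := by monoidal
        _ = _ := by rw [this]; monoidal
    _ = (ρ_ _).inv ≫ (dual X ⊗ X) ◁ cv (dual X) ≫ nest (S.rightEv X) (S.rightEv (dual X)) := by
      rw [nest, ← rightEv_eq]; monoidal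
    _ = _ := by rw [h3]; simp

end SovereignStructure

end CategoricalCenter

namespace CategoricalCenter

/-! ### Partial traces -/

section

variable {C : Type u} [Category.{v} C] [MonoidalCategory C] [RightRigidCategory C]

lemma cv_dualTensor (X Y : C) :
    cv (X ⊗ Y) ≫ (X ⊗ Y) ◁ (dualTensor X Y).hom = cv X ⊗≫ (X ◁ cv Y) ▷ dual X ⊗≫ 𝟙 _ :=
  (@coevaluation_comp_rightAdjointMate C _ _ (X ⊗ Y) (X ⊗ Y)
    (@HasRightDual.mk _ _ _ _ (dual Y ⊗ dual X) ExactPairing.tensor) _ (𝟙 _)).trans (by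
      rw [id_whiskerRight, Category.comp_id]
      exact ExactPairing.tensor_coevaluation)

end

namespace SovereignStructure

variable {C : Type u} [Category.{v} C] [MonoidalCategory C] [RightRigidCategory C]
  (S : SovereignStructure C)

/-- An evaluation has only one coevaluation, so the formula for `rightEv` on tensor products forces
this one. -/
lemma rightCv_tensor (X Y : C) :
    S.rightCv (X ⊗ Y) ≫ (dualTensor X Y).hom ▷ (X ⊗ Y) =
      S.rightCv Y ⊗≫ dual Y ◁ S.rightCv X ▷ Y ⊗≫ 𝟙 _ := by
  symm
  refine eq_of_zigzag (e := nest (S.rightEv Y) (S.rightEv X)) ?_ ?_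
  · calc
      _ = S.rightCv Y ▷ (dual Y ⊗ dual X) ⊗≫
          dual Y ◁ (S.rightCv X ▷ (Y ⊗ dual Y) ≫ (dual X ⊗ X) ◁ S.rightEv Y) ▷ dual X ⊗≫
          dual Y ◁ dual X ◁ S.rightEv X ⊗≫ 𝟙 ((dual Y ⊗ dual X) ⊗ 𝟙_ C) := by rw [nest]; monoidal
      _ = 𝟙 _ ⊗≫ (S.rightCv Y ▷ dual Y ⊗≫ dual Y ◁ S.rightEv Y) ▷ dual X ⊗≫
          dual Y ◁ (S.rightCv X ▷ dual X ⊗≫ dual X ◁ S.rightEv X) ⊗≫ 𝟙 _ := by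
        rw [← whisker_exchange]; monoidal
      _ = _ := by rw [rightCv_rightEv, rightCv_rightEv]; monoidal
  · have h : nest (S.rightEv Y) (S.rightEv X) =
        (X ⊗ Y) ◁ (dualTensor X Y).inv ≫ S.rightEv (X ⊗ Y) := by
      rw [rightEv_tensor, ← MonoidalCategory.whiskerLeft_comp_assoc]; simp
    rw [h]
    calc
      _ = (X ⊗ Y) ◁ S.rightCv (X ⊗ Y) ⊗≫
          (X ⊗ Y) ◁ ((dualTensor X Y).hom ≫ (dualTensor X Y).inv) ▷ (X ⊗ Y) ⊗≫
          S.rightEv (X ⊗ Y) ▷ (X ⊗ Y) := by monoidal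
      _ = (X ⊗ Y) ◁ S.rightCv (X ⊗ Y) ⊗≫ S.rightEv (X ⊗ Y) ▷ (X ⊗ Y) := by
        rw [Iso.hom_inv_id]; monoidal
      _ = _ := by
        refine Eq.trans ?_ ((S.self_rightCv_rightEv (X ⊗ Y)).trans ?_) <;> monoidal

/-- The right partial trace. -/
def ptr {A B V : C} (h : A ⊗ V ⟶ B ⊗ V) : A ⟶ B :=
  𝟙 _ ⊗≫ A ◁ cv V ⊗≫ h ▷ dual V ⊗≫ B ◁ S.rightEv V ⊗≫ 𝟙 _

lemma ptr_comp {A A' B B' V : C} (a : A' ⟶ A) (h : A ⊗ V ⟶ B ⊗ V) (b : B ⟶ B') :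
    S.ptr (a ▷ V ≫ h ≫ b ▷ V) = a ≫ S.ptr h ≫ b :=
  calc
    _ = 𝟙 _ ⊗≫ (A' ◁ cv V ≫ a ▷ (V ⊗ dual V)) ⊗≫ h ▷ dual V ⊗≫
        (b ▷ (V ⊗ dual V) ≫ B' ◁ S.rightEv V) ⊗≫ 𝟙 _ := by rw [ptr]; monoidal
    _ = _ := by rw [whisker_exchange, ← whisker_exchange b, ptr]; monoidal

/-- The morphism `f` travels once around the closed strand: it becomes `mate f` on the dual strand
and turns back at the right evaluation. -/
lemma ptr_cyclic {A B V V' : C} (f : V ⟶ V') (h : A ⊗ V' ⟶ B ⊗ V) :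
    S.ptr (A ◁ f ≫ h) = S.ptr (h ≫ B ◁ f) :=
  calc
    _ = 𝟙 _ ⊗≫ A ◁ (cv V ≫ f ▷ dual V) ⊗≫ h ▷ dual V ⊗≫ B ◁ S.rightEv V ⊗≫ 𝟙 _ := by
      rw [ptr]; monoidal
    _ = 𝟙 _ ⊗≫ A ◁ cv V' ⊗≫ ((A ⊗ V') ◁ mate f ≫ h ▷ dual V) ⊗≫
        B ◁ S.rightEv V ⊗≫ 𝟙 _ := by
      rw [← cv_mate]; monoidal
    _ = 𝟙 _ ⊗≫ A ◁ cv V' ⊗≫ h ▷ dual V' ⊗≫ B ◁ (V ◁ mate f ≫ S.rightEv V) ⊗≫ 𝟙 _ := by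
      rw [whisker_exchange]; monoidal
    _ = _ := by rw [mate_rightEv, ptr]; monoidal

lemma ptr_tensor {A B U V : C} (h : A ⊗ (U ⊗ V) ⟶ B ⊗ (U ⊗ V)) :
    S.ptr h = S.ptr (S.ptr ((α_ A U V).hom ≫ h ≫ (α_ B U V).inv)) :=
  calc
    _ = 𝟙 _ ⊗≫ A ◁ cv (U ⊗ V) ⊗≫
        (h ▷ dual (U ⊗ V) ≫ (B ⊗ U ⊗ V) ◁ (dualTensor U V).hom) ⊗≫
        B ◁ nest (S.rightEv V) (S.rightEv U) ⊗≫ 𝟙 _ := by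
      rw [ptr, rightEv_tensor]; monoidal
    _ = 𝟙 _ ⊗≫ A ◁ (cv (U ⊗ V) ≫ (U ⊗ V) ◁ (dualTensor U V).hom) ⊗≫
        h ▷ (dual V ⊗ dual U) ⊗≫ B ◁ nest (S.rightEv V) (S.rightEv U) ⊗≫ 𝟙 _ := by
      rw [← whisker_exchange]; monoidal
    _ = _ := by rw [cv_dualTensor, ptr, ptr, nest]; monoidal

lemma ptr_whiskerLeft {A B V : C} (X : C) (h : A ⊗ V ⟶ B ⊗ V) :
    S.ptr ((α_ X A V).hom ≫ X ◁ h ≫ (α_ X B V).inv) = X ◁ S.ptr h := by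
  rw [ptr, ptr]; monoidal

lemma ptr_whiskerRight {A B : C} (V : C) (g : A ⟶ B) :
    S.ptr (g ▷ V) = g ≫ (ρ_ B).inv ≫ B ◁ S.dimR V ≫ (ρ_ B).hom :=
  calc
    _ = 𝟙 _ ⊗≫ (A ◁ cv V ≫ g ▷ (V ⊗ dual V)) ⊗≫ B ◁ S.rightEv V ⊗≫ 𝟙 _ := by
      rw [ptr]; monoidal
    _ = g ≫ (ρ_ B).inv ≫ B ◁ (cv V ≫ 𝟙 V ▷ dual V ≫ S.rightEv V) ≫ (ρ_ B).hom := by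
      rw [whisker_exchange]; monoidal
    _ = _ := rfl

lemma trR_eq {X : C} (f : X ⟶ X) : S.trR f = cv X ≫ f ▷ dual X ≫ S.rightEv X := rfl

lemma trL_eq {X : C} (f : X ⟶ X) : S.trL f = S.rightCv X ≫ dual X ◁ f ≫ ev X := by
  rw [rightCv, Category.assoc, ← MonoidalCategory.whiskerLeft_comp_assoc]; rfl

lemma trR_comm {X Y : C} (f : X ⟶ Y) (g : Y ⟶ X) : S.trR (f ≫ g) = S.trR (g ≫ f) := by
  rw [trR_eq, trR_eq, comp_whiskerRight, comp_whiskerRight, Category.assoc, Category.assoc,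
    ← cv_mate_assoc, whisker_exchange_assoc, mate_rightEv]

lemma trR_ptr {M V : C} (h : M ⊗ V ⟶ M ⊗ V) : S.trR (S.ptr h) = S.trR h := by
  symm
  calc
    _ = cv (M ⊗ V) ⊗≫
        (h ▷ dual (M ⊗ V) ≫ (M ⊗ V) ◁ (dualTensor M V).hom) ⊗≫
        nest (S.rightEv V) (S.rightEv M) := by
      rw [trR_eq, rightEv_tensor]; monoidal
    _ = (cv (M ⊗ V) ≫ (M ⊗ V) ◁ (dualTensor M V).hom) ⊗≫
        h ▷ (dual V ⊗ dual M) ⊗≫ nest (S.rightEv V) (S.rightEv M) := by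
      rw [← whisker_exchange]; monoidal
    _ = _ := by rw [cv_dualTensor, trR_eq, ptr, nest]; monoidal

lemma trR_whiskerLeft (V : C) {M : C} (f : M ⟶ M) :
    S.trR (V ◁ f) = cv V ≫ ((ρ_ V).inv ≫ V ◁ S.trR f ≫ (ρ_ V).hom) ▷ dual V ≫ S.rightEv V :=
  calc
    _ = S.trR (S.ptr (V ◁ f)) := (S.trR_ptr _).symm
    _ = _ := by rw [trR_eq, ptr, trR_eq]; monoidal

/-- The left partial trace. -/
def ptrL {U V W : C} (g : U ⊗ V ⟶ U ⊗ W) : V ⟶ W :=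
  𝟙 _ ⊗≫ S.rightCv U ▷ V ⊗≫ dual U ◁ g ⊗≫ ev U ▷ W ⊗≫ 𝟙 _

lemma trL_ptrL {U V : C} (g : U ⊗ V ⟶ U ⊗ V) : S.trL (S.ptrL g) = S.trL g := by
  symm
  calc
    _ = S.rightCv (U ⊗ V) ⊗≫ (dual (U ⊗ V) ◁ g ≫ (dualTensor U V).hom ▷ (U ⊗ V)) ⊗≫
        nest (ev U) (ev V) := by
      rw [trL_eq, ← dualTensor_hom_nest]; monoidal
    _ = (S.rightCv (U ⊗ V) ≫ (dualTensor U V).hom ▷ (U ⊗ V)) ⊗≫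
        (dual V ⊗ dual U) ◁ g ⊗≫ nest (ev U) (ev V) := by
      rw [whisker_exchange]; monoidal
    _ = _ := by rw [rightCv_tensor, trL_eq, ptrL, nest]; monoidal

end SovereignStructure

end CategoricalCenter

namespace CategoricalCenter

/-! ### Scalar objects -/

section Scalar

variable {k : Type w} [Field k] {C : Type u} [Category.{v} C] [Preadditive C] [Linear k C]

variable (k) in
/-- An object whose endomorphisms are scalars. -/
def IsScalar (X : C) : Prop := Function.Bijective (fun a : k => a • 𝟙 X)

/-- The scalar of an endomorphism of a scalar object. -/
def IsScalar.coef {X : C} (h : IsScalar k X) : (X ⟶ X) →ₗ[k] k :=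
  (LinearEquiv.ofBijective (LinearMap.toSpanSingleton k (X ⟶ X) (𝟙 X)) h).symm

lemma IsScalar.coef_smul_id {X : C} (h : IsScalar k X) (f : X ⟶ X) : h.coef f • 𝟙 X = f :=
  (LinearEquiv.ofBijective (LinearMap.toSpanSingleton k (X ⟶ X) (𝟙 X)) h).apply_symm_apply f

lemma IsScalar.coef_id {X : C} (h : IsScalar k X) : h.coef (𝟙 X) = 1 :=
  h.injective (by simp [h.coef_smul_id])

lemma IsScalar.coef_eq_zero {X : C} (h : IsScalar k X) {f : X ⟶ X} : h.coef f = 0 ↔ f = 0 :=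
  ⟨fun hf => by rw [← h.coef_smul_id f, hf, zero_smul], fun hf => by rw [hf, map_zero]⟩

lemma IsScalar.id_ne_zero {X : C} (h : IsScalar k X) : 𝟙 X ≠ 0 := fun h0 =>
  one_ne_zero (h.coef_id.symm.trans (h.coef_eq_zero.2 h0))

lemma IsScalar.of_iso {X Y : C} (h : IsScalar k X) (e : X ≅ Y) : IsScalar k Y := by
  constructor
  · intro a b hab
    refine h.injective ?_
    have := congrArg (fun f => e.hom ≫ f ≫ e.inv) hab
    simpa using this
  · intro f
    refine ⟨h.coef (e.hom ≫ f ≫ e.inv), ?_⟩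
    have := congrArg (fun f => e.inv ≫ f ≫ e.hom) (h.coef_smul_id (e.hom ≫ f ≫ e.inv))
    simpa using this

lemma _root_.LinearMap.exists_generalized_inverse {V W : Type*} [AddCommGroup V] [Module k V]
    [AddCommGroup W] [Module k W] (f : V →ₗ[k] W) :
    ∃ g : W →ₗ[k] V, ∀ x, f (g (f x)) = f x := by
  obtain ⟨s, hs⟩ := f.rangeRestrict.exists_rightInverse_of_surjective f.range_rangeRestrict
  obtain ⟨p, hp⟩ := (LinearMap.range f).subtype.exists_leftInverse_of_injective
    (LinearMap.range f).ker_subtype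
  refine ⟨s ∘ₗ p, fun x => ?_⟩
  have h1 : p (f x) = f.rangeRestrict x := LinearMap.congr_fun hp (f.rangeRestrict x)
  have h2 := congrArg Subtype.val (LinearMap.congr_fun hs (f.rangeRestrict x))
  rw [LinearMap.comp_apply, h1]
  exact h2

end Scalar

/-! ### Decompositions in fusion categories -/

namespace FusionStructure

variable {k : Type w} [Field k]
  {C : Type u} [Category.{v} C] [MonoidalCategory C] [RigidCategory C] [Preadditive C] [Linear k C]
  (F : FusionStructure k C)

lemma isScalar (i : F.I) : IsScalar k (F.V i) := F.end_eq_scalars i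

include F in
lemma isScalar_unit : IsScalar k (𝟙_ C) := by
  obtain ⟨i, ⟨e⟩⟩ := F.exists_unit_iso
  exact (F.isScalar i).of_iso e.symm

lemma exists_decomposition (X : C) : ∃ (n : ℕ) (j : Fin n → F.I) (q : ∀ a, F.V (j a) ⟶ X)
    (p : ∀ a, X ⟶ F.V (j a)), (∀ a, q a ≫ p a = 𝟙 _) ∧ (∀ a b, a ≠ b → q a ≫ p b = 0) ∧
      ∑ a, p a ≫ q a = 𝟙 X := by
  have := F.hasFiniteBiproducts
  obtain ⟨n, j, ⟨e⟩⟩ := F.exists_iso_biproduct X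
  refine ⟨n, j, fun a => biproduct.ι (fun a => F.V (j a)) a ≫ e.inv,
    fun a => e.hom ≫ biproduct.π (fun a => F.V (j a)) a, ?_, ?_, ?_⟩
  · intro a; simp
  · intro a b hab; simp [biproduct.ι_π_ne _ hab]
  · have h : ∑ a, (e.hom ≫ biproduct.π (fun a => F.V (j a)) a) ≫
        biproduct.ι (fun a => F.V (j a)) a ≫ e.inv =
        e.hom ≫ (∑ a, biproduct.π (fun a => F.V (j a)) a ≫
          biproduct.ι (fun a => F.V (j a)) a) ≫ e.inv := by
      simp only [Preadditive.sum_comp, Preadditive.comp_sum, Category.assoc]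
    rw [h, biproduct.total]; simp

/-- The index type of the copies of `V i` in `X`. -/
def Mult (X : C) (i : F.I) : Type :=
  {a : Fin (F.exists_decomposition X).choose //
    (F.exists_decomposition X).choose_spec.choose a = i}

instance (X : C) (i : F.I) : Fintype (F.Mult X i) := by
  classical exact inferInstanceAs (Fintype {a : Fin (F.exists_decomposition X).choose //
    (F.exists_decomposition X).choose_spec.choose a = i})

/-- The inclusions of the copies of `V i` into `X`. -/
def inj (X : C) (i : F.I) (a : F.Mult X i) : F.V i ⟶ X :=
  eqToHom (by rw [a.2]) ≫ (F.exists_decomposition X).choose_spec.choose_spec.choose a.1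

/-- The projections of `X` onto the copies of `V i`. -/
def proj (X : C) (i : F.I) (a : F.Mult X i) : X ⟶ F.V i :=
  (F.exists_decomposition X).choose_spec.choose_spec.choose_spec.choose a.1 ≫
    eqToHom (by rw [a.2])

lemma inj_proj_self (X : C) (i : F.I) (a : F.Mult X i) : F.inj X i a ≫ F.proj X i a = 𝟙 _ := by
  have h := (F.exists_decomposition X).choose_spec.choose_spec.choose_spec.choose_spec.1 a.1
  rw [inj, proj, Category.assoc, reassoc_of% h]
  simp

lemma inj_proj_ne (X : C) (i : F.I) (a b : F.Mult X i) (hab : a ≠ b) :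
    F.inj X i a ≫ F.proj X i b = 0 := by
  have h := (F.exists_decomposition X).choose_spec.choose_spec.choose_spec.choose_spec.2.1
    a.1 b.1 (fun h => hab (Subtype.ext h))
  rw [inj, proj, Category.assoc, reassoc_of% h]
  simp

open Classical in
lemma inj_proj (X : C) (i : F.I) (a b : F.Mult X i) :
    F.inj X i a ≫ F.proj X i b = if a = b then 𝟙 _ else 0 := by
  split_ifs with h
  · rw [h, inj_proj_self]
  · exact F.inj_proj_ne X i a b h

lemma total (X : C) : ∑ i, ∑ a, F.proj X i a ≫ F.inj X i a = 𝟙 X := by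
  classical
  have h := (F.exists_decomposition X).choose_spec.choose_spec.choose_spec.choose_spec.2.2
  rw [← h, ← Finset.sum_fiberwise Finset.univ (F.exists_decomposition X).choose_spec.choose]
  refine Finset.sum_congr rfl fun i _ => ?_
  rw [← Finset.sum_subtype (p := fun a => (F.exists_decomposition X).choose_spec.choose a = i)
    (Finset.univ.filter fun a => (F.exists_decomposition X).choose_spec.choose a = i)
    (fun a => by simp)
    (fun a => (F.exists_decomposition X).choose_spec.choose_spec.choose_spec.choose a ≫
      (F.exists_decomposition X).choose_spec.choose_spec.choose a) |>.symm]
  refine Finset.sum_congr rfl fun a _ => ?_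
  rw [inj, proj, Category.assoc, eqToHom_trans_assoc, eqToHom_refl, Category.id_comp]

lemma hom_ext {X Y : C} {f g : X ⟶ Y} (h : ∀ i (r : F.V i ⟶ X), r ≫ f = r ≫ g) : f = g := by
  rw [← Category.id_comp f, ← Category.id_comp g, ← F.total X]
  simp only [Preadditive.sum_comp, Category.assoc, h]

/-- The scalar of an endomorphism of `V i`. -/
abbrev coef (i : F.I) : (F.V i ⟶ F.V i) →ₗ[k] k := (F.isScalar i).coef

lemma expand {X : C} {i : F.I} (r : F.V i ⟶ X) :
    r = ∑ a, F.coef i (r ≫ F.proj X i a) • F.inj X i a := by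
  conv_lhs => rw [← Category.comp_id r, ← F.total X, Preadditive.comp_sum]
  rw [Finset.sum_eq_single i]
  · rw [Preadditive.comp_sum]
    refine Finset.sum_congr rfl fun a _ => ?_
    conv_lhs => rw [← Category.assoc, ← (F.isScalar i).coef_smul_id (r ≫ F.proj X i a)]
    simp
  · intro j _ hj
    rw [Preadditive.comp_sum]
    refine Finset.sum_eq_zero fun a _ => ?_
    rw [← Category.assoc, F.hom_eq_zero i j hj.symm (r ≫ F.proj X j a), zero_comp]
  · simp

include F in
lemma finite_hom (X Y : C) : Module.Finite k (X ⟶ Y) := by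
  have : ∀ i : F.I, Module.Finite k (F.V i ⟶ F.V i) := fun i =>
    Module.Finite.equiv (LinearEquiv.ofBijective
      (LinearMap.toSpanSingleton k (F.V i ⟶ F.V i) (𝟙 _)) (F.isScalar i))
  let L : (X ⟶ Y) →ₗ[k] (Π i : F.I, Π _ : F.Mult X i × F.Mult Y i, F.V i ⟶ F.V i) :=
    LinearMap.pi fun i => LinearMap.pi fun ab =>
      Linear.leftComp k _ (F.inj X i ab.1) ∘ₗ Linear.rightComp k _ (F.proj Y i ab.2)
  refine Module.Finite.of_injective L ?_
  rw [injective_iff_map_eq_zero]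
  intro f hf
  have h : ∀ i a b, F.inj X i a ≫ f ≫ F.proj Y i b = 0 := fun i a b =>
    congrFun (congrFun hf i) (a, b)
  refine F.hom_ext fun i r => ?_
  rw [F.expand r, Preadditive.sum_comp, comp_zero]
  refine Finset.sum_eq_zero fun a _ => ?_
  rw [Linear.smul_comp, F.expand (F.inj X i a ≫ f), Finset.sum_eq_zero, smul_zero]
  intro b _
  rw [Category.assoc, h, map_zero, zero_smul]

lemma expand' {X : C} {i : F.I} (r : X ⟶ F.V i) :
    r = ∑ a, F.coef i (F.inj X i a ≫ r) • F.proj X i a := by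
  conv_lhs => rw [← Category.id_comp r, ← F.total X, Preadditive.sum_comp]
  rw [Finset.sum_eq_single i]
  · rw [Preadditive.sum_comp]
    refine Finset.sum_congr rfl fun a _ => ?_
    conv_lhs => rw [Category.assoc, ← (F.isScalar i).coef_smul_id (F.inj X i a ≫ r)]
    simp
  · intro j _ hj
    rw [Preadditive.sum_comp]
    refine Finset.sum_eq_zero fun a _ => ?_
    rw [Category.assoc, F.hom_eq_zero j i hj (F.inj X j a ≫ r), comp_zero]
  · simp

/-- The morphism induced by linear maps between the spaces of morphisms from the `V i`. -/
def ofLinear {X Y : C} (L : ∀ i, (F.V i ⟶ X) →ₗ[k] (F.V i ⟶ Y)) : X ⟶ Y :=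
  ∑ i, ∑ a, F.proj X i a ≫ L i (F.inj X i a)

lemma comp_ofLinear {X Y : C} (L : ∀ i, (F.V i ⟶ X) →ₗ[k] (F.V i ⟶ Y)) {i : F.I}
    (r : F.V i ⟶ X) : r ≫ F.ofLinear L = L i r := by
  rw [ofLinear, Preadditive.comp_sum, Finset.sum_eq_single i]
  · conv_rhs => rw [F.expand r, map_sum]
    rw [Preadditive.comp_sum]
    refine Finset.sum_congr rfl fun a _ => ?_
    conv_lhs => rw [← Category.assoc, ← (F.isScalar i).coef_smul_id (r ≫ F.proj X i a)]
    simp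
  · intro j _ hj
    rw [Preadditive.comp_sum]
    refine Finset.sum_eq_zero fun a _ => ?_
    rw [← Category.assoc, F.hom_eq_zero i j hj.symm (r ≫ F.proj X j a), zero_comp]
  · simp

include F in
-- Morphisms are the same as families of linear maps on the spaces `Hom(V i, -)`, so generalized
-- inverses of linear maps can be reassembled by `ofLinear`.
lemma exists_generalized_inverse {X Y : C} (f : X ⟶ Y) : ∃ g : Y ⟶ X, f ≫ g ≫ f = f := by
  choose g hg using fun i =>
    (Linear.rightComp k (F.V i) f).exists_generalized_inverse
  refine ⟨F.ofLinear g, F.hom_ext fun i r => ?_⟩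
  rw [← Category.assoc, ← Category.assoc, comp_ofLinear]
  exact hg i r

include F in
-- The image is built as a sum of copies of `V i`, one for each basis vector of the range of `e` on
-- `Hom(V i, X)`.
lemma exists_split {X : C} (e : X ⟶ X) (he : e ≫ e = e) :
    ∃ (Y : C) (s : Y ⟶ X) (t : X ⟶ Y), s ≫ t = 𝟙 Y ∧ t ≫ s = e := by
  have := F.hasFiniteBiproducts
  have := F.finite_hom
  let R (i : F.I) : Submodule k (F.V i ⟶ X) := LinearMap.range (Linear.rightComp k (F.V i) e)
  let b (i : F.I) := Module.finBasis k (R i)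
  let Y : C := ⨁ fun z : Σ i, Fin (Module.finrank k (R i)) => F.V z.1
  let s : Y ⟶ X := biproduct.desc fun z => (b z.1 z.2).1
  let t : X ⟶ Y := F.ofLinear fun i =>
    ((b i).constr k (fun l => biproduct.ι (fun z : Σ i, Fin (Module.finrank k (R i)) => F.V z.1)
      ⟨i, l⟩)) ∘ₗ (Linear.rightComp k (F.V i) e).rangeRestrict
  have hb : ∀ i l, (b i l).1 ≫ e = (b i l).1 := by
    intro i l
    obtain ⟨r, hr⟩ := (b i l).2
    have hr' : r ≫ e = (b i l).1 := hr
    rw [← hr', Category.assoc, he]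
  refine ⟨Y, s, t, ?_, ?_⟩
  · refine biproduct.hom_ext' _ _ fun z => ?_
    rw [biproduct.ι_desc_assoc, Category.comp_id, comp_ofLinear, LinearMap.comp_apply]
    have : (Linear.rightComp k (F.V z.1) e).rangeRestrict (b z.1 z.2).1 = b z.1 z.2 :=
      Subtype.ext (hb _ _)
    rw [this, Module.Basis.constr_basis]
  · refine F.hom_ext fun i r => ?_
    rw [← Category.assoc, comp_ofLinear, LinearMap.comp_apply]
    have h : ∀ x : R i, ((b i).constr k (fun l => biproduct.ι
        (fun z : Σ i, Fin (Module.finrank k (R i)) => F.V z.1) ⟨i, l⟩)) x ≫ s = x.1 := by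
      intro x
      refine LinearMap.congr_fun (f := Linear.rightComp k (F.V i) s ∘ₗ _) (g := (R i).subtype)
        ((b i).ext fun l => ?_) x
      simp [s, Y]
    rw [h]; rfl

end FusionStructure

end CategoricalCenter

namespace CategoricalCenter

namespace SovereignStructure

variable {C : Type u} [Category.{v} C] [MonoidalCategory C] [RightRigidCategory C]
  (S : SovereignStructure C)

lemma cv_dual_rightEv (X : C) :
    𝟙 X ⊗≫ X ◁ cv (dual X) ⊗≫ S.rightEv X ▷ dual (dual X) ⊗≫ 𝟙 _ = (S.φ X).hom :=
  calc
    _ = 𝟙 _ ⊗≫ (X ◁ cv (dual X) ≫ (S.φ X).hom ▷ (dual X ⊗ dual (dual X))) ⊗≫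
        ev (dual X) ▷ dual (dual X) ⊗≫ 𝟙 _ := by rw [rightEv_eq]; monoidal
    _ = (S.φ X).hom ⊗≫ (dual (dual X) ◁ cv (dual X) ⊗≫ ev (dual X) ▷ dual (dual X)) ⊗≫ 𝟙 _ := by
      rw [whisker_exchange]; monoidal
    _ = _ := by rw [dual_cv_ev]; monoidal

lemma cv_rightEv_dual (X : C) :
    𝟙 _ ⊗≫ cv X ▷ dual (dual X) ⊗≫ X ◁ S.rightEv (dual X) ⊗≫ 𝟙 X = (S.φ X).inv := by
  rw [← cancel_epi (S.φ X).hom, Iso.hom_inv_id]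
  calc
    _ = 𝟙 _ ⊗≫ (𝟙_ C ◁ (S.φ X).hom ≫ cv X ▷ dual (dual X)) ⊗≫
        X ◁ S.rightEv (dual X) ⊗≫ 𝟙 X := by monoidal
    _ = 𝟙 _ ⊗≫ cv X ▷ X ⊗≫ X ◁ (dual X ◁ (S.φ X).hom ≫ S.rightEv (dual X)) ⊗≫ 𝟙 X := by
      rw [whisker_exchange]; monoidal
    _ = 𝟙 _ ⊗≫ (cv X ▷ X ⊗≫ X ◁ ev X) ⊗≫ 𝟙 X := by rw [φ_rightEv_dual]; monoidal
    _ = _ := by rw [cv_ev]; monoidal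

/-- Closing a `U*` strand between a cap and a cup leaves a zigzag through `U**` on each side. They
straighten to `φ` and its inverse, which cancel. -/
lemma ptr_whisker_dual {A B : C} (U : C) (G : A ⟶ B) :
    S.ptr (V := dual U) (((α_ A U (dual U)).hom ≫ A ◁ S.rightEv U ≫ (ρ_ A).hom) ≫ G ≫
      ((ρ_ B).inv ≫ B ◁ cv U ≫ (α_ B U (dual U)).inv)) = G ▷ U :=
  calc
    _ = 𝟙 _ ⊗≫ A ◁ (𝟙 U ⊗≫ U ◁ cv (dual U) ⊗≫ S.rightEv U ▷ dual (dual U) ⊗≫ 𝟙 (dual (dual U))) ⊗≫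
        G ▷ dual (dual U) ⊗≫
        B ◁ (𝟙 (dual (dual U)) ⊗≫ cv U ▷ dual (dual U) ⊗≫ U ◁ S.rightEv (dual U) ⊗≫ 𝟙 U) ⊗≫ 𝟙 _ := by
      rw [ptr]; monoidal
    _ = (A ◁ (S.φ U).hom ≫ G ▷ dual (dual U)) ≫ B ◁ (S.φ U).inv := by
      rw [cv_dual_rightEv, cv_rightEv_dual]; monoidal
    _ = _ := by
      rw [whisker_exchange, Category.assoc, ← MonoidalCategory.whiskerLeft_comp, Iso.hom_inv_id,
        MonoidalCategory.whiskerLeft_id, Category.comp_id]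

/-- The rotation of a morphism `U ⊗ V ⟶ Y`. -/
def rotate {U V Y : C} (p : U ⊗ V ⟶ Y) : V ⟶ dual U ⊗ Y :=
  𝟙 _ ⊗≫ S.rightCv U ▷ V ⊗≫ dual U ◁ p

/-- The rotation of a morphism `Y ⟶ U ⊗ V`. -/
def corotate {U V Y : C} (q : Y ⟶ U ⊗ V) : dual U ⊗ Y ⟶ V :=
  dual U ◁ q ⊗≫ ev U ▷ V ⊗≫ 𝟙 _

lemma rotate_comp_corotate {U V W Y : C} (p : U ⊗ V ⟶ Y) (q : Y ⟶ U ⊗ W) :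
    S.rotate p ≫ corotate q = S.ptrL (p ≫ q) := by
  rw [rotate, corotate, ptrL]; monoidal

lemma rotate_rightEv {U V Y : C} (p : U ⊗ V ⟶ Y) :
    U ◁ S.rotate p ⊗≫ S.rightEv U ▷ Y ⊗≫ 𝟙 _ = p :=
  calc
    _ = 𝟙 _ ⊗≫ U ◁ S.rightCv U ▷ V ⊗≫ ((U ⊗ dual U) ◁ p ≫ S.rightEv U ▷ Y) ⊗≫ 𝟙 _ := by
      rw [rotate]; monoidal
    _ = 𝟙 _ ⊗≫ (U ◁ S.rightCv U ⊗≫ S.rightEv U ▷ U) ▷ V ⊗≫ p := by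
      rw [whisker_exchange]; monoidal
    _ = _ := by rw [self_rightCv_rightEv]; monoidal

lemma rotate_whiskerLeft_rightEv {U V Y : C} (r : V ⟶ dual U ⊗ Y) :
    S.rotate (U ◁ r ⊗≫ S.rightEv U ▷ Y ⊗≫ 𝟙 _) = r :=
  calc
    _ = 𝟙 _ ⊗≫ (S.rightCv U ▷ V ≫ (dual U ⊗ U) ◁ r) ⊗≫ dual U ◁ S.rightEv U ▷ Y ⊗≫ 𝟙 _ := by
      rw [rotate]; monoidal
    _ = r ⊗≫ (S.rightCv U ▷ dual U ⊗≫ dual U ◁ S.rightEv U) ▷ Y ⊗≫ 𝟙 _ := by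
      rw [← whisker_exchange]; monoidal
    _ = _ := by rw [rightCv_rightEv]; monoidal

lemma cv_corotate {U V Y : C} (q : Y ⟶ U ⊗ V) :
    𝟙 _ ⊗≫ cv U ▷ Y ⊗≫ U ◁ corotate q = q :=
  calc
    _ = 𝟙 _ ⊗≫ (cv U ▷ Y ≫ (U ⊗ dual U) ◁ q) ⊗≫ U ◁ ev U ▷ V ⊗≫ 𝟙 _ := by
      rw [corotate]; monoidal
    _ = q ⊗≫ (cv U ▷ U ⊗≫ U ◁ ev U) ▷ V ⊗≫ 𝟙 _ := by
      rw [← whisker_exchange]; monoidal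
    _ = _ := by rw [cv_ev]; monoidal

/-- The open `U` strand is bent around: `p` and `q` are replaced by their rotations, which then meet
on the traced strand `U* ⊗ Y` by cyclicity. The handle slide needs only the composite `corotate q ≫
rotate p`. -/
lemma ptr_rotate {A B U V Y : C} (p : U ⊗ V ⟶ Y) (q : Y ⟶ U ⊗ V) (g : A ⊗ Y ⟶ B ⊗ Y) :
    S.ptr ((α_ A U V).hom ≫ (A ◁ p ≫ g ≫ B ◁ q) ≫ (α_ B U V).inv) =
      S.ptr (((α_ (A ⊗ U) (dual U) Y).inv ≫
        (((α_ A U (dual U)).hom ≫ A ◁ S.rightEv U ≫ (ρ_ A).hom) ▷ Y ≫ g ≫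
          ((ρ_ B).inv ≫ B ◁ cv U ≫ (α_ B U (dual U)).inv) ▷ Y) ≫
        (α_ (B ⊗ U) (dual U) Y).hom) ≫ (B ⊗ U) ◁ (corotate q ≫ S.rotate p)) := by
  conv_rhs => rw [MonoidalCategory.whiskerLeft_comp, ← Category.assoc, ← ptr_cyclic]
  congr 1
  conv_lhs => rw [← S.rotate_rightEv p, ← cv_corotate q]
  monoidal

lemma ptr_rotate_id {A B : C} (U : C) {Y : C} (g : A ⊗ Y ⟶ B ⊗ Y) :
    S.ptr ((α_ (A ⊗ U) (dual U) Y).inv ≫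
        (((α_ A U (dual U)).hom ≫ A ◁ S.rightEv U ≫ (ρ_ A).hom) ▷ Y ≫ g ≫
          ((ρ_ B).inv ≫ B ◁ cv U ≫ (α_ B U (dual U)).inv) ▷ Y) ≫
        (α_ (B ⊗ U) (dual U) Y).hom) = S.ptr g ▷ U := by
  rw [ptr_tensor, Category.assoc, Category.assoc, Iso.hom_inv_id, Category.comp_id,
    Iso.hom_inv_id_assoc, ptr_comp, ptr_whisker_dual]

section Linear

variable {k : Type w} [Field k] [Preadditive C] [Linear k C]
  [MonoidalPreadditive C] [MonoidalLinear k C]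

variable (k) in
/-- The partial trace as a linear map. -/
def ptrₗ (A B V : C) : (A ⊗ V ⟶ B ⊗ V) →ₗ[k] (A ⟶ B) where
  toFun h := S.ptr h
  map_add' f g := by simp [ptr, monoidalComp, MonoidalPreadditive.add_whiskerRight]
  map_smul' a f := by simp [ptr, monoidalComp, MonoidalLinear.smul_whiskerRight]

lemma ptrₗ_apply {A B V : C} (h : A ⊗ V ⟶ B ⊗ V) : S.ptrₗ k A B V h = S.ptr h := rfl

variable (k) in
/-- The right trace as a linear map. -/
def trRₗ (X : C) : (X ⟶ X) →ₗ[k] (𝟙_ C ⟶ 𝟙_ C) where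
  toFun f := S.trR f
  map_add' f g := by
    simp [trR_eq, MonoidalPreadditive.add_whiskerRight]
  map_smul' a f := by
    simp [trR_eq, MonoidalLinear.smul_whiskerRight]

lemma rotate_sum_smul {U V Y : C} {ι : Type*} (s : Finset ι) (c : ι → k) (p : ι → (U ⊗ V ⟶ Y)) :
    S.rotate (∑ a ∈ s, c a • p a) = ∑ a ∈ s, c a • S.rotate (p a) := by
  simp [rotate, monoidalComp, whiskerLeft_sum, Preadditive.comp_sum]

end Linear

end SovereignStructure

end CategoricalCenter

namespace CategoricalCenter

/-! ### Traces and averages in spherical fusion categories -/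

namespace FusionStructure

open SovereignStructure

variable {k : Type w} [Field k]
  {C : Type u} [Category.{v} C] [MonoidalCategory C] [RigidCategory C] [Preadditive C] [Linear k C]
  [MonoidalPreadditive C] [MonoidalLinear k C] (F : FusionStructure k C) (S : SovereignStructure C)

/-- The trace with values in `k`. -/
def tr (X : C) : (X ⟶ X) →ₗ[k] k := F.isScalar_unit.coef ∘ₗ S.trRₗ k X

lemma trR_eq_tr {X : C} (f : X ⟶ X) : S.trR f = F.tr S X f • 𝟙 (𝟙_ C) :=
  (F.isScalar_unit.coef_smul_id _).symm

lemma tr_eq_of_trR {X Y : C} {f : X ⟶ X} {g : Y ⟶ Y} (h : S.trR f = S.trR g) :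
    F.tr S X f = F.tr S Y g := congrArg F.isScalar_unit.coef h

lemma tr_comm {X Y : C} (f : X ⟶ Y) (g : Y ⟶ X) : F.tr S X (f ≫ g) = F.tr S Y (g ≫ f) :=
  F.tr_eq_of_trR S (S.trR_comm f g)

/-- The dimension with values in `k`. -/
def d (X : C) : k := F.tr S X (𝟙 X)

lemma dimR_eq (X : C) : S.dimR X = F.d S X • 𝟙 (𝟙_ C) := F.trR_eq_tr S (𝟙 X)

lemma ptr_whiskerRight {A B : C} (V : C) (g : A ⟶ B) : S.ptr (g ▷ V) = F.d S V • g := by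
  rw [S.ptr_whiskerRight, F.dimR_eq S]
  simp [MonoidalLinear.whiskerLeft_smul]

lemma tr_ptr {M V : C} (h : M ⊗ V ⟶ M ⊗ V) : F.tr S M (S.ptr h) = F.tr S (M ⊗ V) h :=
  F.tr_eq_of_trR S (S.trR_ptr h)

lemma tr_whiskerLeft (V : C) {M : C} (f : M ⟶ M) :
    F.tr S (V ⊗ M) (V ◁ f) = F.d S V * F.tr S M f := by
  refine F.isScalar_unit.injective ?_
  rw [← F.trR_eq_tr S, S.trR_whiskerLeft, F.trR_eq_tr S f, mul_comm, mul_smul, ← F.dimR_eq S]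
  simp [MonoidalLinear.whiskerLeft_smul, MonoidalLinear.smul_whiskerRight, SovereignStructure.dimR,
    SovereignStructure.trR_eq]

lemma tr_eq_coef (i : F.I) (f : F.V i ⟶ F.V i) :
    F.tr S _ f = F.coef i f * F.d S (F.V i) := by
  conv_lhs => rw [← (F.isScalar i).coef_smul_id f, map_smul]
  rfl

/-- The right evaluation is non-zero, so it has a non-zero composite with some `𝟙_ ⟶ X ⊗ X*`; as `X`
is scalar, that morphism is a multiple of the coevaluation, and the composite is a multiple of the
dimension. -/
lemma d_ne_zero (i : F.I) : F.d S (F.V i) ≠ 0 := by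
  intro h0
  set X := F.V i
  have hr : S.rightEv X ≠ 0 := by
    intro h
    have h1 := S.self_rightCv_rightEv X
    rw [h] at h1
    have h2 : 𝟙 X = (ρ_ X).inv ≫ (X ◁ S.rightCv X ⊗≫ (0 : X ⊗ dual X ⟶ 𝟙_ C) ▷ X) ≫
        (λ_ X).hom := by rw [h1]; monoidal
    refine (F.isScalar i).id_ne_zero (h2.trans ?_)
    simp [monoidalComp]
  obtain ⟨g, hg⟩ := F.exists_generalized_inverse (S.rightEv X)
  have h1 : g ≫ S.rightEv X ≠ 0 := by
    intro h
    rw [h, comp_zero] at hg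
    exact hr hg.symm
  -- Every `𝟙_ ⟶ X ⊗ X*` is the coevaluation followed by an endomorphism of `X`, hence a scalar
  -- multiple of the coevaluation.
  have h2 : g = cv X ≫ ((λ_ X).inv ≫ (g ▷ X ≫ (α_ _ _ _).hom) ≫ X ◁ ev X ≫ (ρ_ X).hom) ▷ dual X :=
    calc
      g = g ⊗≫ X ◁ (dual X ◁ cv X ⊗≫ ev X ▷ dual X) ⊗≫ 𝟙 _ := by rw [dual_cv_ev]; monoidal
      _ = 𝟙 _ ⊗≫ (g ▷ 𝟙_ C ≫ (X ⊗ dual X) ◁ cv X) ⊗≫ X ◁ ev X ▷ dual X ⊗≫ 𝟙 _ := by monoidal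
      _ = _ := by rw [← whisker_exchange]; monoidal
  rw [h2, ← (F.isScalar i).coef_smul_id (_ ≫ _ ≫ _ ≫ _)] at h1
  refine h1 ?_
  rw [MonoidalLinear.smul_whiskerRight, Linear.comp_smul, Linear.smul_comp]
  have h3 : (cv X ≫ 𝟙 X ▷ dual X) ≫ S.rightEv X = 0 := by
    rw [Category.assoc]
    change S.dimR X = 0
    rw [F.dimR_eq S, h0, zero_smul]
  rw [h3, smul_zero]

/-- Testing against `proj ≫ r` reduces the trace to a matrix entry of `f` times `d (V i)`, and the
latter is non-zero. -/
lemma eq_zero_of_tr {X Y : C} (f : X ⟶ Y) (h : ∀ g : Y ⟶ X, F.tr S X (f ≫ g) = 0) : f = 0 := by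
  refine F.hom_ext fun i r => ?_
  rw [F.expand (r ≫ f), comp_zero]
  refine Finset.sum_eq_zero fun b _ => ?_
  have h1 := h (F.proj Y i b ≫ r)
  rw [← Category.assoc, F.tr_comm S, F.tr_eq_coef S] at h1
  rw [Category.assoc, (mul_eq_zero.1 h1).resolve_right (F.d_ne_zero S i), zero_smul]

lemma eq_of_tr {X Y : C} (f f' : X ⟶ Y)
    (h : ∀ g : Y ⟶ X, F.tr S X (f ≫ g) = F.tr S X (f' ≫ g)) : f = f' := by
  refine sub_eq_zero.1 (F.eq_zero_of_tr S _ fun g => ?_)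
  rw [Preadditive.sub_comp, map_sub, h, sub_self]

variable {S} (hS : S.IsSpherical)
include hS

lemma tr_ptrL {U V : C} (g : U ⊗ V ⟶ U ⊗ V) : F.tr S V (S.ptrL g) = F.tr S (U ⊗ V) g :=
  F.tr_eq_of_trR S (by rw [← hS, S.trL_ptrL, hS])

open Classical in
-- Both sides are scalars on `V j`, so traces decide. Sphericity enters here: the left partial trace
-- over `U` has the same right trace as `inj ≫ proj` on `V i`.
lemma rotate_corotate (U : C) (i j : F.I) (a b : F.Mult (U ⊗ F.V j) i) :
    F.d S (F.V j) • (S.rotate (F.proj _ i b) ≫ corotate (F.inj _ i a)) =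
      if a = b then F.d S (F.V i) • 𝟙 (F.V j) else 0 := by
  have h : F.tr S (F.V j) (S.rotate (F.proj _ i b) ≫ corotate (F.inj _ i a)) =
      if a = b then F.d S (F.V i) else 0 := by
    rw [S.rotate_comp_corotate, F.tr_ptrL hS, F.tr_comm, F.inj_proj]
    split_ifs
    · rfl
    · exact map_zero _
  rw [F.tr_eq_coef, mul_comm] at h
  rw [← (F.isScalar j).coef_smul_id (_ ≫ _), smul_smul]
  refine (congrArg (· • 𝟙 (F.V j)) h).trans ?_
  split_ifs
  · rfl
  · exact zero_smul _ _

/-- Rotation turns dual bases for the copies of `V i` in `U ⊗ V j` into dual bases for the copies of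
`V j` in `U* ⊗ V i`, up to the factor `d (V i) / d (V j)`. Summing over `j` therefore resolves the
identity. -/
lemma casimir (U : C) (i : F.I) :
    ∑ j, ∑ a : F.Mult (U ⊗ F.V j) i,
      F.d S (F.V j) • (corotate (F.inj _ i a) ≫ S.rotate (F.proj _ i a)) =
      F.d S (F.V i) • 𝟙 (dual U ⊗ F.V i) := by
  refine F.hom_ext fun j r => ?_
  have h : ∀ b, S.rotate (F.proj (U ⊗ F.V j) i b) ≫ (∑ j, ∑ a : F.Mult (U ⊗ F.V j) i,
      F.d S (F.V j) • (corotate (F.inj _ i a) ≫ S.rotate (F.proj _ i a))) =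
      F.d S (F.V i) • S.rotate (F.proj (U ⊗ F.V j) i b) := by
    intro b
    rw [Preadditive.comp_sum, Finset.sum_eq_single j, Preadditive.comp_sum,
      Finset.sum_eq_single b]
    · rw [Linear.comp_smul, ← Category.assoc, ← Linear.smul_comp, F.rotate_corotate hS, if_pos rfl,
        Linear.smul_comp, Category.id_comp]
    · intro a _ hab
      rw [Linear.comp_smul, ← Category.assoc, ← Linear.smul_comp, F.rotate_corotate hS, if_neg hab,
        zero_comp]
    · simp
    · intro l _ hl
      rw [Preadditive.comp_sum]
      refine Finset.sum_eq_zero fun a _ => ?_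
      rw [Linear.comp_smul, ← Category.assoc,
        F.hom_eq_zero j l hl.symm (S.rotate _ ≫ _), zero_comp, smul_zero]
    · simp
  rw [← S.rotate_whiskerLeft_rightEv r, F.expand' (U ◁ r ⊗≫ S.rightEv U ▷ F.V i ⊗≫ 𝟙 _),
    S.rotate_sum_smul, Preadditive.sum_comp, Preadditive.sum_comp]
  refine Finset.sum_congr rfl fun b _ => ?_
  rw [Linear.smul_comp, h, Linear.smul_comp, Linear.comp_smul, Category.comp_id]

/-- The handle slide. -/
lemma handle_slide {A B : C} (h : ∀ V : C, A ⊗ V ⟶ B ⊗ V)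
    (hn : ∀ {V V' : C} (f : V ⟶ V'), A ◁ f ≫ h V' = h V ≫ B ◁ f) (U : C) :
    (∑ i, F.d S (F.V i) • S.ptr (h (F.V i))) ▷ U =
      ∑ j, F.d S (F.V j) •
        S.ptr ((α_ A U (F.V j)).hom ≫ h (U ⊗ F.V j) ≫ (α_ B U (F.V j)).inv) := by
  -- Naturality of `h` lets it be evaluated on the summands `V i` of `U ⊗ V j`.
  have hd : ∀ j, h (U ⊗ F.V j) = ∑ i, ∑ a : F.Mult (U ⊗ F.V j) i,
      A ◁ F.proj _ i a ≫ h (F.V i) ≫ B ◁ F.inj _ i a := by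
    intro j
    conv_lhs => rw [← Category.comp_id (h (U ⊗ F.V j)), ← MonoidalCategory.whiskerLeft_id,
      ← F.total (U ⊗ F.V j)]
    simp only [whiskerLeft_sum, Preadditive.comp_sum, MonoidalCategory.whiskerLeft_comp]
    refine Finset.sum_congr rfl fun i _ => Finset.sum_congr rfl fun a _ => ?_
    rw [← Category.assoc, ← hn, Category.assoc]
  have hp : ∀ j, F.d S (F.V j) •
      S.ptr ((α_ A U (F.V j)).hom ≫ h (U ⊗ F.V j) ≫ (α_ B U (F.V j)).inv) =
      ∑ i, ∑ a : F.Mult (U ⊗ F.V j) i, S.ptr (((α_ (A ⊗ U) (dual U) (F.V i)).inv ≫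
        (((α_ A U (dual U)).hom ≫ A ◁ S.rightEv U ≫ (ρ_ A).hom) ▷ F.V i ≫ h (F.V i) ≫
          ((ρ_ B).inv ≫ B ◁ cv U ≫ (α_ B U (dual U)).inv) ▷ F.V i) ≫
        (α_ (B ⊗ U) (dual U) (F.V i)).hom) ≫ (B ⊗ U) ◁ (F.d S (F.V j) •
          (corotate (F.inj _ i a) ≫ S.rotate (F.proj _ i a)))) := by
    intro j
    rw [hd]
    simp only [Preadditive.sum_comp, Preadditive.comp_sum, ← S.ptrₗ_apply (k := k), map_sum,
      Finset.smul_sum, MonoidalLinear.whiskerLeft_smul, Linear.comp_smul, map_smul]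
    refine Finset.sum_congr rfl fun i _ => Finset.sum_congr rfl fun a _ => ?_
    rw [S.ptrₗ_apply, S.ptr_rotate, S.ptrₗ_apply]
  simp only [hp]
  -- With the order of summation exchanged, the inner sum over `j` for fixed `i` is exactly the one
  -- evaluated by `casimir`.
  rw [Finset.sum_comm, sum_whiskerRight]
  refine Finset.sum_congr rfl fun i _ => ?_
  simp only [← S.ptrₗ_apply (k := k), ← map_sum, ← Preadditive.comp_sum, ← whiskerLeft_sum]
  rw [F.casimir hS, MonoidalLinear.whiskerLeft_smul, Linear.comp_smul, map_smul,
    MonoidalLinear.smul_whiskerRight, MonoidalCategory.whiskerLeft_id, Category.comp_id,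
    S.ptrₗ_apply, S.ptrₗ_apply, S.ptr_rotate_id]

lemma sum_d_mul_d : F.isScalar_unit.coef (F.dim S) = ∑ i, F.d S (F.V i) * F.d S (F.V i) := by
  refine F.isScalar_unit.injective ?_
  rw [F.isScalar_unit.coef_smul_id, FusionStructure.dim, Finset.sum_smul]
  refine Finset.sum_congr rfl fun i _ => ?_
  have h : S.dimL (F.V i) = S.dimR (F.V i) := hS _ _
  rw [h, F.dimR_eq S, mul_smul]
  simp [End.mul_def]

end FusionStructure

lemma _root_.CategoryTheory.HalfBraiding.monoidal_inv {C : Type u} [Category.{v} C]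
    [MonoidalCategory C] {X : C} (b : HalfBraiding X) (U U' : C) :
    (b.β (U ⊗ U')).inv = (α_ _ _ _).hom ≫ U ◁ (b.β U').inv ≫ (α_ _ _ _).inv ≫
      (b.β U).inv ▷ U' ≫ (α_ _ _ _).hom := by
  rw [← cancel_epi (b.β (U ⊗ U')).hom, Iso.hom_inv_id, HalfBraiding.monoidal]
  simp

namespace FusionStructure

open SovereignStructure

variable {k : Type w} [Field k]
  {C : Type u} [Category.{v} C] [MonoidalCategory C] [RigidCategory C] [Preadditive C] [Linear k C]
  [MonoidalPreadditive C] [MonoidalLinear k C] (F : FusionStructure k C) (S : SovereignStructure C)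

/-- Conjugation of a morphism by half braidings. -/
def conj {M N : Center C} (f : M.1 ⟶ N.1) (V : C) : M.1 ⊗ V ⟶ N.1 ⊗ V :=
  (M.2.β V).hom ≫ V ◁ f ≫ (N.2.β V).inv

/-- The average of a morphism, up to a factor. -/
def avgHom {M N : Center C} (f : M.1 ⟶ N.1) : M.1 ⟶ N.1 :=
  ∑ i, F.d S (F.V i) • S.ptr (conj f (F.V i))

omit [RigidCategory C] [Preadditive C] [MonoidalPreadditive C] in
lemma conj_naturality {M N : Center C} (f : M.1 ⟶ N.1) {V V' : C} (g : V ⟶ V') :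
    M.1 ◁ g ≫ conj f V' = conj f V ≫ N.1 ◁ g := by
  have h : g ▷ N.1 ≫ (N.2.β V').inv = (N.2.β V).inv ≫ N.1 ◁ g := by
    rw [Iso.eq_inv_comp, ← Category.assoc, ← HalfBraiding.naturality, Category.assoc,
      Iso.hom_inv_id, Category.comp_id]
  rw [conj, conj, HalfBraiding.naturality_assoc, ← whisker_exchange_assoc, h]
  simp

omit [RigidCategory C] [Preadditive C] [MonoidalPreadditive C] in
-- The hexagon for half braidings: after the handle slide the strand `U` sits outside the partial
-- trace over `V`, framed by the half braidings with `U`. This is what makes the average central.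
lemma conj_tensor {M N : Center C} (f : M.1 ⟶ N.1) (U V : C) :
    (α_ M.1 U V).hom ≫ conj f (U ⊗ V) ≫ (α_ N.1 U V).inv =
      (M.2.β U).hom ▷ V ≫ ((α_ U M.1 V).hom ≫ U ◁ conj f V ≫ (α_ U N.1 V).inv) ≫
        (N.2.β U).inv ▷ V := by
  rw [conj, conj, HalfBraiding.monoidal, HalfBraiding.monoidal_inv]
  simp

/-- The average of a morphism of `C`, up to a factor. -/
@[simps]
def avg (hS : S.IsSpherical) (M N : Center C) (f : M.1 ⟶ N.1) : M ⟶ N where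
  f := F.avgHom S f
  comm U := by
    have h := F.handle_slide hS (conj f) (conj_naturality f) U
    rw [avgHom, h, Preadditive.sum_comp, whiskerLeft_sum, Preadditive.comp_sum]
    refine Finset.sum_congr rfl fun j _ => ?_
    rw [conj_tensor, S.ptr_comp, S.ptr_whiskerLeft, MonoidalLinear.whiskerLeft_smul,
      Linear.smul_comp, Linear.comp_smul]
    simp

lemma avgHom_comp {M M' N N' : Center C} (a : M' ⟶ M) (f : M.1 ⟶ N.1) (b : N ⟶ N') :
    F.avgHom S (M := M') (N := N') (a.f ≫ f ≫ b.f) = a.f ≫ F.avgHom S f ≫ b.f := by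
  rw [avgHom, avgHom, Preadditive.sum_comp, Preadditive.comp_sum]
  refine Finset.sum_congr rfl fun i _ => ?_
  rw [Linear.smul_comp, Linear.comp_smul, ← S.ptr_comp]
  congr 2
  have h : (N.2.β (F.V i)).inv ≫ b.f ▷ F.V i = F.V i ◁ b.f ≫ (N'.2.β (F.V i)).inv := by
    rw [Iso.inv_comp_eq, ← Category.assoc, ← b.comm, Category.assoc,
      Iso.hom_inv_id, Category.comp_id]
  simp only [conj, Category.assoc, h, MonoidalCategory.whiskerLeft_comp, a.comm_assoc]

lemma avgHom_id (hS : S.IsSpherical) (M : Center C) :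
    F.avgHom S (𝟙 M.1) = F.isScalar_unit.coef (F.dim S) • 𝟙 M.1 := by
  rw [avgHom, F.sum_d_mul_d hS, Finset.sum_smul]
  refine Finset.sum_congr rfl fun i _ => ?_
  have h : conj (𝟙 M.1) (F.V i) = 𝟙 M.1 ▷ F.V i := by simp [conj]
  rw [h, F.ptr_whiskerRight, smul_smul]

/-- Under the full trace the two half braidings are inverse to each other and cancel by cyclicity,
leaving the trace of `V i ◁ f`. -/
lemma tr_avgHom (hS : S.IsSpherical) (M : Center C) (f : M.1 ⟶ M.1) :
    F.tr S M.1 (F.avgHom S f) = F.isScalar_unit.coef (F.dim S) * F.tr S M.1 f := by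
  rw [avgHom, F.sum_d_mul_d hS, Finset.sum_mul, map_sum]
  refine Finset.sum_congr rfl fun i _ => ?_
  rw [map_smul, F.tr_ptr, conj, F.tr_comm]
  simp only [Category.assoc, Iso.inv_hom_id, Category.comp_id]
  rw [F.tr_whiskerLeft, smul_eq_mul, mul_assoc]

end FusionStructure

end CategoricalCenter

namespace CategoricalCenter

/-! ### Constructions of half braidings -/

section

variable {C : Type u} [Category.{v} C] [MonoidalCategory C]

/-- The unit condition is automatic: compatibility with `𝟙_ ⊗ 𝟙_` makes the component at `𝟙_`
idempotent, and it is invertible. -/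
lemma halfBraiding_unit {X : C} (b : HalfBraiding X) :
    (b.β (𝟙_ C)).hom = (ρ_ X).hom ≫ (λ_ X).inv := by
  set t : X ⟶ X := (ρ_ X).inv ≫ (b.β (𝟙_ C)).hom ≫ (λ_ X).hom with ht
  have h0 : (b.β (𝟙_ C)).hom = (ρ_ X).hom ≫ t ≫ (λ_ X).inv := by simp [ht]
  have h1 : t ≫ t = t := by
    have h2 := b.naturality (λ_ (𝟙_ C)).hom
    rw [HalfBraiding.monoidal, h0] at h2
    have h3 : t = 𝟙 X ⊗≫ (X ◁ (λ_ (𝟙_ C)).hom ≫ (ρ_ X).hom ≫ t ≫ (λ_ X).inv) ⊗≫ 𝟙 X := by monoidal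
    conv_rhs => rw [h3, h2]
    monoidal
  have : IsIso t := by rw [ht]; infer_instance
  have h2 : t = 𝟙 X := by rw [← cancel_epi t, h1, Category.comp_id]
  rw [h0, h2, Category.id_comp]

/-- In a left rigid category, a lax half braiding is a half braiding. -/
def halfBraidingOfLax [LeftRigidCategory C] {X : C} (b : ∀ U : C, X ⊗ U ⟶ U ⊗ X)
    (hn : ∀ {U U' : C} (f : U ⟶ U'), X ◁ f ≫ b U' = b U ≫ f ▷ X)
    (hm : ∀ U U' : C, b (U ⊗ U') = (α_ _ _ _).inv ≫ b U ▷ U' ≫ (α_ _ _ _).hom ≫ U ◁ b U' ≫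
      (α_ _ _ _).inv)
    (h1 : b (𝟙_ C) = (ρ_ X).hom ≫ (λ_ X).inv) : HalfBraiding X where
  β U :=
    { hom := b U
      -- The inverse is `b` at the left dual, bent around. Multiplicativity merges it with `b U`
      -- into `b` of a tensor product, and naturality moves the (co)evaluation through, leaving a
      -- zigzag.
      inv := 𝟙 _ ⊗≫ U ◁ X ◁ η_ (HasLeftDual.leftDual U) U ⊗≫
        U ◁ b (HasLeftDual.leftDual U) ▷ U ⊗≫ ε_ (HasLeftDual.leftDual U) U ▷ X ▷ U ⊗≫ 𝟙 _
      hom_inv_id := by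
        set D := HasLeftDual.leftDual U
        calc
          _ = 𝟙 _ ⊗≫ (b U ▷ 𝟙_ C ≫ (U ⊗ X) ◁ η_ D U) ⊗≫
              U ◁ b D ▷ U ⊗≫ ε_ D U ▷ X ▷ U ⊗≫ 𝟙 _ := by monoidal
          _ = 𝟙 _ ⊗≫ X ◁ U ◁ η_ D U ⊗≫ (((α_ _ _ _).inv ≫ b U ▷ D ≫ (α_ _ _ _).hom ≫ U ◁ b D ≫
              (α_ _ _ _).inv) ≫ ε_ D U ▷ X) ▷ U ⊗≫ 𝟙 _ := by
            rw [← whisker_exchange]; monoidal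
          _ = 𝟙 _ ⊗≫ X ◁ (U ◁ η_ D U ⊗≫ ε_ D U ▷ U) ⊗≫ 𝟙 _ := by
            rw [← hm, ← hn, h1]; monoidal
          _ = 𝟙 _ := by rw [ExactPairing.coevaluation_evaluation'']; monoidal
      inv_hom_id := by
        set D := HasLeftDual.leftDual U
        calc
          _ = 𝟙 _ ⊗≫ U ◁ X ◁ η_ D U ⊗≫ U ◁ b D ▷ U ⊗≫
              (ε_ D U ▷ (X ⊗ U) ≫ 𝟙_ C ◁ b U) ⊗≫ 𝟙 _ := by monoidal
          _ = 𝟙 _ ⊗≫ U ◁ (X ◁ η_ D U ≫ ((α_ _ _ _).inv ≫ b D ▷ U ≫ (α_ _ _ _).hom ≫ D ◁ b U ≫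
              (α_ _ _ _).inv)) ⊗≫ ε_ D U ▷ (U ⊗ X) ⊗≫ 𝟙 _ := by
            rw [← whisker_exchange]; monoidal
          _ = 𝟙 _ ⊗≫ (U ◁ η_ D U ⊗≫ ε_ D U ▷ U) ▷ X ⊗≫ 𝟙 _ := by
            rw [← hm, hn, h1]; monoidal
          _ = 𝟙 _ := by rw [ExactPairing.coevaluation_evaluation'']; monoidal }
  monoidal := hm
  naturality := hn

end

/-! ### Half braidings on dual objects -/

section Dual

variable {C : Type u} [Category.{v} C] [MonoidalCategory C] [RightRigidCategory C]

/-- The half braiding of the dual. -/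
def dualBraid {X : C} (b : HalfBraiding X) (U : C) : dual X ⊗ U ⟶ U ⊗ dual X :=
  𝟙 _ ⊗≫ dual X ◁ U ◁ cv X ⊗≫ dual X ◁ (b.β U).inv ▷ dual X ⊗≫ ev X ▷ U ▷ dual X ⊗≫ 𝟙 _

variable {X : C} (b : HalfBraiding X)

lemma dualBraid_ev (U : C) : dualBraid b U ▷ X ⊗≫ U ◁ ev X =
    𝟙 _ ⊗≫ dual X ◁ (b.β U).inv ⊗≫ ev X ▷ U ⊗≫ 𝟙 _ :=
  calc
    _ = 𝟙 _ ⊗≫ dual X ◁ U ◁ cv X ▷ X ⊗≫ dual X ◁ ((b.β U).inv ▷ (dual X ⊗ X) ≫ (X ⊗ U) ◁ ev X) ⊗≫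
        ev X ▷ U ⊗≫ 𝟙 _ := by
      have h := whisker_exchange (ev X) (U ◁ ev X)
      calc
        _ = 𝟙 _ ⊗≫ dual X ◁ U ◁ cv X ▷ X ⊗≫ dual X ◁ (b.β U).inv ▷ dual X ▷ X ⊗≫
            (ev X ▷ (U ⊗ (dual X ⊗ X)) ≫ 𝟙_ C ◁ U ◁ ev X) ⊗≫ 𝟙 _ := by rw [dualBraid]; monoidal
        _ = _ := by rw [← h]; monoidal
    _ = 𝟙 _ ⊗≫ dual X ◁ U ◁ (cv X ▷ X ⊗≫ X ◁ ev X) ⊗≫ dual X ◁ (b.β U).inv ⊗≫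
        ev X ▷ U ⊗≫ 𝟙 _ := by rw [← whisker_exchange]; monoidal
    _ = _ := by rw [cv_ev]; monoidal

lemma cv_dualBraid (U : C) : cv X ▷ U ⊗≫ X ◁ dualBraid b U =
    𝟙 _ ⊗≫ U ◁ cv X ⊗≫ (b.β U).inv ▷ dual X ⊗≫ 𝟙 _ :=
  calc
    _ = 𝟙 _ ⊗≫ (cv X ▷ (U ⊗ 𝟙_ C) ≫ (X ⊗ dual X) ◁ U ◁ cv X) ⊗≫
        X ◁ dual X ◁ (b.β U).inv ▷ dual X ⊗≫ X ◁ ev X ▷ U ▷ dual X ⊗≫ 𝟙 _ := by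
      rw [dualBraid]; monoidal
    _ = 𝟙 _ ⊗≫ U ◁ cv X ⊗≫ (cv X ▷ (U ⊗ X) ≫ (X ⊗ dual X) ◁ (b.β U).inv) ▷ dual X ⊗≫
        X ◁ ev X ▷ U ▷ dual X ⊗≫ 𝟙 _ := by
      rw [← whisker_exchange]; monoidal
    _ = 𝟙 _ ⊗≫ U ◁ cv X ⊗≫ (b.β U).inv ▷ dual X ⊗≫
        (cv X ▷ X ⊗≫ X ◁ ev X) ▷ U ▷ dual X ⊗≫ 𝟙 _ := by
      rw [← whisker_exchange]; monoidal
    _ = _ := by rw [cv_ev]; monoidal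

lemma dualBraid_naturality {U U' : C} (f : U ⟶ U') :
    dual X ◁ f ≫ dualBraid b U' = dualBraid b U ≫ f ▷ dual X := by
  have h : f ▷ X ≫ (b.β U').inv = (b.β U).inv ≫ X ◁ f := by
    rw [Iso.eq_inv_comp, ← Category.assoc, ← HalfBraiding.naturality, Category.assoc,
      Iso.hom_inv_id, Category.comp_id]
  calc
    _ = 𝟙 _ ⊗≫ dual X ◁ (f ▷ 𝟙_ C ≫ U' ◁ cv X) ⊗≫ dual X ◁ (b.β U').inv ▷ dual X ⊗≫
        ev X ▷ U' ▷ dual X ⊗≫ 𝟙 _ := by rw [dualBraid]; monoidal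
    _ = 𝟙 _ ⊗≫ dual X ◁ U ◁ cv X ⊗≫ dual X ◁ (f ▷ X ≫ (b.β U').inv) ▷ dual X ⊗≫
        ev X ▷ U' ▷ dual X ⊗≫ 𝟙 _ := by rw [← whisker_exchange]; monoidal
    _ = 𝟙 _ ⊗≫ dual X ◁ U ◁ cv X ⊗≫ dual X ◁ (b.β U).inv ▷ dual X ⊗≫
        ((dual X ⊗ X) ◁ f ≫ ev X ▷ U') ▷ dual X ⊗≫ 𝟙 _ := by rw [h]; monoidal
    _ = _ := by rw [whisker_exchange, dualBraid]; monoidal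

lemma dualBraid_tensor (U U' : C) : dualBraid b (U ⊗ U') =
    (α_ _ _ _).inv ≫ dualBraid b U ▷ U' ≫ (α_ _ _ _).hom ≫ U ◁ dualBraid b U' ≫
      (α_ _ _ _).inv := by
  symm
  calc
    _ = 𝟙 _ ⊗≫ (dualBraid b U ▷ U' ≫ (U ⊗ dual X) ◁ (𝟙 U' ⊗≫ U' ◁ cv X ⊗≫
        (b.β U').inv ▷ dual X)) ⊗≫ U ◁ ev X ▷ U' ▷ dual X ⊗≫ 𝟙 _ := by
      conv_lhs => enter [2, 2, 2]; rw [dualBraid]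
      monoidal
    _ = 𝟙 _ ⊗≫ dual X ◁ U ◁ (𝟙 U' ⊗≫ U' ◁ cv X ⊗≫ (b.β U').inv ▷ dual X) ⊗≫
        (dualBraid b U ▷ X ⊗≫ U ◁ ev X) ▷ U' ▷ dual X ⊗≫ 𝟙 _ := by
      rw [← whisker_exchange]; monoidal
    _ = _ := by rw [dualBraid_ev, dualBraid, HalfBraiding.monoidal_inv]; monoidal

lemma dualBraid_unit : dualBraid b (𝟙_ C) = (ρ_ _).hom ≫ (λ_ _).inv := by
  have h : (b.β (𝟙_ C)).inv = (λ_ X).hom ≫ (ρ_ X).inv := by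
    rw [← cancel_epi (b.β (𝟙_ C)).hom, Iso.hom_inv_id, halfBraiding_unit]; simp
  calc
    _ = 𝟙 _ ⊗≫ (dual X ◁ cv X ⊗≫ ev X ▷ dual X) ⊗≫ 𝟙 _ := by rw [dualBraid, h]; monoidal
    _ = _ := by rw [dual_cv_ev]; monoidal

end Dual

/-! ### Rigidity of the center -/

section RigidCenter

variable {C : Type u} [Category.{v} C] [MonoidalCategory C] [RigidCategory C]

/-- The dual of an object of the center. -/
def centerDual (M : Center C) : Center C :=
  ⟨dual M.1, halfBraidingOfLax (dualBraid M.2) (dualBraid_naturality M.2) (dualBraid_tensor M.2)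
    (dualBraid_unit M.2)⟩

/-- The evaluation of an object of the center. -/
def centerEv (M : Center C) : centerDual M ⊗ M ⟶ 𝟙_ (Center C) where
  f := ev M.1
  comm U := by
    have h : dual M.1 ◁ (M.2.β U).hom ⊗≫ (dualBraid M.2 U ▷ M.1 ⊗≫ U ◁ ev M.1) =
        𝟙 _ ⊗≫ ev M.1 ▷ U ⊗≫ 𝟙 _ := by
      rw [dualBraid_ev]
      calc
        _ = 𝟙 _ ⊗≫ dual M.1 ◁ ((M.2.β U).hom ≫ (M.2.β U).inv) ⊗≫ ev M.1 ▷ U ⊗≫ 𝟙 _ := by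
          monoidal
        _ = _ := by rw [Iso.hom_inv_id]; monoidal
    change ev M.1 ▷ U ≫ (λ_ U).hom ≫ (ρ_ U).inv = ((α_ _ _ _).hom ≫ dual M.1 ◁ (M.2.β U).hom ≫
      (α_ _ _ _).inv ≫ dualBraid M.2 U ▷ M.1 ≫ (α_ _ _ _).hom) ≫ U ◁ ev M.1
    refine Eq.trans ?_ ((congrArg (fun z => (α_ _ _ _).hom ≫ z) h.symm).trans ?_) <;> monoidal

/-- The coevaluation of an object of the center. -/
def centerCv (M : Center C) : 𝟙_ (Center C) ⟶ M ⊗ centerDual M where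
  f := cv M.1
  comm U := by
    have h : (cv M.1 ▷ U ⊗≫ M.1 ◁ dualBraid M.2 U) ⊗≫ (M.2.β U).hom ▷ dual M.1 =
        𝟙 _ ⊗≫ U ◁ cv M.1 ⊗≫ 𝟙 _ := by
      rw [cv_dualBraid]
      calc
        _ = 𝟙 _ ⊗≫ U ◁ cv M.1 ⊗≫ ((M.2.β U).inv ≫ (M.2.β U).hom) ▷ dual M.1 ⊗≫ 𝟙 _ := by
          monoidal
        _ = _ := by rw [Iso.inv_hom_id]; monoidal
    change cv M.1 ▷ U ≫ (α_ _ _ _).hom ≫ M.1 ◁ dualBraid M.2 U ≫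
      (α_ _ _ _).inv ≫ (M.2.β U).hom ▷ dual M.1 ≫ (α_ _ _ _).hom =
      ((λ_ U).hom ≫ (ρ_ U).inv) ≫ U ◁ cv M.1
    refine Eq.trans ?_ ((congrArg (fun z => z ≫ (α_ _ _ _).hom) h).trans ?_) <;> monoidal

/-- The duality pairing of an object of the center. -/
@[reducible]
def centerPairing (M : Center C) : ExactPairing M (centerDual M) where
  coevaluation' := centerCv M
  evaluation' := centerEv M
  coevaluation_evaluation' := by
    apply Center.ext
    rw [Center.comp_f, Center.comp_f, Center.comp_f, Center.associator_inv_f,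
      Center.leftUnitor_inv_f]
    exact ExactPairing.coevaluation_evaluation M.1 (dual M.1)
  evaluation_coevaluation' := by
    apply Center.ext
    rw [Center.comp_f, Center.comp_f, Center.comp_f, Center.rightUnitor_inv_f]
    exact ExactPairing.evaluation_coevaluation M.1 (dual M.1)

/-- The center of a rigid category is right rigid. -/
@[reducible]
def centerRightRigid : RightRigidCategory (Center C) where
  rightDual M := @HasRightDual.mk _ _ _ M (centerDual M) (centerPairing M)

/-- The braiding turns right duals into left duals, so one side suffices. -/
instance centerRigid : RigidCategory (Center C) :=
  @BraidedCategory.rigidCategoryOfRightRigidCategory _ _ _ _ centerRightRigid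

end RigidCenter

end CategoricalCenter

namespace CategoricalCenter

/-! ### The sovereign structure lifts to the center -/

lemma hom_ext_of_zigzag {C : Type u} [Category.{v} C] [MonoidalCategory C] {W Y Z : C}
    {e : Y ⊗ Z ⟶ 𝟙_ C} {c : 𝟙_ C ⟶ Z ⊗ Y} (h : Y ◁ c ⊗≫ e ▷ Y = ⊗𝟙.hom) {g g' : W ⟶ Y}
    (hg : g ▷ Z ≫ e = g' ▷ Z ≫ e) : g = g' := by
  have key : ∀ g : W ⟶ Y, g = 𝟙 _ ⊗≫ W ◁ c ⊗≫ (g ▷ Z ≫ e) ▷ Y ⊗≫ 𝟙 _ := fun g =>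
    calc
      g = g ⊗≫ (Y ◁ c ⊗≫ e ▷ Y) ⊗≫ 𝟙 _ := by rw [h]; monoidal
      _ = 𝟙 _ ⊗≫ (g ▷ 𝟙_ C ≫ Y ◁ c) ⊗≫ e ▷ Y ⊗≫ 𝟙 _ := by monoidal
      _ = _ := by rw [← whisker_exchange]; monoidal
  rw [key g, key g', hg]

lemma transpose_whiskerRight {C : Type u} [Category.{v} C] [MonoidalCategory C] {W Y Z : C} {e : Y ⊗ Z ⟶ 𝟙_ C} {c : 𝟙_ C ⟶ Z ⊗ Y}
    (h : c ▷ Z ⊗≫ Z ◁ e = ⊗𝟙.hom) (r : W ⊗ Z ⟶ 𝟙_ C) :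
    (𝟙 W ⊗≫ W ◁ c ⊗≫ r ▷ Y ⊗≫ 𝟙 Y) ▷ Z ≫ e = r :=
  calc
    _ = 𝟙 _ ⊗≫ W ◁ c ▷ Z ⊗≫ (r ▷ (Y ⊗ Z) ≫ 𝟙_ C ◁ e) ⊗≫ 𝟙 _ := by monoidal
    _ = 𝟙 _ ⊗≫ W ◁ (c ▷ Z ⊗≫ Z ◁ e) ⊗≫ r := by rw [← whisker_exchange]; monoidal
    _ = r := by rw [h]; monoidal

lemma nest_eq {C : Type u} [Category.{v} C] [MonoidalCategory C] {A A' B B' : C}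
    (a : A' ⊗ A ⟶ 𝟙_ C) (b : B' ⊗ B ⟶ 𝟙_ C) :
    nest a b = (α_ _ _ _).hom ≫ B' ◁ (α_ _ _ _).inv ≫ B' ◁ (a ▷ B) ≫ B' ◁ (λ_ _).hom ≫ b := by
  rw [nest]; monoidal

section

variable {C : Type u} [Category.{v} C] [MonoidalCategory C] [RightRigidCategory C]

/-- The isomorphism `U ≅ U*` determined by a self-pairing. -/
def selfDualIso {U : C} (p : ExactPairing U U) : U ≅ dual U := rightDualIso p HasRightDual.exact

lemma selfDualIso_hom_ev {U : C} (p : ExactPairing U U) :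
    (selfDualIso p).hom ▷ U ≫ ev U = p.evaluation' := by
  refine (@rightAdjointMate_comp_evaluation C _ _ U U
      (RightRigidCategory.rightDual _) (@HasRightDual.mk _ _ _ _ U p) (𝟙 _)).trans ?_
  rw [MonoidalCategory.whiskerLeft_id, Category.id_comp]
  rfl

lemma nest_hom_ext {W X Y : C} {g g' : W ⟶ dual Y ⊗ dual X}
    (h : g ▷ (X ⊗ Y) ≫ nest (ev X) (ev Y) = g' ▷ (X ⊗ Y) ≫ nest (ev X) (ev Y)) : g = g' := by
  rw [← cancel_mono (dualTensor X Y).inv]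
  refine dual_hom_ext ?_
  rw [comp_whiskerRight_assoc, comp_whiskerRight_assoc, dualTensor_inv_ev, h]

variable {X : C} (b : HalfBraiding X)

lemma halfBraiding_ev (U : C) :
    (b.β (dual U)).hom ▷ U ⊗≫ dual U ◁ (b.β U).hom ⊗≫ ev U ▷ X =
      𝟙 _ ⊗≫ X ◁ ev U ⊗≫ 𝟙 _ := by
  have h := b.naturality (ev U)
  rw [HalfBraiding.monoidal, halfBraiding_unit] at h
  calc
    _ = 𝟙 _ ⊗≫ (((α_ _ _ _).inv ≫ (b.β (dual U)).hom ▷ U ≫ (α_ _ _ _).hom ≫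
        dual U ◁ (b.β U).hom ≫ (α_ _ _ _).inv) ≫ ev U ▷ X) := by monoidal
    _ = _ := by rw [← h]; monoidal

lemma halfBraiding_rightEv (S : SovereignStructure C) (U : C) :
    (b.β U).hom ▷ dual U ⊗≫ U ◁ (b.β (dual U)).hom ⊗≫ S.rightEv U ▷ X =
      𝟙 _ ⊗≫ X ◁ S.rightEv U ⊗≫ 𝟙 _ := by
  have h := b.naturality (S.rightEv U)
  rw [HalfBraiding.monoidal, halfBraiding_unit] at h
  calc
    _ = 𝟙 _ ⊗≫ (((α_ _ _ _).inv ≫ (b.β U).hom ▷ dual U ≫ (α_ _ _ _).hom ≫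
        U ◁ (b.β (dual U)).hom ≫ (α_ _ _ _).inv) ≫ S.rightEv U ▷ X) := by monoidal
    _ = _ := by rw [← h]; monoidal

lemma dualBraid_nest (S : SovereignStructure C) (U : C) :
    dualBraid b U ▷ (X ⊗ dual U) ≫ nest (ev X) (S.rightEv U) =
      (dual X ⊗ U) ◁ (b.β (dual U)).hom ≫ nest (S.rightEv U) (ev X) :=
  calc
    _ = 𝟙 _ ⊗≫ (dualBraid b U ▷ X ⊗≫ U ◁ ev X) ▷ dual U ⊗≫ S.rightEv U := by
      rw [nest]; monoidal
    _ = 𝟙 _ ⊗≫ dual X ◁ (b.β U).inv ▷ dual U ⊗≫ (ev X ▷ (U ⊗ dual U) ≫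
        𝟙_ C ◁ S.rightEv U) ⊗≫ 𝟙 _ := by rw [dualBraid_ev]; monoidal
    _ = 𝟙 _ ⊗≫ dual X ◁ (b.β U).inv ▷ dual U ⊗≫ dual X ◁ (𝟙 ((X ⊗ U) ⊗ dual U) ⊗≫
        X ◁ S.rightEv U ⊗≫ 𝟙 X) ⊗≫ ev X := by rw [← whisker_exchange]; monoidal
    _ = 𝟙 _ ⊗≫ dual X ◁ (b.β U).inv ▷ dual U ⊗≫ dual X ◁ ((b.β U).hom ▷ dual U ⊗≫
        U ◁ (b.β (dual U)).hom ⊗≫ S.rightEv U ▷ X) ⊗≫ ev X := by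
      rw [halfBraiding_rightEv]; monoidal
    _ = 𝟙 _ ⊗≫ dual X ◁ ((b.β U).inv ≫ (b.β U).hom) ▷ dual U ⊗≫ dual X ◁ (
        U ◁ (b.β (dual U)).hom ⊗≫ S.rightEv U ▷ X) ⊗≫ ev X := by monoidal
    _ = _ := by rw [Iso.inv_hom_id, nest]; monoidal

/-- The dual half braiding is defined through `ev`, while the claim is about `rightEv`. The bridge
is the dual `m` of the braiding with `U*`: the naturality of `rightEv` under `mate` controls `m`,
and `h3` identifies `m` with `dualBraid` after `U ≅ U**`. -/
lemma nest_rightEv_dualBraid (S : SovereignStructure C) (U : C) :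
    (X ⊗ dual U) ◁ dualBraid b U ≫ nest (ev U) (S.rightEv X) =
      (b.β (dual U)).hom ▷ (dual X ⊗ U) ≫ nest (S.rightEv X) (ev U) := by
  set c := (b.β (dual U)).hom
  let m : dual X ⊗ dual (dual U) ⟶ dual (dual U) ⊗ dual X :=
    (dualTensor (dual U) X).inv ≫ mate c ≫ (dualTensor X (dual U)).hom
  have h1 : m ▷ (X ⊗ dual U) ≫ nest (ev X) (ev (dual U)) =
      (dual X ⊗ dual (dual U)) ◁ c ≫ nest (ev (dual U)) (ev X) := by
    rw [comp_whiskerRight_assoc, comp_whiskerRight_assoc, dualTensor_hom_nest, mate_ev,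
      ← whisker_exchange_assoc, dualTensor_inv_ev]
  have h2 : (X ⊗ dual U) ◁ m ≫ nest (S.rightEv (dual U)) (S.rightEv X) =
      c ▷ (dual X ⊗ dual (dual U)) ≫ nest (S.rightEv X) (S.rightEv (dual U)) := by
    rw [MonoidalCategory.whiskerLeft_comp_assoc, MonoidalCategory.whiskerLeft_comp_assoc,
      ← S.rightEv_tensor, S.mate_rightEv, whisker_exchange_assoc, S.rightEv_tensor (dual U) X,
      ← MonoidalCategory.whiskerLeft_comp_assoc, Iso.inv_hom_id,
      MonoidalCategory.whiskerLeft_id, Category.id_comp]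
  have h3 : dual X ◁ (S.φ U).hom ≫ m = dualBraid b U ≫ (S.φ U).hom ▷ dual X := by
    refine nest_hom_ext ?_
    rw [comp_whiskerRight_assoc, h1, comp_whiskerRight_assoc]
    have h4 : (S.φ U).hom ▷ dual X ▷ (X ⊗ dual U) ≫ nest (ev X) (ev (dual U)) =
        nest (ev X) (S.rightEv U) :=
      calc
        _ = 𝟙 _ ⊗≫ ((S.φ U).hom ▷ ((dual X ⊗ X) ⊗ dual U) ≫ dual (dual U) ◁ (ev X ▷ dual U))
            ⊗≫ ev (dual U) := by rw [nest]; monoidal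
        _ = _ := by rw [← whisker_exchange, nest, S.rightEv_eq]; monoidal
    rw [h4, dualBraid_nest b S, ← whisker_exchange_assoc, nest, nest, S.rightEv_eq]
    monoidal
  have h5 := congrArg (fun z => (X ⊗ dual U) ◁ (dual X ◁ (S.φ U).hom) ≫ z) h2
  rw [← MonoidalCategory.whiskerLeft_comp_assoc, h3, whisker_exchange_assoc] at h5
  have h6 : (dual U ⊗ X) ◁ (dual X ◁ (S.φ U).hom) ≫ nest (S.rightEv X) (S.rightEv (dual U)) =
      nest (S.rightEv X) (ev U) :=
    calc
      _ = 𝟙 _ ⊗≫ dual U ◁ ((X ⊗ dual X) ◁ (S.φ U).hom ≫ S.rightEv X ▷ dual (dual U)) ⊗≫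
          S.rightEv (dual U) := by rw [nest]; monoidal
      _ = _ := by rw [whisker_exchange, nest, ← S.φ_rightEv_dual]; monoidal
  rw [h6] at h5
  rw [← h5, MonoidalCategory.whiskerLeft_comp_assoc]
  congr 1
  rw [nest, nest, ← S.φ_rightEv_dual]
  monoidal

lemma dual_whiskerLeft_hom_ext {W U : C} {g g' : W ⟶ U}
    (h : dual U ◁ g ≫ ev U = dual U ◁ g' ≫ ev U) : g = g' := by
  have key : ∀ g : W ⟶ U, g = 𝟙 _ ⊗≫ cv U ▷ W ⊗≫ U ◁ (dual U ◁ g ≫ ev U) ⊗≫ 𝟙 _ := fun g =>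
    calc
      g = g ⊗≫ (cv U ▷ U ⊗≫ U ◁ ev U) ⊗≫ 𝟙 _ := by rw [cv_ev]; monoidal
      _ = 𝟙 _ ⊗≫ (𝟙_ C ◁ g ≫ cv U ▷ U) ⊗≫ U ◁ ev U ⊗≫ 𝟙 _ := by monoidal
      _ = _ := by rw [whisker_exchange]; monoidal
  rw [key g, key g', h]

/-- This is the statement that `rightEv` is a morphism of the center; unlike the one for `ev`, it
depends on the sovereign structure. -/
lemma dualBraid_rightEv (S : SovereignStructure C) (U : C) :
    X ◁ dualBraid b U ⊗≫ (b.β U).hom ▷ dual X ⊗≫ U ◁ S.rightEv X ⊗≫ 𝟙 U =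
      𝟙 _ ⊗≫ S.rightEv X ▷ U ⊗≫ 𝟙 U := by
  refine dual_whiskerLeft_hom_ext ?_
  set c := b.β (dual U)
  -- Precomposing with the invertible braiding of `X` with `U*` lets the two half braidings of `X`
  -- meet `ev U`, where they cancel by naturality.
  have h : c.hom ▷ (dual X ⊗ U) ≫ (α_ _ _ _).hom ≫
      (dual U ◁ (X ◁ dualBraid b U ⊗≫ (b.β U).hom ▷ dual X ⊗≫ U ◁ S.rightEv X ⊗≫ 𝟙 U) ≫ ev U) =
      c.hom ▷ (dual X ⊗ U) ≫ (α_ _ _ _).hom ≫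
      (dual U ◁ (𝟙 _ ⊗≫ S.rightEv X ▷ U ⊗≫ 𝟙 U) ≫ ev U) :=
    calc
      _ = (c.hom ▷ (dual X ⊗ U) ≫ (dual U ⊗ X) ◁ dualBraid b U) ⊗≫
          dual U ◁ (b.β U).hom ▷ dual X ⊗≫ ((dual U ⊗ U) ◁ S.rightEv X ≫ ev U ▷ 𝟙_ C) ⊗≫
          𝟙 _ := by monoidal
      _ = (X ⊗ dual U) ◁ dualBraid b U ⊗≫ (c.hom ▷ U ⊗≫ dual U ◁ (b.β U).hom ⊗≫
          ev U ▷ X) ▷ dual X ⊗≫ S.rightEv X ⊗≫ 𝟙 _ := by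
        rw [← whisker_exchange, whisker_exchange (ev U)]; monoidal
      _ = ((X ⊗ dual U) ◁ dualBraid b U ≫ nest (ev U) (S.rightEv X)) ⊗≫ 𝟙 _ := by
        rw [halfBraiding_ev, nest]; monoidal
      _ = _ := by rw [nest_rightEv_dualBraid, nest]; monoidal
  rw [cancel_epi, cancel_epi] at h
  exact h

end

section RigidCenter

variable {C : Type u} [Category.{v} C] [MonoidalCategory C] [RigidCategory C]

/-- The right evaluation of an object of the center. -/
def centerRightEv (S : SovereignStructure C) (M : Center C) :
    M ⊗ centerDual M ⟶ 𝟙_ (Center C) where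
  f := S.rightEv M.1
  comm U := by
    have h := dualBraid_rightEv M.2 S U
    change S.rightEv M.1 ▷ U ≫ (λ_ U).hom ≫ (ρ_ U).inv = ((α_ _ _ _).hom ≫ M.1 ◁ dualBraid M.2 U ≫
      (α_ _ _ _).inv ≫ (M.2.β U).hom ▷ dual M.1 ≫ (α_ _ _ _).hom) ≫ U ◁ S.rightEv M.1
    refine Eq.trans ?_ ((congrArg (fun z => (α_ _ _ _).hom ≫ z ≫ (ρ_ U).inv) h.symm).trans ?_) <;>
      monoidal

/-- Duals in the center are carried by the duals of `C`, with the same evaluation, and the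
evaluation determines the dual morphism. -/
lemma center_mate_f {M N : Center C} (f : M ⟶ N) : (mate f).f = mate f.f := by
  have h : (mate f).f ▷ M.1 ≫ ev M.1 = dual N.1 ◁ f.f ≫ ev N.1 :=
    congrArg Center.Hom.f (mate_ev f)
  exact dual_hom_ext (h.trans (mate_ev f.f).symm)

lemma center_tensor_nest (M N : Center C) :
    (nest (ev M) (ev N)).f = nest (ev M.1) (ev N.1) := by
  rw [nest_eq, nest_eq, Center.comp_f, Center.comp_f, Center.comp_f, Center.comp_f,
    Center.whiskerLeft_f, Center.associator_inv_f]
  rfl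

lemma center_dualTensor_inv_f (M N : Center C) :
    (dualTensor M N).inv.f = (dualTensor M.1 N.1).inv := by
  have h : (dualTensor M N).inv.f ▷ (M.1 ⊗ N.1) ≫ ev (M.1 ⊗ N.1) = nest (ev M.1) (ev N.1) :=
    (congrArg Center.Hom.f (dualTensor_inv_ev M N)).trans (center_tensor_nest M N)
  exact dual_hom_ext (h.trans (dualTensor_inv_ev M.1 N.1).symm)

lemma center_dualTensor_hom_f (M N : Center C) :
    (dualTensor M N).hom.f = (dualTensor M.1 N.1).hom := by
  have h : (dualTensor M N).inv.f ≫ (dualTensor M N).hom.f = 𝟙 _ :=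
    congrArg Center.Hom.f (dualTensor M N).inv_hom_id
  rw [center_dualTensor_inv_f] at h
  exact (Iso.inv_comp_eq_id _).mp h

/-- The component of the sovereign structure of the center. -/
def centerφ (S : SovereignStructure C) (M : Center C) : M ⟶ dual (dual M) where
  f := (S.φ M.1).hom
  comm := by
    -- Writing `φ` as a zigzag of a coevaluation and the right evaluation, both central, shows that
    -- it commutes with the half braidings without computing the half braiding of `M**`.
    let g : M ⟶ dual (dual M) := (ρ_ M).inv ≫ M ◁ cv (dual M) ≫ (α_ _ _ _).inv ≫
      centerRightEv S M ▷ dual (dual M) ≫ (λ_ _).hom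
    have h : g.f = (S.φ M.1).hom := by
      have h' : (ρ_ M.1).inv ≫ M.1 ◁ cv (dual M.1) ≫ (α_ _ _ _).inv ≫
          S.rightEv M.1 ▷ dual (dual M.1) ≫ (λ_ _).hom = (S.φ M.1).hom := by
        rw [← S.cv_dual_rightEv]; monoidal
      rw [← h', Center.comp_f, Center.comp_f, Center.comp_f, Center.comp_f,
        Center.associator_inv_f, Center.rightUnitor_inv_f]
      rfl
    rw [← h]
    exact g.comm

/-- The sovereign structure of the center. -/
def centerSovereign (S : SovereignStructure C) : SovereignStructure (Center C) where
  φ M := @asIso _ _ _ _ (centerφ S M) (by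
    have : IsIso (centerφ S M).f := inferInstanceAs (IsIso (S.φ M.1).hom)
    exact (Center.isoMk (centerφ S M)).isIso_hom)
  naturality {M N} f := by
    apply Center.ext
    rw [Center.comp_f, Center.comp_f, center_mate_f, center_mate_f]
    exact S.naturality f.f
  tensor M N := by
    apply Center.ext
    rw [doubleDualTensor, Center.comp_f, Center.comp_f, center_mate_f, center_dualTensor_hom_f,
      center_dualTensor_inv_f]
    exact S.tensor M.1 N.1
  unit := by
    apply Center.ext
    let i : 𝟙_ C ≅ dual (𝟙_ C) := selfDualIso exactPairingUnit
    let j : 𝟙_ (Center C) ≅ dual (𝟙_ (Center C)) := selfDualIso exactPairingUnit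
    have h : j.hom.f = i.hom := by
      have h : j.hom.f ▷ 𝟙_ C ≫ ev (𝟙_ C) = (exactPairingUnit (C := C)).evaluation' :=
        congrArg Center.Hom.f (selfDualIso_hom_ev (U := 𝟙_ (Center C)) exactPairingUnit)
      exact dual_hom_ext (h.trans (selfDualIso_hom_ev (U := 𝟙_ C) exactPairingUnit).symm)
    have h' : j.inv.f = i.inv := by
      have h1 : j.inv.f ≫ j.hom.f = 𝟙 _ := congrArg Center.Hom.f j.inv_hom_id
      rw [h] at h1
      exact (Iso.comp_hom_eq_id _).mp h1
    have h2 : (j.hom ≫ mate j.inv).f = i.hom ≫ mate i.inv := by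
      rw [Center.comp_f, center_mate_f, h, h']; rfl
    exact S.unit.trans h2.symm

lemma centerSovereign_φ_inv_f (S : SovereignStructure C) (M : Center C) :
    ((centerSovereign S).φ M).inv.f = (S.φ M.1).inv := by
  have h : ((centerSovereign S).φ M).inv.f ≫ (S.φ M.1).hom = 𝟙 _ :=
    congrArg Center.Hom.f ((centerSovereign S).φ M).inv_hom_id
  exact (Iso.comp_hom_eq_id _).mp h

lemma centerSovereign_rightCv_f (S : SovereignStructure C) (M : Center C) :
    ((centerSovereign S).rightCv M).f = S.rightCv M.1 := by
  rw [SovereignStructure.rightCv, Center.comp_f, Center.whiskerLeft_f, centerSovereign_φ_inv_f]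
  rfl

end RigidCenter

end CategoricalCenter

namespace CategoricalCenter

/-! ### The twist of a braided sovereign category -/

section Twist

variable {B : Type u} [Category.{v} B] [MonoidalCategory B] [BraidedCategory B]

lemma braiding_comp_pairing {A A' : B} (e : A ⊗ A' ⟶ 𝟙_ B) (Z : B) :
    (β_ A Z).hom ▷ A' ⊗≫ Z ◁ e ⊗≫ 𝟙 Z = 𝟙 _ ⊗≫ A ◁ (β_ A' Z).inv ⊗≫ e ▷ Z ⊗≫ 𝟙 Z := by
  have h := BraidedCategory.braiding_naturality_left e Z
  rw [braiding_tensorUnit_left, BraidedCategory.braiding_tensor_left_hom] at h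
  calc
    _ = 𝟙 _ ⊗≫ A ◁ ((β_ A' Z).inv ≫ (β_ A' Z).hom) ⊗≫ (β_ A Z).hom ▷ A' ⊗≫ Z ◁ e ⊗≫ 𝟙 Z := by
      rw [Iso.inv_hom_id]; monoidal
    _ = 𝟙 _ ⊗≫ A ◁ (β_ A' Z).inv ⊗≫ (((α_ A A' Z).hom ≫ A ◁ (β_ A' Z).hom ≫ (α_ A Z A').inv ≫
          (β_ A Z).hom ▷ A' ≫ (α_ Z A A').hom) ≫ Z ◁ e) ⊗≫ 𝟙 Z := by monoidal
    _ = _ := by rw [← h]; monoidal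

lemma braiding_comp_pairing' {A A' : B} (e : A ⊗ A' ⟶ 𝟙_ B) (Z : B) :
    A ◁ (β_ Z A').hom ⊗≫ e ▷ Z ⊗≫ 𝟙 Z = 𝟙 _ ⊗≫ (β_ Z A).inv ▷ A' ⊗≫ Z ◁ e ⊗≫ 𝟙 Z := by
  have h := BraidedCategory.braiding_naturality_right Z e
  rw [braiding_tensorUnit_right, BraidedCategory.braiding_tensor_right_hom] at h
  calc
    _ = 𝟙 _ ⊗≫ ((β_ Z A).inv ≫ (β_ Z A).hom) ▷ A' ⊗≫ A ◁ (β_ Z A').hom ⊗≫ e ▷ Z ⊗≫ 𝟙 Z := by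
      rw [Iso.inv_hom_id]; monoidal
    _ = 𝟙 _ ⊗≫ (β_ Z A).inv ▷ A' ⊗≫ (((α_ Z A A').inv ≫ (β_ Z A).hom ▷ A' ≫ (α_ A Z A').hom ≫
          A ◁ (β_ Z A').hom ≫ (α_ A A' Z).inv) ≫ e ▷ Z) ⊗≫ 𝟙 Z := by monoidal
    _ = _ := by rw [← h]; monoidal

lemma braiding_yangBaxter_inv (U V W : B) :
    (β_ U V).hom ▷ W ⊗≫ V ◁ (β_ U W).hom ⊗≫ (β_ W V).inv ▷ U =
      𝟙 _ ⊗≫ U ◁ (β_ W V).inv ⊗≫ (β_ U W).hom ▷ V ⊗≫ W ◁ (β_ U V).hom ⊗≫ 𝟙 _ := by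
  have h := BraidedCategory.braiding_naturality_right U (β_ W V).inv
  rw [BraidedCategory.braiding_tensor_right_hom, BraidedCategory.braiding_tensor_right_hom] at h
  calc
    _ = 𝟙 _ ⊗≫ (((α_ U V W).inv ≫ (β_ U V).hom ▷ W ≫ (α_ V U W).hom ≫ V ◁ (β_ U W).hom ≫
        (α_ V W U).inv) ≫ (β_ W V).inv ▷ U) := by monoidal
    _ = _ := by rw [← h]; monoidal

variable [RightRigidCategory B]

/-- The evaluation `X ⊗ X* ⟶ 𝟙_` obtained from the braiding. -/
def braidedEv (X : B) : X ⊗ dual X ⟶ 𝟙_ B := (β_ X (dual X)).hom ≫ ev X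

/-- The coevaluation `𝟙_ ⟶ X* ⊗ X` obtained from the braiding. -/
def braidedCv (X : B) : 𝟙_ B ⟶ dual X ⊗ X := cv X ≫ (β_ (dual X) X).inv

lemma braidedCv_braidedEv (X : B) :
    braidedCv X ▷ dual X ⊗≫ dual X ◁ braidedEv X = ⊗𝟙.hom :=
  (BraidedCategory.exactPairing_swap X (dual X)).evaluation_coevaluation'' 

lemma self_braidedCv_braidedEv (X : B) :
    X ◁ braidedCv X ⊗≫ braidedEv X ▷ X = ⊗𝟙.hom :=
  (BraidedCategory.exactPairing_swap X (dual X)).coevaluation_evaluation'' 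

lemma mate_braidedEv {X Y : B} (f : X ⟶ Y) :
    X ◁ mate f ≫ braidedEv X = f ▷ dual Y ≫ braidedEv Y := by
  rw [braidedEv, braidedEv, BraidedCategory.braiding_naturality_right_assoc, mate_ev,
    BraidedCategory.braiding_naturality_left_assoc]

/-- Besides the two self-crossings, the left side has crossings of `X` with `Y*` and of `Y` with
`X*`. Pushed through the pairings, they become the inverse double braiding of `X` and `Y`;
Yang–Baxter makes the self-crossing of `Y` reachable. -/
lemma braiding_nest (X Y : B) :
    (β_ (X ⊗ Y) (dual Y ⊗ dual X)).hom ≫ nest (ev X) (ev Y) =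
      ((β_ Y X).inv ≫ (β_ X Y).inv) ▷ (dual Y ⊗ dual X) ≫ nest (braidedEv Y) (braidedEv X) := by
  rw [BraidedCategory.braiding_tensor_left_hom, BraidedCategory.braiding_tensor_right_hom,
    BraidedCategory.braiding_tensor_right_hom]
  calc
    _ = 𝟙 _ ⊗≫ X ◁ (β_ Y (dual Y)).hom ▷ dual X ⊗≫ X ◁ dual Y ◁ (β_ Y (dual X)).hom ⊗≫
        ((β_ X (dual Y)).hom ▷ dual X ⊗≫ dual Y ◁ braidedEv X ⊗≫ 𝟙 (dual Y)) ▷ Y ⊗≫ ev Y := by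
      rw [braidedEv, nest]; monoidal
    _ = 𝟙 _ ⊗≫ X ◁ ((β_ Y (dual Y)).hom ▷ dual X ⊗≫ dual Y ◁ (β_ Y (dual X)).hom ⊗≫
        (β_ (dual X) (dual Y)).inv ▷ Y) ⊗≫ braidedEv X ▷ dual Y ▷ Y ⊗≫ ev Y := by
      rw [braiding_comp_pairing]; monoidal
    _ = 𝟙 _ ⊗≫ X ◁ Y ◁ (β_ (dual X) (dual Y)).inv ⊗≫ X ◁ (β_ Y (dual X)).hom ▷ dual Y ⊗≫
        ((X ⊗ dual X) ◁ (β_ Y (dual Y)).hom ≫ braidedEv X ▷ (dual Y ⊗ Y)) ⊗≫ ev Y := by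
      rw [braiding_yangBaxter_inv]; monoidal
    _ = 𝟙 _ ⊗≫ X ◁ Y ◁ (β_ (dual X) (dual Y)).inv ⊗≫
        (X ◁ (β_ Y (dual X)).hom ⊗≫ braidedEv X ▷ Y ⊗≫ 𝟙 Y) ▷ dual Y ⊗≫ braidedEv Y := by
      rw [whisker_exchange, braidedEv, braidedEv]; monoidal
    _ = 𝟙 _ ⊗≫ ((X ⊗ Y) ◁ (β_ (dual X) (dual Y)).inv ≫ (β_ Y X).inv ▷ (dual X ⊗ dual Y)) ⊗≫
        Y ◁ braidedEv X ▷ dual Y ⊗≫ braidedEv Y := by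
      rw [braiding_comp_pairing']; monoidal
    _ = 𝟙 _ ⊗≫ (β_ Y X).inv ▷ (dual Y ⊗ dual X) ⊗≫ Y ◁ (𝟙 ((X ⊗ dual Y) ⊗ dual X) ⊗≫ X ◁ (β_ (dual X) (dual Y)).inv ⊗≫
        braidedEv X ▷ dual Y ⊗≫ 𝟙 (dual Y)) ⊗≫ braidedEv Y := by
      rw [whisker_exchange]; monoidal
    _ = 𝟙 _ ⊗≫ (β_ Y X).inv ▷ (dual Y ⊗ dual X) ⊗≫ Y ◁ (β_ X (dual Y)).hom ▷ dual X ⊗≫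
        ((Y ⊗ dual Y) ◁ braidedEv X ≫ braidedEv Y ▷ 𝟙_ B) ⊗≫ 𝟙 _ := by
      rw [← braiding_comp_pairing]; monoidal
    _ = 𝟙 _ ⊗≫ (β_ Y X).inv ▷ (dual Y ⊗ dual X) ⊗≫ (Y ◁ (β_ X (dual Y)).hom ⊗≫
        braidedEv Y ▷ X ⊗≫ 𝟙 X) ▷ dual X ⊗≫ braidedEv X := by
      rw [whisker_exchange]; monoidal
    _ = _ := by rw [braiding_comp_pairing', nest]; monoidal

lemma braidedEv_tensor (X Y : B) :
    ((β_ X Y).hom ≫ (β_ Y X).hom) ▷ dual (X ⊗ Y) ≫ braidedEv (X ⊗ Y) =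
      (X ⊗ Y) ◁ (dualTensor X Y).hom ≫ nest (braidedEv Y) (braidedEv X) := by
  rw [braidedEv, ← dualTensor_hom_nest, ← BraidedCategory.braiding_naturality_right_assoc,
    braiding_nest, ← whisker_exchange_assoc, ← comp_whiskerRight_assoc]
  simp

namespace SovereignStructure

variable (S : SovereignStructure B)

/-- The twist of a braided sovereign category. -/
def twist (X : B) : X ≅ X where
  hom := 𝟙 X ⊗≫ X ◁ braidedCv X ⊗≫ S.rightEv X ▷ X ⊗≫ 𝟙 X
  inv := 𝟙 X ⊗≫ X ◁ S.rightCv X ⊗≫ braidedEv X ▷ X ⊗≫ 𝟙 X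
  hom_inv_id := by
    refine hom_ext_of_zigzag (S.self_rightCv_rightEv X) ?_
    rw [comp_whiskerRight_assoc, transpose_whiskerRight (S.rightCv_rightEv X),
      transpose_whiskerRight (braidedCv_braidedEv X)]
    simp
  inv_hom_id := by
    refine hom_ext_of_zigzag (self_braidedCv_braidedEv X) ?_
    rw [comp_whiskerRight_assoc, transpose_whiskerRight (braidedCv_braidedEv X),
      transpose_whiskerRight (S.rightCv_rightEv X)]
    simp

/-- This characterizes the twist: both evaluations are non-degenerate, so an equality of
endomorphisms may be tested after composing with `braidedEv`. -/
lemma twist_braidedEv (X : B) : (S.twist X).hom ▷ dual X ≫ braidedEv X = S.rightEv X :=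
  transpose_whiskerRight (braidedCv_braidedEv X) _

lemma rightCv_twist (X : B) : S.rightCv X ≫ dual X ◁ (S.twist X).hom = braidedCv X := by
  refine eq_of_zigzag (e := braidedEv X) ?_ (self_braidedCv_braidedEv X)
  calc
    _ = S.rightCv X ▷ dual X ⊗≫ dual X ◁ ((S.twist X).hom ▷ dual X ≫ braidedEv X) := by monoidal
    _ = _ := by rw [twist_braidedEv, rightCv_rightEv]

lemma twist_naturality {X Y : B} (f : X ⟶ Y) :
    f ≫ (S.twist Y).hom = (S.twist X).hom ≫ f := by
  refine hom_ext_of_zigzag (self_braidedCv_braidedEv Y) ?_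
  rw [comp_whiskerRight_assoc, twist_braidedEv, comp_whiskerRight_assoc, ← mate_braidedEv,
    ← whisker_exchange_assoc, twist_braidedEv, mate_rightEv]

/-- The sovereign evaluation is multiplicative, while the braided one is multiplicative only up to
the double braiding; their comparison picks up exactly that factor. -/
lemma twist_tensor (X Y : B) : (S.twist (X ⊗ Y)).hom =
    (β_ X Y).hom ≫ (β_ Y X).hom ≫ ((S.twist X).hom ⊗ₘ (S.twist Y).hom) := by
  have h : (β_ X Y).hom ≫ (β_ Y X).hom ≫ ((S.twist X).hom ⊗ₘ (S.twist Y).hom) =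
      ((S.twist X).hom ⊗ₘ (S.twist Y).hom) ≫ (β_ X Y).hom ≫ (β_ Y X).hom := by
    rw [BraidedCategory.braiding_naturality_assoc, BraidedCategory.braiding_naturality]
  refine hom_ext_of_zigzag (self_braidedCv_braidedEv (X ⊗ Y)) ?_
  rw [h, twist_braidedEv, comp_whiskerRight_assoc, braidedEv_tensor, rightEv_tensor,
    ← whisker_exchange_assoc]
  congr 1
  rw [tensorHom_def', ← twist_braidedEv, ← twist_braidedEv, nest, nest]
  calc
    _ = 𝟙 _ ⊗≫ X ◁ ((S.twist Y).hom ▷ dual Y) ▷ dual X ⊗≫ (X ◁ braidedEv Y ▷ dual X ≫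
        (S.twist X).hom ▷ (𝟙_ B ⊗ dual X)) ⊗≫ braidedEv X := by monoidal
    _ = _ := by rw [whisker_exchange]; monoidal

/-- Rewriting `rightEv` as the twist followed by `braidedEv` pulls the twist out; what remains is
`X` braided past `X ⊗ X*`, which is trivial on the coevaluation. It connects the twist with the
partial trace of the self-braiding. -/
lemma twist_eq (X : B) : (S.twist X).hom =
    𝟙 X ⊗≫ X ◁ cv X ⊗≫ (β_ X X).hom ▷ dual X ⊗≫ X ◁ S.rightEv X ⊗≫ 𝟙 X := by
  symm
  rw [← twist_braidedEv]
  calc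
    _ = 𝟙 _ ⊗≫ X ◁ cv X ⊗≫ ((β_ X X).hom ≫ X ◁ (S.twist X).hom) ▷ dual X ⊗≫
        X ◁ braidedEv X ⊗≫ 𝟙 X := by monoidal
    _ = 𝟙 _ ⊗≫ (X ◁ cv X ≫ (S.twist X).hom ▷ (X ⊗ dual X)) ⊗≫ (β_ X X).hom ▷ dual X ⊗≫
        X ◁ braidedEv X ⊗≫ 𝟙 X := by
      rw [← BraidedCategory.braiding_naturality_left]; monoidal
    _ = (S.twist X).hom ⊗≫ X ◁ cv X ⊗≫ ((α_ _ _ _).inv ≫ (β_ X X).hom ▷ dual X ≫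
        (α_ _ _ _).hom ≫ X ◁ (β_ X (dual X)).hom ≫ (α_ _ _ _).inv) ⊗≫ X ◁ ev X ⊗≫ 𝟙 X := by
      rw [whisker_exchange, braidedEv]; monoidal
    _ = (S.twist X).hom ⊗≫ (X ◁ cv X ≫ (β_ X (X ⊗ dual X)).hom) ⊗≫ X ◁ ev X ⊗≫ 𝟙 X := by
      rw [BraidedCategory.braiding_tensor_right_hom]; monoidal
    _ = (S.twist X).hom ⊗≫ (cv X ▷ X ⊗≫ X ◁ ev X) ⊗≫ 𝟙 X := by
      rw [BraidedCategory.braiding_naturality_right, braiding_tensorUnit_right]; monoidal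
    _ = _ := by rw [cv_ev]; monoidal

lemma twist_hom_eq (X : B) : (S.twist X).hom =
    (ρ_ X).inv ≫ X ◁ cv X ≫ (α_ X X (dual X)).inv ≫ (β_ X X).hom ▷ dual X ≫
      (α_ X X (dual X)).hom ≫ X ◁ S.rightEv X ≫ (ρ_ X).hom := by
  rw [twist_eq]; monoidal

/-- A characterization of the twist of the dual. -/
lemma twist_dual_eq {X : B} {t : dual X ⟶ dual X}
    (h : t ▷ X ≫ (β_ (dual X) X).hom ≫ S.rightEv X = ev X) : (S.twist (dual X)).hom = t := by
  refine hom_ext_of_zigzag (self_braidedCv_braidedEv (dual X)) ?_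
  rw [twist_braidedEv]
  have h1 : dual X ◁ (S.φ X).hom ≫ braidedEv (dual X) = (β_ (dual X) X).hom ≫ S.rightEv X := by
    rw [braidedEv, BraidedCategory.braiding_naturality_right_assoc]; rfl
  rw [← cancel_epi (dual X ◁ (S.φ X).hom), S.φ_rightEv_dual, whisker_exchange_assoc, h1, h]

end SovereignStructure

end Twist

/-! ### Self-duality of the twist of the center -/

section CenterTwist

variable {C : Type u} [Category.{v} C] [MonoidalCategory C] [RigidCategory C]
  (S : SovereignStructure C)

lemma centerSovereign_twist_f (X : Center C) :
    ((centerSovereign S).twist X).hom.f = S.centerTwist X := by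
  rw [SovereignStructure.twist_hom_eq, Center.comp_f, Center.comp_f, Center.comp_f, Center.comp_f, Center.comp_f, Center.comp_f,
    Center.associator_inv_f, Center.rightUnitor_inv_f]
  rfl

variable {k : Type w} [Field k] [Preadditive C] [Linear k C] [MonoidalPreadditive C]
  [MonoidalLinear k C] (F : FusionStructure k C)

include F in
-- Here `t` is characterized by coevaluations and `w` by evaluations. The functionals `tr (w ≫ f)`
-- and `tr (t ≫ f)` are a right and a left trace of the same diagram, so sphericity and
-- non-degeneracy give `w = t`. All endomorphisms `f` in `C` are used, not only central ones.
lemma rightEv_of_rightCv (hS : S.IsSpherical) {X : C} (c : dual X ⊗ X ≅ X ⊗ dual X)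
    (h : ∀ f : X ⟶ X, dual X ◁ f ≫ c.hom = c.hom ≫ f ▷ dual X) {t : X ⟶ X}
    (ht : S.rightCv X ≫ dual X ◁ t = cv X ≫ c.inv) :
    c.hom ≫ t ▷ dual X ≫ S.rightEv X = ev X := by
  have hc (f : X ⟶ X) : f ▷ dual X ≫ c.inv = c.inv ≫ dual X ◁ f := by
    rw [Iso.eq_inv_comp, ← Category.assoc, ← h, Category.assoc, Iso.hom_inv_id, Category.comp_id]
  let w : X ⟶ X := 𝟙 _ ⊗≫ X ◁ S.rightCv X ⊗≫ (c.inv ≫ ev X) ▷ X ⊗≫ 𝟙 _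
  have hw : w ▷ dual X ≫ S.rightEv X = c.inv ≫ ev X :=
    transpose_whiskerRight (S.rightCv_rightEv X) _
  have htw : w = t := by
    refine F.eq_of_tr S _ _ fun f => F.tr_eq_of_trR S ?_
    rw [S.trR_comm w f, S.trR_eq (f ≫ w), ← hS, S.trL_eq (t ≫ f),
      MonoidalCategory.whiskerLeft_comp_assoc, reassoc_of% ht, comp_whiskerRight_assoc, hw,
      reassoc_of% hc f]
  rw [← htw, hw, Iso.hom_inv_id_assoc]

include F in
lemma rightEv_centerTwist (hS : S.IsSpherical) (X : Center C) :
    ((dual X).2.β X.1).hom ≫ S.centerTwist X ▷ dual X.1 ≫ S.rightEv X.1 = ev X.1 := by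
  refine rightEv_of_rightCv S F hS ((dual X).2.β X.1) (fun f => (dual X).2.naturality f) ?_
  have hinv : (β_ (dual X) X).inv.f = ((dual X).2.β X.1).inv := by
    have h : (β_ (dual X) X).inv.f ≫ ((dual X).2.β X.1).hom = 𝟙 _ :=
      congrArg Center.Hom.f (β_ (dual X) X).inv_hom_id
    exact (Iso.comp_hom_eq_id _).mp h
  have h := congrArg Center.Hom.f ((centerSovereign S).rightCv_twist X)
  rw [braidedCv, Center.comp_f, Center.comp_f, hinv, centerSovereign_rightCv_f,
    Center.whiskerLeft_f, centerSovereign_twist_f] at h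
  exact h

include F in
lemma mate_center_twist (hS : S.IsSpherical) (X : Center C) :
    mate ((centerSovereign S).twist X).hom = ((centerSovereign S).twist (dual X)).hom := by
  symm
  refine (centerSovereign S).twist_dual_eq ?_
  rw [BraidedCategory.braiding_naturality_left_assoc, (centerSovereign S).mate_rightEv]
  apply Center.ext
  refine Eq.trans ?_ (rightEv_centerTwist S F hS X)
  rw [← centerSovereign_twist_f]
  rfl

/-- The ribbon structure of the center. -/
def centerRibbon (hS : S.IsSpherical) : RibbonStructure (Center C) where
  θ := (centerSovereign S).twist
  naturality := (centerSovereign S).twist_naturality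
  tensor := (centerSovereign S).twist_tensor
  selfDual := mate_center_twist S F hS

lemma centerRibbon_θ_hom_f (hS : S.IsSpherical) (X : Center C) :
    ((centerRibbon S F hS).θ X).hom.f = S.centerTwist X := centerSovereign_twist_f S X

end CenterTwist

end CategoricalCenter

namespace CategoricalCenter

/-! ### Decompositions in linear categories with split idempotents -/

section Regular

variable {k : Type w} [Field k] {D : Type u} [Category.{v} D] [Preadditive D] [Linear k D]

/-- Schur's lemma from regularity: `f ≫ g` and `g ≫ f` are scalars that fix the non-zero `f`, hence
both are `1`. -/
lemma IsScalar.nonempty_iso {X Y : D} (hX : IsScalar k X) (hY : IsScalar k Y) {f : X ⟶ Y}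
    (hf : f ≠ 0) {g : Y ⟶ X} (hg : f ≫ g ≫ f = f) : Nonempty (X ≅ Y) := by
  have h1 : f ≫ g = hX.coef (f ≫ g) • 𝟙 X := (hX.coef_smul_id _).symm
  have h2 : g ≫ f = hY.coef (g ≫ f) • 𝟙 Y := (hY.coef_smul_id _).symm
  have e1 : hX.coef (f ≫ g) • f = (1 : k) • f := by
    conv_rhs => rw [← hg, ← Category.assoc, h1]
    simp
  have e2 : hY.coef (g ≫ f) • f = (1 : k) • f := by
    conv_rhs => rw [← hg, h2]
    simp
  have c1 : hX.coef (f ≫ g) = 1 := smul_left_injective k hf e1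
  have c2 : hY.coef (g ≫ f) = 1 := smul_left_injective k hf e2
  exact ⟨⟨f, g, by rw [h1, c1, one_smul], by rw [h2, c2, one_smul]⟩⟩

/-- Conjugation embeds `End Y` into `End X`, and the identity of `X` is in the image only if the
retract is everything. -/
lemma finrank_end_lt {X Y : D} [Module.Finite k (X ⟶ X)] {s : Y ⟶ X} {t : X ⟶ Y}
    (hst : s ≫ t = 𝟙 Y) (hts : t ≫ s ≠ 𝟙 X) :
    Module.finrank k (Y ⟶ Y) < Module.finrank k (X ⟶ X) := by
  let L : (Y ⟶ Y) →ₗ[k] (X ⟶ X) := Linear.leftComp k X t ∘ₗ Linear.rightComp k Y s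
  have hL (f : Y ⟶ Y) : L f = t ≫ f ≫ s := rfl
  have hinj : Function.Injective L := by
    intro f g hfg
    have := congrArg (fun x => s ≫ x ≫ t) hfg
    simpa [hL, hst, reassoc_of% hst] using this
  rw [← LinearMap.finrank_range_of_inj hinj]
  refine Submodule.finrank_lt fun htop => hts ?_
  obtain ⟨f, hf⟩ : 𝟙 X ∈ LinearMap.range L := htop ▸ Submodule.mem_top
  rw [hL] at hf
  calc
    t ≫ s = t ≫ s ≫ t ≫ f ≫ s := by rw [hf, Category.comp_id]
    _ = 𝟙 X := by rw [reassoc_of% hst, hf]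

variable (k) in
/-- A finite orthogonal decomposition into scalar objects. -/
def HasScalarDecomposition (X : D) : Prop :=
  ∃ (ι : Type) (_ : Fintype ι) (N : ι → D) (q : ∀ a, N a ⟶ X) (p : ∀ a, X ⟶ N a),
    (∀ a, IsScalar k (N a)) ∧ (∀ a, q a ≫ p a = 𝟙 _) ∧ (∀ a b, a ≠ b → q a ≫ p b = 0) ∧
      ∑ a, p a ≫ q a = 𝟙 X

lemma HasScalarDecomposition.of_split {X Y Z : D} {s : Y ⟶ X} {t : X ⟶ Y} {s' : Z ⟶ X}
    {t' : X ⟶ Z} (h : s ≫ t = 𝟙 Y) (h' : s' ≫ t' = 𝟙 Z) (hsum : t ≫ s + t' ≫ s' = 𝟙 X)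
    (hY : HasScalarDecomposition k Y) (hZ : HasScalarDecomposition k Z) :
    HasScalarDecomposition k X := by
  obtain ⟨ι, _, N, q, p, hN, hqp, hne, htot⟩ := hY
  obtain ⟨ι', _, N', q', p', hN', hqp', hne', htot'⟩ := hZ
  have h0 : s ≫ t' = 0 := by
    have := congrArg (fun x => s ≫ x ≫ t') hsum
    simpa [h', reassoc_of% h] using this
  have h0' : s' ≫ t = 0 := by
    have := congrArg (fun x => s' ≫ x ≫ t) hsum
    simpa [h, reassoc_of% h'] using this
  refine ⟨ι ⊕ ι', inferInstance, Sum.elim N N',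
    fun a => match a with
      | Sum.inl a => q a ≫ s
      | Sum.inr a => q' a ≫ s',
    fun a => match a with
      | Sum.inl a => t ≫ p a
      | Sum.inr a => t' ≫ p' a, ?_, ?_, ?_, ?_⟩
  · rintro (a | a)
    · exact hN a
    · exact hN' a
  · rintro (a | a)
    · simp [reassoc_of% h, hqp]
    · simp [reassoc_of% h', hqp']
  · rintro (a | a) (b | b) hab
    · exact (by simp [reassoc_of% h, hne a b (fun e => hab (congrArg _ e))] :
        (q a ≫ s) ≫ t ≫ p b = 0)
    · exact (by simp [reassoc_of% h0] : (q a ≫ s) ≫ t' ≫ p' b = 0)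
    · exact (by simp [reassoc_of% h0'] : (q' a ≫ s') ≫ t ≫ p b = 0)
    · exact (by simp [reassoc_of% h', hne' a b (fun e => hab (congrArg _ e))] :
        (q' a ≫ s') ≫ t' ≫ p' b = 0)
  · have e : ∑ a, (t ≫ p a) ≫ q a ≫ s = t ≫ s := by
      have e (a) : (t ≫ p a) ≫ q a ≫ s = t ≫ (p a ≫ q a) ≫ s := by simp
      simp only [e]
      rw [← Preadditive.comp_sum, ← Preadditive.sum_comp, htot, Category.id_comp]
    have e' : ∑ a, (t' ≫ p' a) ≫ q' a ≫ s' = t' ≫ s' := by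
      have e (a) : (t' ≫ p' a) ≫ q' a ≫ s' = t' ≫ (p' a ≫ q' a) ≫ s' := by simp
      simp only [e]
      rw [← Preadditive.comp_sum, ← Preadditive.sum_comp, htot', Category.id_comp]
    rw [Fintype.sum_sum_type]
    exact (congrArg₂ (· + ·) e e').trans hsum

variable [IsAlgClosed k]

lemma hasScalarDecomposition (hfin : ∀ X Y : D, Module.Finite k (X ⟶ Y))
    (hreg : ∀ {X Y : D} (f : X ⟶ Y), ∃ g, f ≫ g ≫ f = f)
    (hsplit : ∀ {X : D} (e : X ⟶ X), e ≫ e = e →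
      ∃ (Y : D) (s : Y ⟶ X) (t : X ⟶ Y), s ≫ t = 𝟙 Y ∧ t ≫ s = e) (X : D) :
    HasScalarDecomposition k X := by
  induction hn : Module.finrank k (X ⟶ X) using Nat.strong_induction_on generalizing X with
  | _ n ih =>
    by_cases h0 : 𝟙 X = 0
    · exact ⟨Empty, inferInstance, fun a => a.elim, fun a => a.elim, fun a => a.elim,
        fun a => a.elim, fun a => a.elim, fun a => a.elim, by simp [h0]⟩
    by_cases hs : IsScalar k X
    · exact ⟨Unit, inferInstance, fun _ => X, fun _ => 𝟙 X, fun _ => 𝟙 X, fun _ => hs,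
        fun _ => Category.comp_id _, fun a b hab => (hab rfl).elim, by simp⟩
    obtain ⟨f, hf⟩ : ∃ f : X ⟶ X, ∀ a : k, a • 𝟙 X ≠ f := by
      by_contra! hc
      exact hs ⟨smul_left_injective k h0, hc⟩
    have := hfin X X
    have : Nontrivial (X ⟶ X) := ⟨⟨_, _, h0⟩⟩
    -- An eigenvector of composition with `f` shows that `f - μ` is a zero divisor. Its generalized
    -- inverse then yields an idempotent different from `0` and `1`, along which `X` splits into
    -- objects with smaller endomorphism algebras.
    obtain ⟨μ, hμ⟩ := Module.End.exists_eigenvalue (Linear.leftComp k X f)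
    obtain ⟨h, hh⟩ := hμ.exists_hasEigenvector
    have hh1 : f ≫ h = μ • h := hh.apply_eq_smul
    set x : X ⟶ X := f - μ • 𝟙 X with hx
    have hx0 : x ≠ 0 := fun e => hf μ (sub_eq_zero.1 e).symm
    have hxh : x ≫ h = 0 := by rw [hx, Preadditive.sub_comp, hh1]; simp
    obtain ⟨g, hg⟩ := hreg x
    have he : (g ≫ x) ≫ g ≫ x = g ≫ x := by rw [Category.assoc, hg]
    have he1 : g ≫ x ≠ 𝟙 X := fun e => hh.2 (by
      rw [← Category.id_comp h, ← e, Category.assoc, hxh, comp_zero])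
    have he0 : g ≫ x ≠ 0 := fun e => hx0 (by rw [← hg, e, comp_zero])
    obtain ⟨Y, s, t, hst, hts⟩ := hsplit (g ≫ x) he
    obtain ⟨Z, s', t', hst', hts'⟩ := hsplit (𝟙 X - g ≫ x) (by
      simp only [Preadditive.sub_comp, Preadditive.comp_sub, he, Category.id_comp,
        Category.comp_id]; abel)
    refine HasScalarDecomposition.of_split hst hst' (by rw [hts, hts']; abel)
      (ih _ ?_ Y rfl) (ih _ ?_ Z rfl)
    · exact hn ▸ finrank_end_lt hst (hts ▸ he1)
    · refine hn ▸ finrank_end_lt hst' fun e => he0 ?_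
      rw [hts', sub_eq_self] at e
      exact e

omit [IsAlgClosed k] in
-- A non-zero morphism from `G j` to a scalar object is non-zero on some scalar summand of `G j`,
-- which is then isomorphic to the target. So the summands of the `G j`, up to isomorphism, are all
-- the scalar objects.
lemma exists_scalar_representatives
    (hreg : ∀ {X Y : D} (f : X ⟶ Y), ∃ g, f ≫ g ≫ f = f)
    (hdec : ∀ X : D, HasScalarDecomposition k X)
    {κ : Type} [Fintype κ] (G : κ → D)
    (hG : ∀ X : D, IsScalar k X → ∃ (j : κ) (f : G j ⟶ X), f ≠ 0) :
    ∃ (I : Type) (_ : Fintype I) (V : I → D), (∀ i, IsScalar k (V i)) ∧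
      (∀ i j, i ≠ j → ∀ f : V i ⟶ V j, f = 0) ∧
      ∀ X : D, IsScalar k X → ∃ i, Nonempty (X ≅ V i) := by
  classical
  choose ι hι N q p hN hqp hne htot using fun j => hdec (G j)
  let T : Type := Σ j, ι j
  let W : T → D := fun z => N z.1 z.2
  let r : Setoid T :=
    { r := fun a b => Nonempty (W a ≅ W b)
      iseqv := ⟨fun a => ⟨Iso.refl _⟩, fun ⟨e⟩ => ⟨e.symm⟩, fun ⟨e⟩ ⟨e'⟩ => ⟨e.trans e'⟩⟩ }
  refine ⟨Quotient r, Fintype.ofFinite _, fun c => W c.out, fun c => hN _ _, ?_, ?_⟩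
  · intro c c' hcc f
    by_contra hf
    obtain ⟨g, hg⟩ := hreg f
    exact hcc (Quotient.out_equiv_out.1 ((hN _ _).nonempty_iso (hN _ _) hf hg))
  · intro X hX
    obtain ⟨j, f, hf⟩ := hG X hX
    obtain ⟨a, ha⟩ : ∃ a, q j a ≫ f ≠ 0 := by
      by_contra! hc
      refine hf ?_
      rw [← Category.id_comp f, ← htot j, Preadditive.sum_comp]
      exact Finset.sum_eq_zero fun a _ => by rw [Category.assoc, hc, comp_zero]
    obtain ⟨g, hg⟩ := hreg (q j a ≫ f)
    obtain ⟨e⟩ := (hN j a).nonempty_iso hX ha hg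
    obtain ⟨e'⟩ : Nonempty (W ⟨j, a⟩ ≅ W (Quotient.mk r ⟨j, a⟩).out) :=
      Setoid.symm (Quotient.mk_out (s := r) ⟨j, a⟩)
    exact ⟨Quotient.mk r ⟨j, a⟩, ⟨e.symm.trans e'⟩⟩

end Regular

section Existence

variable {k : Type w} [Field k] {D : Type u} [Category.{v} D] [MonoidalCategory D]
  [RigidCategory D] [Preadditive D] [Linear k D]

lemma nonempty_fusionStructure [HasFiniteBiproducts D]
    (hdec : ∀ X : D, HasScalarDecomposition k X) (h1 : IsScalar k (𝟙_ D)) {I : Type} [Fintype I]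
    (V : I → D) (hV : ∀ i, IsScalar k (V i)) (hne : ∀ i j, i ≠ j → ∀ f : V i ⟶ V j, f = 0)
    (hrep : ∀ X : D, IsScalar k X → ∃ i, Nonempty (X ≅ V i)) :
    Nonempty (FusionStructure k D) := by
  refine ⟨⟨inferInstance, I, V, hne, hV, fun X => ?_, hrep _ h1⟩⟩
  obtain ⟨ι, _, N, q, p, hN, hqp, hqp0, htot⟩ := hdec X
  choose j e using fun a => hrep (N a) (hN a)
  let n := Fintype.card ι
  let σ : Fin n ≃ ι := (Fintype.equivFin ι).symm
  refine ⟨n, fun a => j (σ a), ⟨⟨biproduct.lift fun a => p (σ a) ≫ (e (σ a)).some.hom,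
    biproduct.desc fun a => (e (σ a)).some.inv ≫ q (σ a), ?_, ?_⟩⟩⟩
  · rw [biproduct.lift_desc, ← htot, ← Equiv.sum_comp σ]
    simp
  · refine biproduct.hom_ext' _ _ fun a => biproduct.hom_ext _ _ fun b => ?_
    by_cases hab : a = b
    · subst hab
      simp [reassoc_of% hqp]
    · have h := hqp0 (σ a) (σ b) (fun h => hab (σ.injective h))
      simp [reassoc_of% h, biproduct.ι_π_ne _ hab]

end Existence

end CategoricalCenter

namespace CategoricalCenter

/-! ### Sums and retracts in the center -/

section Retract

variable {C : Type u} [Category.{v} C] [MonoidalCategory C] [Preadditive C]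
  [MonoidalPreadditive C] {ι : Type*} [Fintype ι] {M : ι → Center C} {X : C}
  (r : ∀ a, X ⟶ (M a).1) (s : ∀ a, (M a).1 ⟶ X)

/-- The half braiding of an object presented by objects of the center. -/
def retractBraid (U : C) : X ⊗ U ⟶ U ⊗ X := ∑ a, r a ▷ U ≫ ((M a).2.β U).hom ≫ U ◁ s a

variable (t : ∀ a b, M a ⟶ M b) (ht : ∀ a b, s a ≫ r b = (t a b).f)
  (h : ∑ a, r a ≫ s a = 𝟙 X)

include ht h

/-- The matrix `t` is an idempotent on `⨁ M a` with image `X`; its entries are central and hence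
pass through the half braidings. The same construction serves for direct sums and for images of
idempotents. -/
lemma retractBraid_comp (U : C) (b : ι) :
    retractBraid r s U ≫ U ◁ r b = r b ▷ U ≫ ((M b).2.β U).hom := by
  have h1 (a) : (r a ▷ U ≫ ((M a).2.β U).hom ≫ U ◁ s a) ≫ U ◁ r b =
      (r a ≫ s a) ▷ U ≫ r b ▷ U ≫ ((M b).2.β U).hom := by
    rw [Category.assoc, Category.assoc, ← MonoidalCategory.whiskerLeft_comp, ht, ← (t a b).comm,
      ← ht]
    simp
  rw [retractBraid, Preadditive.sum_comp]
  simp only [h1]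
  rw [← Preadditive.sum_comp, ← sum_whiskerRight, h]
  simp

lemma comp_retractBraid (U : C) (b : ι) :
    s b ▷ U ≫ retractBraid r s U = ((M b).2.β U).hom ≫ U ◁ s b := by
  have h1 (a) : s b ▷ U ≫ r a ▷ U ≫ ((M a).2.β U).hom ≫ U ◁ s a =
      ((M b).2.β U).hom ≫ U ◁ s b ≫ U ◁ (r a ≫ s a) := by
    rw [← comp_whiskerRight_assoc, ht, (t b a).comm_assoc, ← ht]
    simp
  rw [retractBraid, Preadditive.comp_sum]
  simp only [h1]
  rw [← Preadditive.comp_sum, ← Preadditive.comp_sum, ← whiskerLeft_sum, h]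
  simp

omit ht h in
lemma center_sum_f {A B : Center C} {κ : Type*} (T : Finset κ) (f : κ → (A ⟶ B)) :
    (∑ a ∈ T, f a).f = ∑ a ∈ T, (f a).f :=
  map_sum (AddMonoidHom.mk' (fun g : A ⟶ B => g.f) fun _ _ => rfl) f T

variable [RigidCategory C]

/-- The object of the center determined by a presentation. -/
def centerRetract : Center C :=
  ⟨X, halfBraidingOfLax (retractBraid r s)
    (fun {U U'} f => by
      rw [retractBraid, retractBraid, Preadditive.comp_sum, Preadditive.sum_comp]
      refine Finset.sum_congr rfl fun a _ => ?_
      rw [whisker_exchange_assoc, HalfBraiding.naturality_assoc, Category.assoc, Category.assoc,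
        whisker_exchange])
    (fun U U' => by
      have h1 : retractBraid r s U' = ∑ a, r a ▷ U' ≫ ((M a).2.β U').hom ≫ U' ◁ s a := rfl
      rw [h1, retractBraid, whiskerLeft_sum, Preadditive.sum_comp, Preadditive.comp_sum,
        Preadditive.comp_sum, Preadditive.comp_sum]
      refine Finset.sum_congr rfl fun a _ => ?_
      symm
      calc
        _ = 𝟙 _ ⊗≫ (retractBraid r s U ≫ U ◁ r a) ▷ U' ⊗≫ U ◁ ((M a).2.β U').hom ⊗≫
            (U ⊗ U') ◁ s a := by monoidal
        _ = _ := by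
          rw [retractBraid_comp r s t ht h, HalfBraiding.monoidal]; monoidal)
    (by
      have h1 (a) : r a ▷ 𝟙_ C ≫ ((M a).2.β (𝟙_ C)).hom ≫ 𝟙_ C ◁ s a =
          (ρ_ X).hom ≫ (r a ≫ s a) ≫ (λ_ X).inv := by
        rw [halfBraiding_unit]; monoidal
      rw [retractBraid]
      simp only [h1]
      rw [← Preadditive.comp_sum, ← Preadditive.sum_comp, h, Category.id_comp])⟩

/-- The projections of a presented object of the center. -/
def centerRetractπ (a : ι) : centerRetract r s t ht h ⟶ M a where
  f := r a
  comm U := (retractBraid_comp r s t ht h U a).symm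

/-- The inclusions of a presented object of the center. -/
def centerRetractι (a : ι) : M a ⟶ centerRetract r s t ht h where
  f := s a
  comm U := comp_retractBraid r s t ht h U a

omit ht h

instance center_hasFiniteBiproducts [HasFiniteBiproducts C] :
    HasFiniteBiproducts (Center C) := by
  classical
  refine ⟨fun n => ⟨fun M => ?_⟩⟩
  let X : C := ⨁ fun a => (M a).1
  let r (a) : X ⟶ (M a).1 := biproduct.π (fun a => (M a).1) a
  let s (a) : (M a).1 ⟶ X := biproduct.ι (fun a => (M a).1) a
  let t (a b) : M a ⟶ M b := if h : a = b then eqToHom (by rw [h]) else 0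
  have ht (a b) : s a ≫ r b = (t a b).f := by
    by_cases hab : a = b
    · subst hab
      simp [s, r, t]
    · simp [s, r, t, hab, biproduct.ι_π_ne _ hab]
  have h : ∑ a, r a ≫ s a = 𝟙 X := biproduct.total
  let b : Bicone M :=
    { pt := centerRetract r s t ht h
      π := fun a => centerRetractπ r s t ht h a
      ι := fun a => centerRetractι r s t ht h a
      ι_π := fun a b => by
        have e : centerRetractι r s t ht h a ≫ centerRetractπ r s t ht h b = t a b :=
          Center.ext _ _ (ht a b)
        rw [e]
        dsimp only [t]
        split_ifs <;> rfl }
  exact hasBiproduct_of_total b (Center.ext _ _ ((center_sum_f _ _).trans h))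

end Retract

/-! ### Idempotents and generalized inverses in the center -/

section Regular

variable {k : Type w} [Field k]
  {C : Type u} [Category.{v} C] [MonoidalCategory C] [RigidCategory C] [Preadditive C] [Linear k C]
  [MonoidalPreadditive C] [MonoidalLinear k C] (F : FusionStructure k C) {S : SovereignStructure C}

include F

omit [MonoidalLinear k C] in
lemma center_exists_split {M : Center C} (e : M ⟶ M) (he : e ≫ e = e) :
    ∃ (N : Center C) (s : N ⟶ M) (t : M ⟶ N), s ≫ t = 𝟙 N ∧ t ≫ s = e := by
  obtain ⟨Y, s, t, hst, hts⟩ := F.exists_split e.f (congrArg Center.Hom.f he)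
  have h : ∑ _ : Unit, s ≫ t = 𝟙 Y := by simpa using hst
  let N : Center C := centerRetract (M := fun _ => M) (fun _ => s) (fun _ => t) (fun _ _ => e)
    (fun _ _ => hts) h
  let s' : N ⟶ M := centerRetractπ (M := fun _ => M) (fun _ => s) (fun _ => t) (fun _ _ => e)
    (fun _ _ => hts) h ()
  let t' : M ⟶ N := centerRetractι (M := fun _ => M) (fun _ => s) (fun _ => t) (fun _ _ => e)
    (fun _ _ => hts) h ()
  exact ⟨N, s', t', Center.ext _ _ hst, Center.ext _ _ hts⟩

lemma center_finite_hom (M N : Center C) : Module.Finite k (M ⟶ N) := by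
  have := F.finite_hom M.1 N.1
  let L : (M ⟶ N) →ₗ[k] (M.1 ⟶ N.1) :=
    { toFun := Center.Hom.f, map_add' := fun _ _ => rfl, map_smul' := fun _ _ => rfl }
  exact Module.Finite.of_injective L fun f g hfg => Center.ext _ _ hfg

omit [MonoidalPreadditive C] [MonoidalLinear k C] in
lemma FusionStructure.coef_dim_ne_zero (hdim : IsUnit (F.dim S)) :
    F.isScalar_unit.coef (F.dim S) ≠ 0 := fun h0 => by
  rw [F.isScalar_unit.coef_eq_zero] at h0
  obtain ⟨c, hc⟩ := hdim.exists_right_inv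
  rw [h0, zero_mul] at hc
  exact F.isScalar_unit.id_ne_zero hc.symm

/-- Maschke's argument: averaging `f ≫ g ≫ f = f` pulls the central `f` out on both sides and
multiplies the right side by the dimension, which is then divided out. -/
lemma center_exists_generalized_inverse (hS : S.IsSpherical) (hdim : IsUnit (F.dim S))
    {M N : Center C} (f : M ⟶ N) : ∃ g : N ⟶ M, f ≫ g ≫ f = f := by
  obtain ⟨g, hg⟩ := F.exists_generalized_inverse f.f
  refine ⟨(F.isScalar_unit.coef (F.dim S))⁻¹ • F.avg S hS N M g, Center.ext _ _ ?_⟩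
  have h := F.avgHom_comp S f g f
  have h' := F.avgHom_comp S f (𝟙 N.1) (𝟙 N)
  rw [F.avgHom_id S hS] at h'
  rw [hg] at h
  rw [Linear.smul_comp, Linear.comp_smul, center_smul_f, Center.comp_f, Center.comp_f, F.avg_f,
    ← h]
  have h2 : f.f ≫ 𝟙 N.1 ≫ (𝟙 N : N ⟶ N).f = f.f := by simp
  rw [h2] at h'
  rw [h', Linear.smul_comp, Linear.comp_smul, smul_smul, inv_mul_cancel₀ (F.coef_dim_ne_zero hdim), one_smul]
  exact h2

end Regular

end CategoricalCenter

namespace CategoricalCenter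

/-! ### The induced objects -/

section ToDual

variable {C : Type u} [Category.{v} C] [MonoidalCategory C] [RightRigidCategory C]

lemma comp_toDual {X Y Y' : C} (g : Y ⟶ Y') (e : Y' ⊗ X ⟶ 𝟙_ C) :
    g ≫ toDual e = toDual (g ▷ X ≫ e) := by
  refine dual_hom_ext ?_
  rw [comp_whiskerRight_assoc, toDual_ev, toDual_ev]

lemma toDual_ev_self (X : C) : toDual (ev X) = 𝟙 (dual X) := by
  refine dual_hom_ext ?_
  rw [toDual_ev]; simp

lemma toDual_whiskerLeft_ev {X X' : C} (f : X ⟶ X') : toDual (dual X' ◁ f ≫ ev X') = mate f := by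
  refine dual_hom_ext ?_
  rw [toDual_ev, mate_ev]

variable {k : Type w} [CommRing k] [Preadditive C] [Linear k C] [MonoidalPreadditive C]
  [MonoidalLinear k C]

lemma toDual_add {X Y : C} (e e' : Y ⊗ X ⟶ 𝟙_ C) : toDual (e + e') = toDual e + toDual e' := by
  refine dual_hom_ext ?_
  rw [MonoidalPreadditive.add_whiskerRight, Preadditive.add_comp, toDual_ev, toDual_ev, toDual_ev]

lemma toDual_smul {X Y : C} (a : k) (e : Y ⊗ X ⟶ 𝟙_ C) : toDual (a • e) = a • toDual e := by
  refine dual_hom_ext ?_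
  rw [MonoidalLinear.smul_whiskerRight, Linear.smul_comp, toDual_ev, toDual_ev]

end ToDual

namespace FusionStructure

variable {k : Type w} [Field k]
  {C : Type u} [Category.{v} C] [MonoidalCategory C] [RigidCategory C] [Preadditive C] [Linear k C]
  (F : FusionStructure k C)

/-- The element `∑ inj ⊗ proj` is dinatural in `X`. All (di)naturality of the induced objects rests
on this. -/
lemma sum_slide {X X' : C} (i : F.I) {A : Type*} [AddCommGroup A] [Module k A]
    (Φ : (F.V i ⟶ X') →ₗ[k] (X ⟶ F.V i) →ₗ[k] A) (f : X ⟶ X') :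
    ∑ a, Φ (F.inj X i a ≫ f) (F.proj X i a) = ∑ b, Φ (F.inj X' i b) (f ≫ F.proj X' i b) := by
  have h1 (a) : Φ (F.inj X i a ≫ f) (F.proj X i a) =
      ∑ b, F.coef i (F.inj X i a ≫ f ≫ F.proj X' i b) • Φ (F.inj X' i b) (F.proj X i a) := by
    conv_lhs => rw [F.expand (F.inj X i a ≫ f)]
    simp [LinearMap.sum_apply]
  have h2 (b) : Φ (F.inj X' i b) (f ≫ F.proj X' i b) =
      ∑ a, F.coef i (F.inj X i a ≫ f ≫ F.proj X' i b) • Φ (F.inj X' i b) (F.proj X i a) := by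
    conv_lhs => rw [F.expand' (f ≫ F.proj X' i b)]
    simp
  simp only [h1, h2]
  exact Finset.sum_comm

/-- The decomposition chosen for `V i` need not be the trivial one; bilinearity makes the sum
independent of that choice. -/
lemma sum_inj_proj (i : F.I) {A : Type*} [AddCommGroup A] [Module k A]
    (Φ : ∀ j : F.I, (F.V j ⟶ F.V i) →ₗ[k] (F.V i ⟶ F.V j) →ₗ[k] A) :
    ∑ j, ∑ a, Φ j (F.inj (F.V i) j a) (F.proj (F.V i) j a) = Φ i (𝟙 _) (𝟙 _) := by
  rw [Finset.sum_eq_single i]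
  · have h (a) : Φ i (F.inj (F.V i) i a) (F.proj (F.V i) i a) =
        Φ i (𝟙 _) (F.coef i (F.inj (F.V i) i a ≫ 𝟙 _) • F.proj (F.V i) i a) := by
      conv_lhs => rw [← (F.isScalar i).coef_smul_id (F.inj (F.V i) i a)]
      simp
    simp only [h]
    rw [← map_sum, ← F.expand']
  · intro j _ hj
    refine Finset.sum_eq_zero fun a _ => ?_
    rw [F.hom_eq_zero j i hj (F.inj (F.V i) j a)]; simp
  · simp

variable [HasFiniteBiproducts C]

/-- The direct sum of the objects `(V i)* ⊗ W ⊗ V i`. -/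
def ind (W : C) : C := ⨁ fun i => dual (F.V i) ⊗ (W ⊗ F.V i)

/-- The inclusion of a summand. -/
def indι (W : C) (i : F.I) : dual (F.V i) ⊗ (W ⊗ F.V i) ⟶ F.ind W :=
  biproduct.ι (fun i => dual (F.V i) ⊗ (W ⊗ F.V i)) i

/-- The projection to a summand. -/
def indπ (W : C) (i : F.I) : F.ind W ⟶ dual (F.V i) ⊗ (W ⊗ F.V i) :=
  biproduct.π (fun i => dual (F.V i) ⊗ (W ⊗ F.V i)) i

lemma indι_indπ_self (W : C) (i : F.I) : F.indι W i ≫ F.indπ W i = 𝟙 _ :=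
  biproduct.ι_π_self _ _

lemma indι_indπ_ne (W : C) {i j : F.I} (h : i ≠ j) : F.indι W i ≫ F.indπ W j = 0 :=
  biproduct.ι_π_ne _ h

lemma ind_total (W : C) : ∑ i, F.indπ W i ≫ F.indι W i = 𝟙 (F.ind W) := biproduct.total

lemma map_ind_hom_ext {E : Type*} [Category* E] [Preadditive E] (G : C ⥤ E) [G.Additive] {W : C}
    {D : E} {f g : G.obj (F.ind W) ⟶ D}
    (h : ∀ i, G.map (F.indι W i) ≫ f = G.map (F.indι W i) ≫ g) : f = g := by
  rw [← Category.id_comp f, ← Category.id_comp g, ← G.map_id, ← F.ind_total, G.map_sum,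
    Preadditive.sum_comp, Preadditive.sum_comp]
  refine Finset.sum_congr rfl fun i _ => ?_
  rw [G.map_comp, Category.assoc, Category.assoc, h]

variable [MonoidalPreadditive C]

/-- The summands of `indMap` as a bilinear map. -/
def indBilin [MonoidalLinear k C] (W : C) {X X' Y : C} (e : Y ⊗ X ⟶ 𝟙_ C) (i : F.I) :
    (F.V i ⟶ X) →ₗ[k] (X' ⟶ F.V i) →ₗ[k] (Y ⊗ (W ⊗ X') ⟶ F.ind W) :=
  LinearMap.mk₂ k (fun u p => toDual (Y ◁ u ≫ e) ▷ (W ⊗ X') ≫ dual (F.V i) ◁ W ◁ p ≫ F.indι W i)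
    (by intro u u' p; simp [toDual_add]) (by intro c u p; simp [toDual_smul])
    (by intro u p p'; simp) (by intro c u p; simp)

/-- The canonical morphism to an induced object determined by a pairing. -/
def indMap (W : C) {X Y : C} (e : Y ⊗ X ⟶ 𝟙_ C) : Y ⊗ (W ⊗ X) ⟶ F.ind W :=
  ∑ i, ∑ a, toDual (Y ◁ F.inj X i a ≫ e) ▷ (W ⊗ X) ≫ dual (F.V i) ◁ W ◁ F.proj X i a ≫ F.indι W i

/-- The maps `indMap` are indexed by arbitrary pairings `Y ⊗ X ⟶ 𝟙_` rather than by objects.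
Dinaturality thus splits into two plain naturalities, and pairings such as `nest e (ev U)`, whose
left factor is only isomorphic to a dual, need no correction. -/
lemma whiskerLeft_indMap [MonoidalLinear k C] (W : C) {X X' Y : C} (f : X ⟶ X') (e : Y ⊗ X' ⟶ 𝟙_ C) :
    Y ◁ W ◁ f ≫ F.indMap W e = F.indMap W (Y ◁ f ≫ e) := by
  rw [indMap, indMap, Preadditive.comp_sum]
  refine Finset.sum_congr rfl fun i _ => ?_
  rw [Preadditive.comp_sum]
  refine Eq.trans ?_ ((F.sum_slide i (F.indBilin W e i) f).symm.trans ?_)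
  · refine Finset.sum_congr rfl fun a _ => ?_
    rw [indBilin, LinearMap.mk₂_apply, whisker_exchange_assoc]
    simp
  · refine Finset.sum_congr rfl fun a _ => ?_
    rw [indBilin, LinearMap.mk₂_apply, MonoidalCategory.whiskerLeft_comp_assoc]

omit [MonoidalPreadditive C] in
lemma whiskerRight_indMap (W : C) {X Y Y' : C} (g : Y ⟶ Y') (e : Y' ⊗ X ⟶ 𝟙_ C) :
    g ▷ (W ⊗ X) ≫ F.indMap W e = F.indMap W (g ▷ X ≫ e) := by
  rw [indMap, indMap, Preadditive.comp_sum]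
  refine Finset.sum_congr rfl fun i _ => ?_
  rw [Preadditive.comp_sum]
  refine Finset.sum_congr rfl fun a _ => ?_
  rw [← comp_whiskerRight_assoc, comp_toDual, whisker_exchange_assoc]

lemma indMap_ev [MonoidalLinear k C] (W : C) (i : F.I) : F.indMap W (ev (F.V i)) = F.indι W i := by
  rw [indMap]
  refine (F.sum_inj_proj i (F.indBilin W (ev (F.V i)))).trans ?_
  rw [indBilin, LinearMap.mk₂_apply]
  simp [toDual_ev_self]

/-- The universal property of the coend of `X* ⊗ W ⊗ X`, after any additive functor `G`. The cases
needed are the identity and tensoring with `U`. -/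
lemma map_indMap_desc {E : Type*} [Category* E] [Preadditive E] (G : C ⥤ E) [G.Additive] {W : C}
    {D : E} (d : ∀ {X Y : C}, (Y ⊗ X ⟶ 𝟙_ C) → (G.obj (Y ⊗ (W ⊗ X)) ⟶ D))
    (hl : ∀ {X X' Y : C} (f : X ⟶ X') (e : Y ⊗ X' ⟶ 𝟙_ C),
      G.map (Y ◁ W ◁ f) ≫ d e = d (Y ◁ f ≫ e))
    (hr : ∀ {X Y Y' : C} (g : Y ⟶ Y') (e : Y' ⊗ X ⟶ 𝟙_ C),
      G.map (g ▷ (W ⊗ X)) ≫ d e = d (g ▷ X ≫ e)) {X Y : C} (e : Y ⊗ X ⟶ 𝟙_ C) :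
    G.map (F.indMap W e) ≫ ∑ i, G.map (F.indπ W i) ≫ d (ev (F.V i)) = d e := by
  have h0 (i) : G.map (F.indι W i) ≫ ∑ i, G.map (F.indπ W i) ≫ d (ev (F.V i)) =
      d (ev (F.V i)) := by
    rw [Preadditive.comp_sum, Finset.sum_eq_single i]
    · rw [← Category.assoc, ← G.map_comp, indι_indπ_self, G.map_id, Category.id_comp]
    · intro j _ hj
      rw [← Category.assoc, ← G.map_comp, F.indι_indπ_ne W hj.symm, G.map_zero, zero_comp]
    · simp
  have h1 (i) (a : F.Mult X i) : G.map (toDual (Y ◁ F.inj X i a ≫ e) ▷ (W ⊗ X) ≫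
      dual (F.V i) ◁ W ◁ F.proj X i a ≫ F.indι W i) ≫
      ∑ i, G.map (F.indπ W i) ≫ d (ev (F.V i)) =
      G.map (Y ◁ W ◁ (F.proj X i a ≫ F.inj X i a)) ≫ d e := by
    rw [← whisker_exchange_assoc, G.map_comp, G.map_comp, Category.assoc, Category.assoc, h0, hr,
      toDual_ev, MonoidalCategory.whiskerLeft_comp, MonoidalCategory.whiskerLeft_comp, G.map_comp,
      Category.assoc, ← hl]
  rw [indMap, G.map_sum, Preadditive.sum_comp]
  simp only [G.map_sum, Preadditive.sum_comp, h1]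
  simp only [← Preadditive.sum_comp, ← G.map_sum, ← whiskerLeft_sum, F.total]
  simp

end FusionStructure

end CategoricalCenter

namespace CategoricalCenter

/-! ### The half braiding of the induced objects -/

section Nest

variable {C : Type u} [Category.{v} C] [MonoidalCategory C]

lemma nest_left_whiskerLeft {A A₁ A' B B' : C} (f : A ⟶ A₁) (a : A' ⊗ A₁ ⟶ 𝟙_ C)
    (b : B' ⊗ B ⟶ 𝟙_ C) : (B' ⊗ A') ◁ (f ▷ B) ≫ nest a b = nest (A' ◁ f ≫ a) b := by
  rw [nest, nest]; monoidal

lemma nest_left_whiskerRight {A A' A₁' B B' : C} (g : A' ⟶ A₁') (a : A₁' ⊗ A ⟶ 𝟙_ C)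
    (b : B' ⊗ B ⟶ 𝟙_ C) : (B' ◁ g) ▷ (A ⊗ B) ≫ nest a b = nest (g ▷ A ≫ a) b := by
  rw [nest, nest]; monoidal

lemma nest_right_whiskerLeft {A A' B B₁ B' : C} (f : B ⟶ B₁) (a : A' ⊗ A ⟶ 𝟙_ C)
    (b : B' ⊗ B₁ ⟶ 𝟙_ C) : (B' ⊗ A') ◁ (A ◁ f) ≫ nest a b = nest a (B' ◁ f ≫ b) :=
  calc
    _ = 𝟙 _ ⊗≫ B' ◁ ((A' ⊗ A) ◁ f ≫ a ▷ B₁) ⊗≫ b := by rw [nest]; monoidal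
    _ = _ := by rw [whisker_exchange, nest]; monoidal

lemma nest_right_whiskerRight {A A' B B' B₁' : C} (g : B' ⟶ B₁') (a : A' ⊗ A ⟶ 𝟙_ C)
    (b : B₁' ⊗ B ⟶ 𝟙_ C) : (g ▷ A') ▷ (A ⊗ B) ≫ nest a b = nest a (g ▷ B ≫ b) :=
  calc
    _ = 𝟙 _ ⊗≫ (g ▷ (A' ⊗ A) ≫ B₁' ◁ a) ▷ B ⊗≫ b := by rw [nest]; monoidal
    _ = _ := by rw [← whisker_exchange, nest]; monoidal

lemma nest_nest {A A' B B' D D' : C} (e : A' ⊗ A ⟶ 𝟙_ C) (a : B' ⊗ B ⟶ 𝟙_ C)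
    (b : D' ⊗ D ⟶ 𝟙_ C) : nest e (nest a b) =
      (α_ D' B' A').hom ▷ (A ⊗ (B ⊗ D)) ≫ (D' ⊗ (B' ⊗ A')) ◁ (α_ A B D).inv ≫
        nest (nest e a) b := by
  rw [nest, nest, nest, nest]; monoidal

end Nest

namespace FusionStructure

variable {k : Type w} [Field k]
  {C : Type u} [Category.{v} C] [MonoidalCategory C] [RigidCategory C] [Preadditive C] [Linear k C]
  (F : FusionStructure k C) [HasFiniteBiproducts C] [MonoidalPreadditive C] [MonoidalLinear k C]

/-- The half braiding of an induced object, on the image of `indMap`. -/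
def indBraidMap (W U : C) {X Y : C} (e : Y ⊗ X ⟶ 𝟙_ C) :
    (Y ⊗ (W ⊗ X)) ⊗ U ⟶ U ⊗ F.ind W :=
  𝟙 _ ⊗≫ cv U ▷ ((Y ⊗ (W ⊗ X)) ⊗ U) ⊗≫ U ◁ F.indMap W (nest e (ev U))

/-- The half braiding of an induced object. -/
def indBraid (W U : C) : F.ind W ⊗ U ⟶ U ⊗ F.ind W :=
  ∑ i, F.indπ W i ▷ U ≫ F.indBraidMap W U (ev (F.V i))

lemma ind_whiskerRight_hom_ext {W U D : C} {f g : F.ind W ⊗ U ⟶ D}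
    (h : ∀ i, F.indMap W (ev (F.V i)) ▷ U ≫ f = F.indMap W (ev (F.V i)) ▷ U ≫ g) : f = g :=
  F.map_ind_hom_ext (tensorRight U) fun i => by
    have h := h i
    rw [indMap_ev] at h
    exact h

lemma indMap_indBraid (W U : C) {X Y : C} (e : Y ⊗ X ⟶ 𝟙_ C) :
    F.indMap W e ▷ U ≫ F.indBraid W U = F.indBraidMap W U e := by
  refine F.map_indMap_desc (tensorRight U) (fun e => F.indBraidMap W U e) ?_ ?_ e
  · intro X X' Y f e
    change (Y ◁ W ◁ f) ▷ U ≫ F.indBraidMap W U e = _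
    calc
      _ = 𝟙 _ ⊗≫ (𝟙_ C ◁ ((Y ◁ W ◁ f) ▷ U) ≫ cv U ▷ ((Y ⊗ (W ⊗ X')) ⊗ U)) ⊗≫
          U ◁ F.indMap W (nest e (ev U)) := by rw [indBraidMap]; monoidal
      _ = 𝟙 _ ⊗≫ cv U ▷ ((Y ⊗ (W ⊗ X)) ⊗ U) ⊗≫
          U ◁ ((dual U ⊗ Y) ◁ W ◁ (f ▷ U) ≫ F.indMap W (nest e (ev U))) := by
        rw [whisker_exchange]; monoidal
      _ = _ := by rw [whiskerLeft_indMap, nest_left_whiskerLeft, indBraidMap]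
  · intro X Y Y' g e
    change (g ▷ (W ⊗ X)) ▷ U ≫ F.indBraidMap W U e = _
    calc
      _ = 𝟙 _ ⊗≫ (𝟙_ C ◁ ((g ▷ (W ⊗ X)) ▷ U) ≫ cv U ▷ ((Y' ⊗ (W ⊗ X)) ⊗ U)) ⊗≫
          U ◁ F.indMap W (nest e (ev U)) := by rw [indBraidMap]; monoidal
      _ = 𝟙 _ ⊗≫ cv U ▷ ((Y ⊗ (W ⊗ X)) ⊗ U) ⊗≫
          U ◁ ((dual U ◁ g) ▷ (W ⊗ (X ⊗ U)) ≫ F.indMap W (nest e (ev U))) := by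
        rw [whisker_exchange]; monoidal
      _ = _ := by rw [whiskerRight_indMap, nest_left_whiskerRight, indBraidMap]

lemma indMap_indBraid_assoc (W U : C) {X Y Z : C} (e : Y ⊗ X ⟶ 𝟙_ C) (g : U ⊗ F.ind W ⟶ Z) :
    F.indMap W e ▷ U ≫ F.indBraid W U ≫ g = F.indBraidMap W U e ≫ g := by
  rw [← Category.assoc, indMap_indBraid]

lemma indBraidMap_naturality (W : C) {U U' : C} (f : U ⟶ U') {X Y : C} (e : Y ⊗ X ⟶ 𝟙_ C) :
    (Y ⊗ (W ⊗ X)) ◁ f ≫ F.indBraidMap W U' e = F.indBraidMap W U e ≫ f ▷ F.ind W :=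
  calc
    _ = 𝟙 _ ⊗≫ (𝟙_ C ◁ ((Y ⊗ (W ⊗ X)) ◁ f) ≫ cv U' ▷ ((Y ⊗ (W ⊗ X)) ⊗ U')) ⊗≫
        U' ◁ F.indMap W (nest e (ev U')) := by rw [indBraidMap]; monoidal
    _ = 𝟙 _ ⊗≫ cv U' ▷ ((Y ⊗ (W ⊗ X)) ⊗ U) ⊗≫
        U' ◁ ((dual U' ⊗ Y) ◁ W ◁ (X ◁ f) ≫ F.indMap W (nest e (ev U'))) := by
      rw [whisker_exchange]; monoidal
    _ = 𝟙 _ ⊗≫ cv U' ▷ ((Y ⊗ (W ⊗ X)) ⊗ U) ⊗≫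
        U' ◁ ((mate f ▷ Y) ▷ (W ⊗ (X ⊗ U)) ≫ F.indMap W (nest e (ev U))) := by
      rw [whiskerLeft_indMap, nest_right_whiskerLeft, ← mate_ev, whiskerRight_indMap,
        nest_right_whiskerRight]
    _ = 𝟙 _ ⊗≫ (cv U' ≫ U' ◁ mate f) ▷ ((Y ⊗ (W ⊗ X)) ⊗ U) ⊗≫
        U' ◁ F.indMap W (nest e (ev U)) := by monoidal
    _ = 𝟙 _ ⊗≫ cv U ▷ ((Y ⊗ (W ⊗ X)) ⊗ U) ⊗≫ (f ▷ ((dual U ⊗ Y) ⊗ (W ⊗ (X ⊗ U))) ≫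
        U' ◁ F.indMap W (nest e (ev U))) := by rw [cv_mate]; monoidal
    _ = _ := by rw [← whisker_exchange, indBraidMap]; monoidal

lemma indBraid_naturality (W : C) {U U' : C} (f : U ⟶ U') :
    F.ind W ◁ f ≫ F.indBraid W U' = F.indBraid W U ≫ f ▷ F.ind W := by
  refine F.ind_whiskerRight_hom_ext fun i => ?_
  rw [← whisker_exchange_assoc, indMap_indBraid, indMap_indBraid_assoc, indBraidMap_naturality]

lemma indBraid_tensor (W U U' : C) : F.indBraid W (U ⊗ U') =
    (α_ _ _ _).inv ≫ F.indBraid W U ▷ U' ≫ (α_ _ _ _).hom ≫ U ◁ F.indBraid W U' ≫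
      (α_ _ _ _).inv := by
  refine F.ind_whiskerRight_hom_ext fun i => ?_
  -- Only the formula for `indMap` on arbitrary pairings is used from here on.
  generalize ev (F.V i) = e
  generalize dual (F.V i) = Y at e
  generalize F.V i = X at e
  rw [indMap_indBraid]
  symm
  calc
    _ = 𝟙 _ ⊗≫ (F.indMap W e ▷ U ≫ F.indBraid W U) ▷ U' ⊗≫ U ◁ F.indBraid W U' ⊗≫ 𝟙 _ := by
      monoidal
    _ = 𝟙 _ ⊗≫ cv U ▷ ((Y ⊗ (W ⊗ X)) ⊗ U) ▷ U' ⊗≫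
        U ◁ (F.indMap W (nest e (ev U)) ▷ U' ≫ F.indBraid W U') ⊗≫ 𝟙 _ := by
      rw [indMap_indBraid, indBraidMap]; monoidal
    _ = 𝟙 _ ⊗≫ cv U ▷ ((Y ⊗ (W ⊗ X)) ⊗ U) ▷ U' ⊗≫
        U ◁ cv U' ▷ dual U ▷ ((Y ⊗ (W ⊗ X)) ⊗ (U ⊗ U')) ⊗≫
        U ◁ U' ◁ F.indMap W (nest (nest e (ev U)) (ev U')) ⊗≫ 𝟙 _ := by
      rw [indMap_indBraid, indBraidMap]; monoidal
    _ = 𝟙 _ ⊗≫ (cv U ⊗≫ U ◁ cv U' ▷ dual U ⊗≫ 𝟙 ((U ⊗ U') ⊗ (dual U' ⊗ dual U))) ▷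
        ((Y ⊗ (W ⊗ X)) ⊗ (U ⊗ U')) ⊗≫
        (U ⊗ U') ◁ ((α_ _ _ _).hom ▷ (W ⊗ (X ⊗ (U ⊗ U'))) ≫
          (dual U' ⊗ (dual U ⊗ Y)) ◁ W ◁ (α_ X U U').inv ≫
          F.indMap W (nest (nest e (ev U)) (ev U'))) ⊗≫ 𝟙 _ := by monoidal
    _ = 𝟙 _ ⊗≫ (cv (U ⊗ U') ≫ (U ⊗ U') ◁ (dualTensor U U').hom) ▷
        ((Y ⊗ (W ⊗ X)) ⊗ (U ⊗ U')) ⊗≫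
        (U ⊗ U') ◁ F.indMap W (nest e (nest (ev U) (ev U'))) ⊗≫ 𝟙 _ := by
      rw [whiskerLeft_indMap, whiskerRight_indMap, nest_nest, cv_dualTensor]
      monoidal
    _ = 𝟙 _ ⊗≫ cv (U ⊗ U') ▷ ((Y ⊗ (W ⊗ X)) ⊗ (U ⊗ U')) ⊗≫
        (U ⊗ U') ◁ (((dualTensor U U').hom ▷ Y) ▷ (W ⊗ (X ⊗ (U ⊗ U'))) ≫
          F.indMap W (nest e (nest (ev U) (ev U')))) ⊗≫ 𝟙 _ := by monoidal
    _ = _ := by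
      rw [whiskerRight_indMap, nest_right_whiskerRight, dualTensor_hom_nest, indBraidMap]
      monoidal

lemma indBraid_unit (W : C) : F.indBraid W (𝟙_ C) = (ρ_ _).hom ≫ (λ_ _).inv := by
  refine F.ind_whiskerRight_hom_ext fun i => ?_
  generalize ev (F.V i) = e
  generalize dual (F.V i) = Y at e
  generalize F.V i = X at e
  rw [indMap_indBraid]
  have h : nest e (ev (𝟙_ C)) = (dual (𝟙_ C) ⊗ Y) ◁ (ρ_ X).hom ≫
      (((ρ_ _).inv ≫ ev (𝟙_ C)) ▷ Y ≫ (λ_ Y).hom) ▷ X ≫ e :=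
    calc
      _ = 𝟙 _ ⊗≫ (dual (𝟙_ C) ◁ e ≫ ((ρ_ _).inv ≫ ev (𝟙_ C)) ▷ 𝟙_ C) ⊗≫ 𝟙 _ := by
        rw [nest]; monoidal
      _ = _ := by rw [whisker_exchange]; monoidal
  have hz : cv (𝟙_ C) ▷ 𝟙_ C ⊗≫ 𝟙_ C ◁ ev (𝟙_ C) = 𝟙 _ :=
    Eq.trans (by monoidal) ((cv_ev (𝟙_ C)).trans (by monoidal))
  rw [indBraidMap, h, ← whiskerLeft_indMap, ← whiskerRight_indMap]
  calc
    _ = 𝟙 _ ⊗≫ (cv (𝟙_ C) ▷ 𝟙_ C ⊗≫ 𝟙_ C ◁ ev (𝟙_ C)) ▷ (Y ⊗ (W ⊗ X)) ⊗≫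
        F.indMap W e ⊗≫ 𝟙 _ := by monoidal
    _ = _ := by rw [hz]; monoidal

/-- The half braiding on an induced object. -/
def centerInd (W : C) : Center C :=
  ⟨F.ind W, halfBraidingOfLax (F.indBraid W) (F.indBraid_naturality W) (F.indBraid_tensor W)
    (F.indBraid_unit W)⟩

end FusionStructure

end CategoricalCenter

namespace CategoricalCenter

/-! ### The center is a fusion category -/

namespace FusionStructure

variable {k : Type w} [Field k]
  {C : Type u} [Category.{v} C] [MonoidalCategory C] [RigidCategory C] [Preadditive C] [Linear k C]
  (F : FusionStructure k C) [HasFiniteBiproducts C] [MonoidalPreadditive C] [MonoidalLinear k C]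

lemma ind_hom_ext {W D : C} {f g : F.ind W ⟶ D}
    (h : ∀ i, F.indMap W (ev (F.V i)) ≫ f = F.indMap W (ev (F.V i)) ≫ g) : f = g :=
  F.map_ind_hom_ext (𝟭 C) fun i => by
    have h := h i
    rw [indMap_ev] at h
    exact h

/-- The action of an induced object, on the image of `indMap`. -/
def indDescMap {M W : C} (b : HalfBraiding M) (g : W ⟶ M) {X Y : C} (e : Y ⊗ X ⟶ 𝟙_ C) :
    Y ⊗ (W ⊗ X) ⟶ M :=
  Y ◁ (g ▷ X ≫ (b.β X).hom) ⊗≫ e ▷ M ⊗≫ 𝟙 _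

/-- The morphism from an induced object determined by a morphism of `C`. -/
def indDesc {M W : C} (b : HalfBraiding M) (g : W ⟶ M) : F.ind W ⟶ M :=
  ∑ i, F.indπ W i ≫ indDescMap b g (ev (F.V i))

omit [MonoidalLinear k C] in
lemma indMap_indDesc {M W : C} (b : HalfBraiding M) (g : W ⟶ M) {X Y : C} (e : Y ⊗ X ⟶ 𝟙_ C) :
    F.indMap W e ≫ F.indDesc b g = indDescMap b g e := by
  refine F.map_indMap_desc (𝟭 C) (fun e => indDescMap b g e) ?_ ?_ e
  · intro X X' Y f e
    change Y ◁ W ◁ f ≫ indDescMap b g e = indDescMap b g (Y ◁ f ≫ e)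
    calc
      _ = Y ◁ ((W ◁ f ≫ g ▷ X') ≫ (b.β X').hom) ⊗≫ e ▷ M ⊗≫ 𝟙 _ := by
        rw [indDescMap]; monoidal
      _ = Y ◁ (g ▷ X ≫ M ◁ f ≫ (b.β X').hom) ⊗≫ e ▷ M ⊗≫ 𝟙 _ := by
        rw [whisker_exchange, Category.assoc]
      _ = _ := by rw [HalfBraiding.naturality, indDescMap]; monoidal
  · intro X Y Y' f e
    change f ▷ (W ⊗ X) ≫ indDescMap b g e = indDescMap b g (f ▷ X ≫ e)
    calc
      _ = 𝟙 _ ⊗≫ (f ▷ (W ⊗ X) ≫ Y' ◁ (g ▷ X ≫ (b.β X).hom)) ⊗≫ e ▷ M ⊗≫ 𝟙 _ := by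
        rw [indDescMap]; monoidal
      _ = _ := by rw [← whisker_exchange, indDescMap]; monoidal

lemma indDesc_comm {M W : C} (b : HalfBraiding M) (g : W ⟶ M) (U : C) :
    F.indDesc b g ▷ U ≫ (b.β U).hom = F.indBraid W U ≫ U ◁ F.indDesc b g := by
  refine F.ind_whiskerRight_hom_ext fun i => ?_
  generalize ev (F.V i) = e
  generalize dual (F.V i) = Y at e
  generalize F.V i = X at e
  symm
  rw [indMap_indBraid_assoc, ← comp_whiskerRight_assoc, indMap_indDesc]
  calc
    _ = 𝟙 _ ⊗≫ cv U ▷ ((Y ⊗ (W ⊗ X)) ⊗ U) ⊗≫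
        U ◁ (F.indMap W (nest e (ev U)) ≫ F.indDesc b g) := by rw [indBraidMap]; monoidal
    _ = 𝟙 _ ⊗≫ cv U ▷ ((Y ⊗ (W ⊗ X)) ⊗ U) ⊗≫ U ◁ dual U ◁ Y ◁ (g ▷ X ≫ (b.β X).hom) ▷ U ⊗≫
        U ◁ dual U ◁ ((Y ⊗ X) ◁ (b.β U).hom ≫ e ▷ (U ⊗ M)) ⊗≫ U ◁ ev U ▷ M ⊗≫ 𝟙 _ := by
      rw [indMap_indDesc, indDescMap, HalfBraiding.monoidal, nest]; monoidal
    _ = 𝟙 _ ⊗≫ (cv U ▷ ((Y ⊗ (W ⊗ X)) ⊗ U) ≫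
        (U ⊗ dual U) ◁ (indDescMap b g e ▷ U ≫ (b.β U).hom)) ⊗≫ U ◁ ev U ▷ M ⊗≫ 𝟙 _ := by
      rw [whisker_exchange, indDescMap]; monoidal
    _ = 𝟙 _ ⊗≫ (indDescMap b g e ▷ U ≫ (b.β U).hom) ⊗≫ (cv U ▷ U ⊗≫ U ◁ ev U) ▷ M ⊗≫ 𝟙 _ := by
      rw [← whisker_exchange]; monoidal
    _ = _ := by rw [cv_ev]; monoidal

/-- The morphism from an induced object determined by a morphism of `C`. -/
def centerIndDesc {M : Center C} {W : C} (g : W ⟶ M.1) : F.centerInd W ⟶ M where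
  f := F.indDesc M.2 g
  comm U := F.indDesc_comm M.2 g U

/-- The canonical morphism to the induced object. -/
def indUnit (W : C) : W ⟶ F.ind W := 𝟙 _ ⊗≫ F.indMap W (λ_ (𝟙_ C)).hom

omit [MonoidalLinear k C] in
-- Enough of the adjunction between induction and the forgetful functor for what follows: a morphism
-- `g` is recovered from its extension to the induced object.
lemma indUnit_indDesc {M W : C} (b : HalfBraiding M) (g : W ⟶ M) :
    F.indUnit W ≫ F.indDesc b g = g :=
  calc
    _ = 𝟙 _ ⊗≫ (F.indMap W (λ_ (𝟙_ C)).hom ≫ F.indDesc b g) := by rw [indUnit]; monoidal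
    _ = _ := by rw [indMap_indDesc, indDescMap, halfBraiding_unit]; monoidal

include F in
omit [HasFiniteBiproducts C] in
lemma center_isScalar_unit : IsScalar k (𝟙_ (Center C)) := by
  constructor
  · intro a b hab
    exact F.isScalar_unit.injective (congrArg Center.Hom.f hab)
  · intro f
    obtain ⟨a, ha⟩ := F.isScalar_unit.surjective f.f
    exact ⟨a, Center.ext _ _ ha⟩

end FusionStructure

theorem center_nonempty_fusionStructure {k : Type w} [Field k] [IsAlgClosed k]
    {C : Type u} [Category.{v} C] [MonoidalCategory C] [RigidCategory C]
    [Preadditive C] [Linear k C] [MonoidalPreadditive C] [MonoidalLinear k C]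
    (F : FusionStructure k C) {S : SovereignStructure C} (hS : S.IsSpherical)
    (hdim : IsUnit (F.dim S)) : Nonempty (FusionStructure k (Center C)) := by
  have := F.hasFiniteBiproducts
  have hreg {M N : Center C} (f : M ⟶ N) := center_exists_generalized_inverse F hS hdim f
  have hdec : ∀ M : Center C, HasScalarDecomposition k M :=
    hasScalarDecomposition (center_finite_hom F) hreg (center_exists_split F)
  obtain ⟨I, _, V, hV, hne, hrep⟩ := exists_scalar_representatives hreg hdec
    (fun i => F.centerInd (F.V i)) (fun M hM => by
      -- If every `centerInd (V i) ⟶ M` vanished, then so would every `V i ⟶ M` in `C`, and `M`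
      -- would be zero.
      by_contra! hc
      refine hM.id_ne_zero (Center.ext _ _ (F.hom_ext fun i r => ?_))
      have h : F.indDesc M.2 r = 0 := congrArg Center.Hom.f (hc i (F.centerIndDesc r))
      have h' := F.indUnit_indDesc M.2 r
      rw [h, comp_zero] at h'
      rw [← h', zero_comp, zero_comp])
  exact nonempty_fusionStructure hdec F.center_isScalar_unit V hV hne hrep

end CategoricalCenter

namespace CategoricalCenter

/-! ### The coend and its Hopf pairing -/

lemma toDual_comp_mate {C : Type u} [Category.{v} C] [MonoidalCategory C] [RightRigidCategory C]
    {X X' Y : C} (e : Y ⊗ X' ⟶ 𝟙_ C) (f : X ⟶ X') :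
    toDual e ≫ mate f = toDual (Y ◁ f ≫ e) := by
  refine dual_hom_ext ?_
  rw [comp_whiskerRight_assoc, mate_ev, ← whisker_exchange_assoc, toDual_ev, toDual_ev]

namespace FusionStructure

variable {k : Type w} [Field k]
  {C : Type u} [Category.{v} C] [MonoidalCategory C] [RigidCategory C] [Preadditive C] [Linear k C]
  (F : FusionStructure k C) [HasFiniteBiproducts C] [MonoidalPreadditive C] [MonoidalLinear k C]

/-- The coend of a fusion category. -/
def coend : CoendOf C where
  pt := F.ind (𝟙_ C)
  ι X := dual X ◁ (λ_ X).inv ≫ F.indMap (𝟙_ C) (ev X)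
  dinatural {X Y} f := by
    rw [← whisker_exchange_assoc, whiskerRight_indMap, mate_ev, ← whiskerLeft_indMap,
      ← MonoidalCategory.whiskerLeft_comp_assoc, ← MonoidalCategory.whiskerLeft_comp_assoc,
      leftUnitor_inv_naturality]
  universal D d hd := by
    -- A dinatural family, given only at the evaluations, extends to all pairings by first mapping
    -- `Y` to `X*`.
    let d' {X Y : C} (e : Y ⊗ X ⟶ 𝟙_ C) : Y ⊗ (𝟙_ C ⊗ X) ⟶ D :=
      toDual e ▷ (𝟙_ C ⊗ X) ≫ dual X ◁ (λ_ X).hom ≫ d X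
    have hd' (X) : d' (ev X) = dual X ◁ (λ_ X).hom ≫ d X := by
      simp [d', toDual_ev_self]
    have key {X : C} := F.map_indMap_desc (𝟭 C) (W := 𝟙_ C) d' (fun {X X' Y} f e => by
        change Y ◁ (𝟙_ C ◁ f) ≫ d' e = d' (Y ◁ f ≫ e)
        dsimp only [d']
        rw [← toDual_comp_mate, whisker_exchange_assoc, ← MonoidalCategory.whiskerLeft_comp_assoc,
          leftUnitor_naturality, MonoidalCategory.whiskerLeft_comp_assoc, ← hd,
          comp_whiskerRight_assoc, ← whisker_exchange_assoc, ← whisker_exchange_assoc,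
          ← whisker_exchange_assoc])
      (fun {X Y Y'} g e => by
        change g ▷ (𝟙_ C ⊗ X) ≫ d' e = d' (g ▷ X ≫ e)
        dsimp only [d']
        rw [← comp_whiskerRight_assoc, comp_toDual]) (ev X)
    refine ⟨∑ i, F.indπ (𝟙_ C) i ≫ d' (ev (F.V i)), fun X => ?_, fun g hg => ?_⟩
    · rw [Category.assoc]
      refine (congrArg (fun z => dual X ◁ (λ_ X).inv ≫ z) key).trans ?_
      rw [hd', ← MonoidalCategory.whiskerLeft_comp_assoc]
      simp
    · refine F.ind_hom_ext fun i => ?_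
      refine Eq.trans ?_ key.symm
      rw [hd', ← hg, ← Category.assoc, ← Category.assoc, ← MonoidalCategory.whiskerLeft_comp]
      simp

end FusionStructure

/-! ### The Hopf pairing of a coend -/

section Hopf

variable {B : Type u} [Category.{v} B] [MonoidalCategory B] [RigidCategory B]

/-- By duality a pairing on `K.pt ⊗ Q` is a morphism from `K.pt` to `Q*`, so the universal property
survives tensoring with `Q`. -/
lemma CoendOf.whiskerRight_hom_ext (K : CoendOf B) {Q : B} {p p' : K.pt ⊗ Q ⟶ 𝟙_ B}
    (h : ∀ X, K.ι X ▷ Q ≫ p = K.ι X ▷ Q ≫ p') : p = p' := by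
  have hd {X Y : B} (f : X ⟶ Y) : mate f ▷ X ≫ K.ι X ≫ toDual p =
      dual Y ◁ f ≫ K.ι Y ≫ toDual p := by
    rw [← Category.assoc, K.dinatural, Category.assoc]
  have h1 : toDual p = toDual p' := (K.universal _ _ hd).unique (fun X => rfl) fun X => by
    rw [comp_toDual, comp_toDual, h]
  rw [← toDual_ev p, h1, toDual_ev]

lemma CoendOf.exists_desc_whiskerRight (K : CoendOf B) {Q : B}
    (d : ∀ X : B, (dual X ⊗ X) ⊗ Q ⟶ 𝟙_ B)
    (hd : ∀ {X Y : B} (f : X ⟶ Y), (mate f ▷ X) ▷ Q ≫ d X = (dual Y ◁ f) ▷ Q ≫ d Y) :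
    ∃ p : K.pt ⊗ Q ⟶ 𝟙_ B, ∀ X, K.ι X ▷ Q ≫ p = d X := by
  obtain ⟨g, hg, -⟩ := K.universal (dual Q) (fun X => toDual (d X)) (fun {X Y} f => by
    rw [comp_toDual, comp_toDual, hd])
  exact ⟨g ▷ Q ≫ ev Q, fun X => by rw [← comp_whiskerRight_assoc, hg, toDual_ev]⟩

lemma isNondegenerate_of_inverse {A : B} (ω : A ⊗ A ⟶ 𝟙_ B) {g : dual A ⟶ A}
    (h1 : toDual ω ≫ g = 𝟙 A) (h2 : g ≫ toDual ω = 𝟙 (dual A)) : IsNondegenerate ω := by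
  have h : ω = toDual ω ▷ A ≫ ev A := (toDual_ev ω).symm
  generalize toDual ω = j at h h1 h2
  subst h
  refine ⟨cv A ≫ A ◁ g, ?_, ?_⟩
  · calc
      _ = 𝟙 _ ⊗≫ A ◁ cv A ⊗≫ ((A ⊗ A) ◁ g ≫ (j ▷ A ≫ ev A) ▷ A) ⊗≫ 𝟙 _ := by monoidal
      _ = 𝟙 _ ⊗≫ (A ◁ cv A ≫ j ▷ (A ⊗ dual A)) ⊗≫ ev A ▷ dual A ⊗≫ g := by
        rw [whisker_exchange]; monoidal
      _ = 𝟙 _ ⊗≫ j ⊗≫ (dual A ◁ cv A ⊗≫ ev A ▷ dual A) ⊗≫ g := by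
        rw [whisker_exchange]; monoidal
      _ = 𝟙 _ ⊗≫ (j ≫ g) ⊗≫ 𝟙 _ := by rw [dual_cv_ev]; monoidal
      _ = _ := by rw [h1]; monoidal
  · calc
      _ = 𝟙 _ ⊗≫ cv A ▷ A ⊗≫ A ◁ ((g ≫ j) ▷ A) ⊗≫ A ◁ ev A ⊗≫ 𝟙 _ := by monoidal
      _ = 𝟙 _ ⊗≫ (cv A ▷ A ⊗≫ A ◁ ev A) ⊗≫ 𝟙 _ := by rw [h2]; monoidal
      _ = _ := by rw [cv_ev]; monoidal

variable [BraidedCategory B]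

lemma CoendOf.exists_pairing (K : CoendOf B)
    (d : ∀ X Y : B, (dual X ⊗ X) ⊗ (dual Y ⊗ Y) ⟶ 𝟙_ B)
    (hl : ∀ {X X' : B} (f : X ⟶ X') (Y : B),
      (mate f ▷ X) ▷ (dual Y ⊗ Y) ≫ d X Y = (dual X' ◁ f) ▷ (dual Y ⊗ Y) ≫ d X' Y)
    (hr : ∀ (X : B) {Y Y' : B} (f : Y ⟶ Y'),
      (dual X ⊗ X) ◁ (mate f ▷ Y) ≫ d X Y = (dual X ⊗ X) ◁ (dual Y' ◁ f) ≫ d X Y') :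
    ∃ ω : K.pt ⊗ K.pt ⟶ 𝟙_ B, ∀ X Y, (K.ι X ⊗ₘ K.ι Y) ≫ ω = d X Y := by
  choose p hp using fun Y => K.exists_desc_whiskerRight (fun X => d X Y) (fun f => hl f Y)
  -- The first variable has been descended; braiding puts the second one on the left, so that the
  -- same one-sided lemma applies.
  obtain ⟨q, hq⟩ := K.exists_desc_whiskerRight (Q := K.pt)
    (fun Y => (β_ (dual Y ⊗ Y) K.pt).hom ≫ p Y) (fun {Y Y'} f => by
      rw [BraidedCategory.braiding_naturality_left_assoc,
        BraidedCategory.braiding_naturality_left_assoc]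
      congr 1
      refine K.whiskerRight_hom_ext fun X => ?_
      rw [← whisker_exchange_assoc, ← whisker_exchange_assoc, hp, hp, hr])
  refine ⟨(β_ K.pt K.pt).inv ≫ q, fun X Y => ?_⟩
  rw [MonoidalCategory.tensorHom_def, Category.assoc, BraidedCategory.braiding_inv_naturality_right_assoc, hq,
    Iso.inv_hom_id_assoc, hp]

/-- The action of `X* ⊗ X` on an object by the double braiding. -/
def monodromy (X Z : B) : (dual X ⊗ X) ⊗ Z ⟶ Z :=
  𝟙 _ ⊗≫ dual X ◁ ((β_ X Z).hom ≫ (β_ Z X).hom) ⊗≫ ev X ▷ Z ⊗≫ 𝟙 _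

lemma monodromy_dinatural {X X' : B} (f : X ⟶ X') (Z : B) :
    (mate f ▷ X) ▷ Z ≫ monodromy X Z = (dual X' ◁ f) ▷ Z ≫ monodromy X' Z :=
  calc
    _ = 𝟙 _ ⊗≫ (mate f ▷ (X ⊗ Z) ≫ dual X ◁ ((β_ X Z).hom ≫ (β_ Z X).hom)) ⊗≫
        ev X ▷ Z ⊗≫ 𝟙 _ := by rw [monodromy]; monoidal
    _ = 𝟙 _ ⊗≫ dual X' ◁ ((β_ X Z).hom ≫ (β_ Z X).hom) ⊗≫ (mate f ▷ X ≫ ev X) ▷ Z ⊗≫ 𝟙 _ := by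
      rw [← whisker_exchange]; monoidal
    _ = 𝟙 _ ⊗≫ dual X' ◁ ((β_ X Z).hom ≫ (β_ Z X).hom ≫ f ▷ Z) ⊗≫ ev X' ▷ Z ⊗≫ 𝟙 _ := by
      rw [mate_ev]; monoidal
    _ = _ := by
      rw [← BraidedCategory.braiding_naturality_right,
        ← BraidedCategory.braiding_naturality_left_assoc, monodromy]
      monoidal

lemma monodromy_naturality (X : B) {Z Z' : B} (f : Z ⟶ Z') :
    (dual X ⊗ X) ◁ f ≫ monodromy X Z' = monodromy X Z ≫ f :=
  calc
    _ = 𝟙 _ ⊗≫ dual X ◁ (X ◁ f ≫ (β_ X Z').hom ≫ (β_ Z' X).hom) ⊗≫ ev X ▷ Z' ⊗≫ 𝟙 _ := by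
      rw [monodromy]; monoidal
    _ = 𝟙 _ ⊗≫ dual X ◁ ((β_ X Z).hom ≫ (β_ Z X).hom) ⊗≫ ((dual X ⊗ X) ◁ f ≫ ev X ▷ Z') ⊗≫
        𝟙 _ := by
      rw [BraidedCategory.braiding_naturality_right_assoc, BraidedCategory.braiding_naturality_left]
      monoidal
    _ = _ := by rw [whisker_exchange, monodromy]; monoidal

/-- The Hopf pairing on `(X* ⊗ X) ⊗ (Y* ⊗ Y)`. -/
def hopf (X Y : B) : (dual X ⊗ X) ⊗ (dual Y ⊗ Y) ⟶ 𝟙_ B :=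
  𝟙 _ ⊗≫ monodromy X (dual Y) ▷ Y ⊗≫ ev Y

lemma hopf_eq (X Y : B) : hopf X Y =
    (α_ (dual X) X ((dual Y) ⊗ Y)).hom ≫ (dual X) ◁ (α_ X (dual Y) Y).inv ≫
        (dual X) ◁ (((β_ X (dual Y)).hom ≫ (β_ (dual Y) X).hom) ▷ Y) ≫
        (dual X) ◁ (α_ X (dual Y) Y).hom ≫ (α_ (dual X) X ((dual Y) ⊗ Y)).inv ≫
        (ε_ X (dual X) ⊗ₘ ε_ Y (dual Y)) ≫ (λ_ (𝟙_ B)).hom := by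
  change _ = (α_ (dual X) X ((dual Y) ⊗ Y)).hom ≫ (dual X) ◁ (α_ X (dual Y) Y).inv ≫
        (dual X) ◁ (((β_ X (dual Y)).hom ≫ (β_ (dual Y) X).hom) ▷ Y) ≫
        (dual X) ◁ (α_ X (dual Y) Y).hom ≫ (α_ (dual X) X ((dual Y) ⊗ Y)).inv ≫
        (ev X ⊗ₘ ev Y) ≫ (λ_ (𝟙_ B)).hom
  rw [hopf, monodromy, MonoidalCategory.tensorHom_def]
  monoidal

lemma CoendOf.exists_isHopfPairing (K : CoendOf B) :
    ∃ ω : K.pt ⊗ K.pt ⟶ 𝟙_ B, ∀ X Y, (K.ι X ⊗ₘ K.ι Y) ≫ ω = hopf X Y := by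
  refine K.exists_pairing hopf (fun {X X'} f Y => ?_) (fun X {Y Y'} f => ?_)
  · calc
      _ = 𝟙 _ ⊗≫ ((mate f ▷ X) ▷ dual Y ≫ monodromy X (dual Y)) ▷ Y ⊗≫ ev Y := by
        rw [hopf]; monoidal
      _ = _ := by rw [monodromy_dinatural, hopf]; monoidal
  · calc
      _ = 𝟙 _ ⊗≫ ((dual X ⊗ X) ◁ mate f ≫ monodromy X (dual Y)) ▷ Y ⊗≫ ev Y := by
        rw [hopf]; monoidal
      _ = 𝟙 _ ⊗≫ monodromy X (dual Y') ▷ Y ⊗≫ (mate f ▷ Y ≫ ev Y) := by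
        rw [monodromy_naturality]; monoidal
      _ = 𝟙 _ ⊗≫ (monodromy X (dual Y') ▷ Y ≫ dual Y' ◁ f) ⊗≫ ev Y' := by
        rw [mate_ev]; monoidal
      _ = _ := by rw [← whisker_exchange, hopf]; monoidal

end Hopf

end CategoricalCenter

namespace CategoricalCenter

/-! ### Non-degeneracy of the Hopf pairing -/

section Monodromy

variable {k : Type w} [Field k]
  {B : Type u} [Category.{v} B] [MonoidalCategory B] [RigidCategory B]
  [Preadditive B] [Linear k B] [MonoidalPreadditive B] [MonoidalLinear k B]
  [HasFiniteBiproducts B] (G : FusionStructure k B)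

/-- The components of a morphism to the coend. -/
def coendComp {N : B} (f : N ⟶ G.coend.pt) (s : G.I) : N ⟶ dual (G.V s) ⊗ G.V s :=
  f ≫ G.indπ (𝟙_ B) s ≫ dual (G.V s) ◁ (λ_ (G.V s)).hom

lemma sum_coendComp {N : B} (f : N ⟶ G.coend.pt) :
    ∑ s, coendComp G f s ≫ G.coend.ι (G.V s) = f := by
  have key (f : N ⟶ G.ind (𝟙_ B)) :
      ∑ s, (f ≫ G.indπ (𝟙_ B) s ≫ dual (G.V s) ◁ (λ_ (G.V s)).hom) ≫
        dual (G.V s) ◁ (λ_ (G.V s)).inv ≫ G.indMap (𝟙_ B) (ev (G.V s)) = f := by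
    have h (s) : (f ≫ G.indπ (𝟙_ B) s ≫ dual (G.V s) ◁ (λ_ (G.V s)).hom) ≫
        dual (G.V s) ◁ (λ_ (G.V s)).inv ≫ G.indMap (𝟙_ B) (ev (G.V s)) =
        f ≫ G.indπ (𝟙_ B) s ≫ G.indι (𝟙_ B) s := by
      rw [G.indMap_ev, Category.assoc, Category.assoc, ← MonoidalCategory.whiskerLeft_comp_assoc]
      simp
    simp only [h]
    rw [← Preadditive.comp_sum, G.ind_total, Category.comp_id]
  exact key f

variable [BraidedCategory B]

lemma sum_monodromy_eq_zero (T : SovereignStructure B) {ω : G.coend.pt ⊗ G.coend.pt ⟶ 𝟙_ B}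
    (hω : ∀ X Y, (G.coend.ι X ⊗ₘ G.coend.ι Y) ≫ ω = hopf X Y) {N : B} {f : N ⟶ G.coend.pt}
    (hf : f ≫ toDual ω = 0) (Z : B) :
    ∑ s, coendComp G f s ▷ Z ≫ monodromy (G.V s) Z = 0 := by
  have hf' : f ▷ G.coend.pt ≫ ω = 0 := by
    rw [← toDual_ev (f ▷ G.coend.pt ≫ ω), ← comp_toDual, hf]; simp
  have h1 (Y : B) : ∑ s, coendComp G f s ▷ dual Y ≫ monodromy (G.V s) (dual Y) = 0 := by
    refine dual_hom_ext ?_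
    have h2 (s) : (coendComp G f s ▷ dual Y ≫ monodromy (G.V s) (dual Y)) ▷ Y ≫ ev Y =
        (α_ N (dual Y) Y).hom ≫ (coendComp G f s ≫ G.coend.ι (G.V s)) ▷ (dual Y ⊗ Y) ≫
          G.coend.pt ◁ G.coend.ι Y ≫ ω := by
      have h2' : (coendComp G f s ≫ G.coend.ι (G.V s)) ▷ (dual Y ⊗ Y) ≫
          G.coend.pt ◁ G.coend.ι Y ≫ ω = coendComp G f s ▷ (dual Y ⊗ Y) ≫ hopf (G.V s) Y := by
        rw [comp_whiskerRight_assoc, ← hω, MonoidalCategory.tensorHom_def_assoc]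
      rw [h2', hopf]
      monoidal
    rw [sum_whiskerRight, Preadditive.sum_comp]
    simp only [h2]
    rw [← Preadditive.comp_sum, ← Preadditive.sum_comp, ← sum_whiskerRight, sum_coendComp,
      ← whisker_exchange_assoc, hf']
    simp
  -- The pairing only sees the double braiding with dual objects; naturality along `Z ≅ Z**`
  -- transfers the conclusion to every `Z`.
  have h3 (s) : (coendComp G f s ▷ Z ≫ monodromy (G.V s) Z) ≫ (T.φ Z).hom =
      N ◁ (T.φ Z).hom ≫ coendComp G f s ▷ dual (dual Z) ≫ monodromy (G.V s) (dual (dual Z)) := by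
    rw [Category.assoc, ← monodromy_naturality, whisker_exchange_assoc]
  rw [← cancel_mono (T.φ Z).hom, Preadditive.sum_comp, zero_comp]
  simp only [h3]
  rw [← Preadditive.comp_sum, h1, comp_zero]

end Monodromy

namespace FusionStructure

variable {k : Type w} [Field k]
  {C : Type u} [Category.{v} C] [MonoidalCategory C] [RigidCategory C] [Preadditive C] [Linear k C]
  (F : FusionStructure k C) [HasFiniteBiproducts C] [MonoidalPreadditive C] [MonoidalLinear k C]

lemma indUnit_indBraid (W M : C) : F.indUnit W ▷ M ≫ F.indBraid W M =
    𝟙 _ ⊗≫ cv M ▷ (W ⊗ M) ⊗≫ M ◁ F.indMap W (ev M) := by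
  have h : nest (λ_ (𝟙_ C)).hom (ev M) =
      (ρ_ (dual M)).hom ▷ (𝟙_ C ⊗ M) ≫ dual M ◁ (λ_ M).hom ≫ ev M := by
    rw [nest]; monoidal
  calc
    _ = 𝟙 _ ⊗≫ (F.indMap W (λ_ (𝟙_ C)).hom ▷ M ≫ F.indBraid W M) := by rw [indUnit]; monoidal
    _ = _ := by
      rw [indMap_indBraid, indBraidMap, h, ← whiskerRight_indMap, ← whiskerLeft_indMap]
      monoidal

/-- On the generating copy of `W`, the half braiding of the induced object creates a pair `M`, `M*`
whose `M` is absorbed by the evaluation. The double braiding thus collapses to a single half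
braiding followed by the canonical map. -/
lemma indUnit_doubleBraid {M : C} (b : HalfBraiding M) (W : C) :
    (dual M ⊗ M) ◁ F.indUnit W ≫ (𝟙 _ ⊗≫ dual M ◁ ((b.β (F.ind W)).hom ≫ F.indBraid W M) ⊗≫
      ev M ▷ F.ind W ⊗≫ 𝟙 _) = (α_ _ _ _).hom ≫ dual M ◁ (b.β W).hom ≫ F.indMap W (ev M) :=
  calc
    _ = 𝟙 _ ⊗≫ dual M ◁ ((M ◁ F.indUnit W ≫ (b.β (F.ind W)).hom) ≫ F.indBraid W M) ⊗≫
        ev M ▷ F.ind W ⊗≫ 𝟙 _ := by monoidal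
    _ = 𝟙 _ ⊗≫ dual M ◁ (b.β W).hom ⊗≫ dual M ◁ (F.indUnit W ▷ M ≫ F.indBraid W M) ⊗≫
        ev M ▷ F.ind W ⊗≫ 𝟙 _ := by rw [HalfBraiding.naturality]; monoidal
    _ = 𝟙 _ ⊗≫ dual M ◁ (b.β W).hom ⊗≫ dual M ◁ cv M ▷ (W ⊗ M) ⊗≫
        ((dual M ⊗ M) ◁ F.indMap W (ev M) ≫ ev M ▷ F.ind W) ⊗≫ 𝟙 _ := by
      rw [indUnit_indBraid]; monoidal
    _ = 𝟙 _ ⊗≫ dual M ◁ (b.β W).hom ⊗≫ (dual M ◁ cv M ⊗≫ ev M ▷ dual M) ▷ (W ⊗ M) ⊗≫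
        F.indMap W (ev M) := by
      rw [whisker_exchange]; monoidal
    _ = _ := by rw [dual_cv_ev]; monoidal

omit [MonoidalPreadditive C] [MonoidalLinear k C] in
lemma indMap_ev_indπ (W M : C) (i : F.I) : F.indMap W (ev M) ≫ F.indπ W i =
    ∑ a, mate (F.inj M i a) ▷ (W ⊗ M) ≫ dual (F.V i) ◁ W ◁ F.proj M i a := by
  rw [indMap, Preadditive.sum_comp, Finset.sum_eq_single i]
  · rw [Preadditive.sum_comp]
    refine Finset.sum_congr rfl fun a _ => ?_
    rw [toDual_whiskerLeft_ev, Category.assoc, Category.assoc, indι_indπ_self, Category.comp_id]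
  · intro j _ hj
    rw [Preadditive.sum_comp]
    refine Finset.sum_eq_zero fun a _ => ?_
    rw [Category.assoc, Category.assoc, F.indι_indπ_ne W hj, comp_zero, comp_zero]
  · simp

/-- A vanishing statement about the half braidings with all `W` is turned into one about averages,
which are central and so accessible to Schur's lemma. -/
lemma sum_average_eq_zero (S : SovereignStructure C) {ι : Type*} [Fintype ι] (M : ι → C)
    (b : ∀ s, HalfBraiding (M s)) {N : C} (f : ∀ s, N ⟶ dual (M s) ⊗ M s)
    (h : ∀ W, ∑ s, f s ▷ W ≫ (α_ _ _ _).hom ≫ dual (M s) ◁ ((b s).β W).hom ≫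
      F.indMap W (ev (M s)) = 0) (t : ι) {i : F.I} (u : F.V i ⟶ M t) :
    ∑ s, ∑ a, f s ≫ dual (M s) ◁ (∑ j, F.d S (F.V j) • S.ptr (((b s).β (F.V j)).hom ≫
      F.V j ◁ (F.proj (M s) i a ≫ u) ≫ ((b t).β (F.V j)).inv)) ≫
      mate (F.inj (M s) i a) ▷ M t = 0 := by
  have h1 (W : C) : ∑ s, ∑ a, f s ▷ W ≫ ((α_ _ _ _).hom ≫
      dual (M s) ◁ (((b s).β W).hom ≫ W ◁ (F.proj (M s) i a ≫ u) ≫ ((b t).β W).inv) ≫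
      (α_ _ _ _).inv) ≫ (mate (F.inj (M s) i a) ▷ M t) ▷ W = 0 := by
    -- Projecting to the `i`-th summand exposes the matrix entries; `u` followed by the inverse half
    -- braiding of `M t` completes them to conjugates of `proj ≫ u`.
    have h2 := congrArg (fun z => z ≫ F.indπ W i ≫
      dual (F.V i) ◁ (W ◁ u ≫ ((b t).β W).inv) ≫ (α_ _ _ _).inv) (h W)
    rw [Preadditive.sum_comp, zero_comp] at h2
    rw [← h2]
    refine Finset.sum_congr rfl fun s _ => ?_
    simp only [Category.assoc]
    have h3 := F.indMap_ev_indπ W (M s) i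
    rw [reassoc_of% h3]
    simp only [Preadditive.sum_comp, Preadditive.comp_sum]
    refine Finset.sum_congr rfl fun a _ => ?_
    congr 2
    simp only [Category.assoc, MonoidalCategory.whiskerLeft_comp]
    congr 1
    simp only [← MonoidalCategory.whiskerLeft_comp_assoc]
    rw [← whisker_exchange_assoc]
    congr 1
    monoidal
  -- Tracing out `W = V j` with weight `d (V j)` produces the averages.
  have h4 : ∑ j, F.d S (F.V j) • S.ptr (∑ s, ∑ a, f s ▷ F.V j ≫ ((α_ _ _ _).hom ≫
      dual (M s) ◁ (((b s).β (F.V j)).hom ≫ F.V j ◁ (F.proj (M s) i a ≫ u) ≫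
        ((b t).β (F.V j)).inv) ≫ (α_ _ _ _).inv) ≫
          (mate (F.inj (M s) i a) ▷ M t) ▷ F.V j) = 0 := by
    refine Finset.sum_eq_zero fun j _ => ?_
    rw [h1, ← S.ptrₗ_apply (k := k), map_zero, smul_zero]
  rw [← h4]
  simp only [← S.ptrₗ_apply (k := k), map_sum, Finset.smul_sum]
  rw [Finset.sum_comm]
  refine Finset.sum_congr rfl fun s _ => ?_
  rw [Finset.sum_comm]
  refine Finset.sum_congr rfl fun a _ => ?_
  rw [whiskerLeft_sum, Preadditive.sum_comp, Preadditive.comp_sum]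
  refine Finset.sum_congr rfl fun j _ => ?_
  rw [S.ptrₗ_apply, S.ptrₗ_apply, S.ptr_comp, S.ptr_whiskerLeft, MonoidalLinear.whiskerLeft_smul,
    Linear.smul_comp, Linear.comp_smul]

end FusionStructure

end CategoricalCenter

namespace CategoricalCenter

/-! ### Modularity of the center -/

/-- The two retractions bound `dim Hom(Y, X)` and `dim End Y` by each other, so composition with `s`
is bijective from `Hom(Y, X)` to `End Y`, and `s` has an inverse on the other side too. -/
lemma comp_eq_id_of_retracts (k : Type w) [Field k] {D : Type u} [Category.{v} D] [Preadditive D]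
    [Linear k D] {X Y : D} [Module.Finite k (Y ⟶ X)] [Module.Finite k (Y ⟶ Y)] {s : X ⟶ Y}
    {g : Y ⟶ X} (h1 : s ≫ g = 𝟙 X) {h : Y ⟶ X} {p : X ⟶ Y} (h2 : h ≫ p = 𝟙 Y) :
    g ≫ s = 𝟙 Y := by
  have hL : Function.Injective (Linear.rightComp k Y s) := fun r r' hr => by
    have := congrArg (fun z => z ≫ g) hr
    simpa [h1] using this
  have hR : Function.Injective (Linear.rightComp k Y h) := fun r r' hr => by
    have := congrArg (fun z => z ≫ p) hr
    simpa [h2] using this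
  have hd : Module.finrank k (Y ⟶ X) = Module.finrank k (Y ⟶ Y) :=
    le_antisymm (LinearMap.finrank_le_finrank_of_injective hL)
      (LinearMap.finrank_le_finrank_of_injective hR)
  obtain ⟨r, hr⟩ := (LinearMap.injective_iff_surjective_of_finrank_eq_finrank hd).1 hL (𝟙 Y)
  have hr' : r ≫ s = 𝟙 Y := hr
  have hg : g = r := by rw [← Category.id_comp g, ← hr', Category.assoc, h1, Category.comp_id]
  rw [hg, hr']

lemma monodromy_eq {B : Type u} [Category.{v} B] [MonoidalCategory B] [RigidCategory B]
    [BraidedCategory B] (X Z : B) : monodromy X Z = (α_ _ _ _).hom ≫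
      dual X ◁ ((β_ X Z).hom ≫ (β_ Z X).hom) ≫ (α_ _ _ _).inv ≫ ev X ▷ Z ≫ (λ_ Z).hom := by
  rw [monodromy]; monoidal

lemma monodromy_aux {C : Type u} [Category.{v} C] [MonoidalCategory C] [RightRigidCategory C]
    (X Z : C) (g : X ⊗ Z ⟶ X ⊗ Z) : (α_ _ _ _).hom ≫ dual X ◁ g ≫ (α_ _ _ _).inv ≫
      ev X ▷ Z ≫ (λ_ Z).hom =
    𝟙 ((dual X ⊗ X) ⊗ Z) ⊗≫ dual X ◁ g ⊗≫ ev X ▷ Z ⊗≫ 𝟙 Z := by monoidal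

lemma center_monodromy_f {C : Type u} [Category.{v} C] [MonoidalCategory C] [RigidCategory C]
    (X Z : Center C) : (monodromy X Z).f =
      𝟙 ((dual X.1 ⊗ X.1) ⊗ Z.1) ⊗≫ dual X.1 ◁ ((X.2.β Z.1).hom ≫ (Z.2.β X.1).hom) ⊗≫ ev X.1 ▷ Z.1 ⊗≫ 𝟙 Z.1 := by
  rw [monodromy_eq, Center.comp_f, Center.comp_f, Center.comp_f, Center.comp_f,
    Center.associator_inv_f]
  exact monodromy_aux X.1 Z.1 _

lemma mate_sum {C : Type u} [Category.{v} C] [MonoidalCategory C] [RightRigidCategory C]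
    [Preadditive C] [MonoidalPreadditive C] {X Y : C} {κ : Type*} (T : Finset κ) (f : κ → (X ⟶ Y)) :
    mate (∑ a ∈ T, f a) = ∑ a ∈ T, mate (f a) := by
  refine dual_hom_ext ?_
  rw [mate_ev, whiskerLeft_sum, sum_whiskerRight, Preadditive.sum_comp, Preadditive.sum_comp]
  simp only [mate_ev]

section

variable {k : Type w} [Field k]
  {C : Type u} [Category.{v} C] [MonoidalCategory C] [RigidCategory C] [Preadditive C] [Linear k C]
  [MonoidalPreadditive C] [MonoidalLinear k C] (F : FusionStructure k C) {S : SovereignStructure C}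

/-- By Schur the average is a scalar, and the trace computes it. Keeping `d S M.1` on the left
avoids having to know that it is non-zero. -/
lemma smul_avgHom (hS : S.IsSpherical) {M : Center C} (hM : IsScalar k M) (g : M.1 ⟶ M.1) :
    F.d S M.1 • F.avgHom S g =
      (F.isScalar_unit.coef (F.dim S) * F.tr S M.1 g) • 𝟙 M.1 := by
  have h : F.avgHom S g = hM.coef (F.avg S hS M M g) • 𝟙 M.1 :=
    (congrArg Center.Hom.f (hM.coef_smul_id (F.avg S hS M M g))).symm
  rw [← F.tr_avgHom S hS, h, map_smul, smul_smul, mul_comm]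
  rfl

omit [MonoidalLinear k C] in
lemma eq_zero_of_comp_mate_inj {M N : C} {f : N ⟶ dual M ⊗ M}
    (h : ∀ i c, f ≫ mate (F.inj M i c) ▷ M = 0) : f = 0 := by
  rw [← Category.comp_id f, ← id_whiskerRight, ← mate_id, ← F.total M, mate_sum, sum_whiskerRight,
    Preadditive.comp_sum]
  refine Finset.sum_eq_zero fun i _ => ?_
  rw [mate_sum, sum_whiskerRight, Preadditive.comp_sum]
  refine Finset.sum_eq_zero fun c _ => ?_
  rw [mate_comp, comp_whiskerRight, reassoc_of% (h i c), zero_comp]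

lemma comp_mate_inj_eq_zero {ι : Type*} [Fintype ι] {M : ι → C} {N : C}
    (f : ∀ s, N ⟶ dual (M s) ⊗ M s) (t : ι) {i : F.I} (c : F.Mult (M t) i)
    (A : ∀ s, F.Mult (M s) i → (M s ⟶ M t)) (x : k) {y : k} (hy : y ≠ 0)
    (hne : ∀ s, s ≠ t → ∀ a, A s a = 0) (hne' : ∀ a, a ≠ c → x • A t a = 0)
    (hself : x • A t c = y • 𝟙 _)
    (h : ∑ s, ∑ a, f s ≫ dual (M s) ◁ A s a ≫ mate (F.inj (M s) i a) ▷ M t = 0) :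
    f t ≫ mate (F.inj (M t) i c) ▷ M t = 0 := by
  rw [Finset.sum_eq_single t (fun s _ hs => Finset.sum_eq_zero fun a _ => by
    rw [hne s hs a]; simp) (by simp)] at h
  have h' := congrArg (fun z => x • z) h
  simp only [smul_zero, Finset.smul_sum] at h'
  have e (a) : x • (f t ≫ dual (M t) ◁ A t a ≫ mate (F.inj (M t) i a) ▷ M t) =
      f t ≫ dual (M t) ◁ (x • A t a) ≫ mate (F.inj (M t) i a) ▷ M t := by
    rw [MonoidalLinear.whiskerLeft_smul, Linear.smul_comp, Linear.comp_smul]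
  simp only [e] at h'
  rw [Finset.sum_eq_single c (fun a _ ha => by rw [hne' a ha]; simp) (by simp), hself,
    MonoidalLinear.whiskerLeft_smul, Linear.smul_comp, Linear.comp_smul, smul_eq_zero] at h'
  simpa using h'.resolve_left hy

variable [HasFiniteBiproducts C]

lemma sum_indMap_ev_eq_zero {ι : Type*} [Fintype ι] {M : ι → C}
    (b : ∀ s, HalfBraiding (M s)) {N : C} (f : ∀ s, N ⟶ dual (M s) ⊗ M s) (W : C)
    (h : ∑ s, f s ▷ F.ind W ≫ (𝟙 ((dual (M s) ⊗ M s) ⊗ F.ind W) ⊗≫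
      dual (M s) ◁ (((b s).β (F.ind W)).hom ≫ F.indBraid W (M s)) ⊗≫
        ev (M s) ▷ F.ind W ⊗≫ 𝟙 (F.ind W)) = 0) :
    ∑ s, f s ▷ W ≫ (α_ _ _ _).hom ≫ dual (M s) ◁ ((b s).β W).hom ≫ F.indMap W (ev (M s)) = 0 := by
  have h' := congrArg (fun z => N ◁ F.indUnit W ≫ z) h
  simp only [comp_zero, Preadditive.comp_sum, whisker_exchange_assoc, F.indUnit_doubleBraid] at h'
  exact h'

lemma eq_zero_of_comp_toDual (hS : S.IsSpherical) (hdim : F.isScalar_unit.coef (F.dim S) ≠ 0)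
    (G : FusionStructure k (Center C)) {ω : G.coend.pt ⊗ G.coend.pt ⟶ 𝟙_ (Center C)}
    (hω : ∀ X Y, (G.coend.ι X ⊗ₘ G.coend.ι Y) ≫ ω = hopf X Y) {N : Center C}
    {f : N ⟶ G.coend.pt} (hf : f ≫ toDual ω = 0) : f = 0 := by
  have h1 (W : C) : ∑ s, (coendComp G f s).f ▷ W ≫ (α_ _ _ _).hom ≫
      dual (G.V s).1 ◁ ((G.V s).2.β W).hom ≫ F.indMap W (ev (G.V s).1) = 0 := by
    refine sum_indMap_ev_eq_zero F (fun s => (G.V s).2) (fun s => (coendComp G f s).f) W ?_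
    have h := congrArg Center.Hom.f
      (sum_monodromy_eq_zero G (centerSovereign S) hω hf (F.centerInd W))
    rw [center_sum_f] at h
    refine (Finset.sum_congr rfl fun s _ => ?_).trans h
    rw [Center.comp_f, center_monodromy_f]
    rfl
  have h2 (t : G.I) (i : F.I) (c : F.Mult (G.V t).1 i) :
      (coendComp G f t).f ≫ mate (F.inj (G.V t).1 i c) ▷ (G.V t).1 = 0 := by
    -- The trace becomes that of `inj c ≫ proj a` on `V i`: it is `d (V i)` for `a = c` and `0`
    -- otherwise, so averaging selects a single matrix entry.
    have htr (a : F.Mult (G.V t).1 i) :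
        F.d S (G.V t).1 • F.avgHom S (F.proj (G.V t).1 i a ≫ F.inj (G.V t).1 i c) =
          (F.isScalar_unit.coef (F.dim S) * F.tr S (F.V i)
            (F.inj (G.V t).1 i c ≫ F.proj (G.V t).1 i a)) • 𝟙 (G.V t).1 := by
      rw [smul_avgHom F hS (G.isScalar t), F.tr_comm]
    refine comp_mate_inj_eq_zero F (M := fun s => (G.V s).1) (fun s => (coendComp G f s).f) t c
      (fun s a => F.avgHom S (M := G.V s) (N := G.V t) (F.proj (G.V s).1 i a ≫ F.inj (G.V t).1 i c))
      (F.d S (G.V t).1) (mul_ne_zero hdim (F.d_ne_zero S i)) (fun s hs a => ?_) (fun a ha => ?_) ?_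
      (F.sum_average_eq_zero S (fun s => (G.V s).1) (fun s => (G.V s).2)
        (fun s => (coendComp G f s).f) h1 t (F.inj (G.V t).1 i c))
    · exact congrArg Center.Hom.f (G.hom_eq_zero _ _ hs (F.avg S hS (G.V s) (G.V t) _))
    · refine (htr a).trans ?_
      rw [F.inj_proj_ne _ _ _ _ ha.symm, map_zero, mul_zero, zero_smul]
    · refine (htr c).trans ?_
      rw [F.inj_proj_self]
      rfl
  have h3 (t : G.I) : coendComp G f t = 0 :=
    Center.ext _ _ (eq_zero_of_comp_mate_inj F (h2 t))
  rw [← sum_coendComp G f]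
  exact Finset.sum_eq_zero fun s _ => by rw [h3, zero_comp]

end

theorem center_isModular {k : Type w} [Field k] [IsAlgClosed k]
    {C : Type u} [Category.{v} C] [MonoidalCategory C] [RigidCategory C]
    [Preadditive C] [Linear k C] [MonoidalPreadditive C] [MonoidalLinear k C]
    (F : FusionStructure k C) {S : SovereignStructure C} (hS : S.IsSpherical)
    (hdim : IsUnit (F.dim S)) : IsModular (Center C) := by
  have := F.hasFiniteBiproducts
  obtain ⟨G⟩ := center_nonempty_fusionStructure F hS hdim
  obtain ⟨ω, hω⟩ := G.coend.exists_isHopfPairing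
  refine ⟨G.coend, ω, fun X Y => (hω X Y).trans (hopf_eq X Y), ?_⟩
  have hmono {N : Center C} {f : N ⟶ G.coend.pt} (hf : f ≫ toDual ω = 0) : f = 0 :=
    eq_zero_of_comp_toDual F hS (F.coef_dim_ne_zero hdim) G hω hf
  obtain ⟨g, hg⟩ := center_exists_generalized_inverse F hS hdim (toDual ω)
  have h1 : toDual ω ≫ g = 𝟙 _ := by
    rw [← sub_eq_zero]
    refine hmono ?_
    rw [Preadditive.sub_comp, Category.assoc, hg, Category.id_comp, sub_self]
  have := center_finite_hom F (dual G.coend.pt) G.coend.pt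
  have := center_finite_hom F (dual G.coend.pt) (dual G.coend.pt)
  -- `A` is a retract of `A*` by `h1`; dualizing `h1` and using `A ≅ A**` makes `A*` a retract of
  -- `A`.
  refine isNondegenerate_of_inverse ω h1 (comp_eq_id_of_retracts k h1
    (h := mate g ≫ ((centerSovereign S).φ _).inv)
    (p := ((centerSovereign S).φ _).hom ≫ mate (toDual ω)) ?_)
  rw [Category.assoc, Iso.inv_hom_id_assoc, ← mate_comp, h1, mate_id]

end CategoricalCenter

end

/-- The center of a spherical fusion category of invertible dimension over an algebraically closed
field is a ribbon fusion category, and it is modular. -/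
theorem mainTheorem6 {k : Type w} [Field k] [IsAlgClosed k]
    {C : Type u} [Category.{v} C] [MonoidalCategory C] [RigidCategory C]
    [Preadditive C] [Linear k C] [MonoidalPreadditive C] [MonoidalLinear k C]
    (F : CategoricalCenter.FusionStructure k C)
    (S : CategoricalCenter.SovereignStructure C) (hS : S.IsSpherical)
    (hdim : IsUnit (F.dim S)) :
    ∃ _ : RigidCategory (Center C),
      Nonempty (CategoricalCenter.FusionStructure k (Center C)) ∧
      (∃ R : CategoricalCenter.RibbonStructure (Center C),
        ∀ X : Center C, (R.θ X).hom.f = S.centerTwist X) ∧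
      CategoricalCenter.IsModular (Center C) := by
  refine ⟨CategoricalCenter.centerRigid,
    CategoricalCenter.center_nonempty_fusionStructure F hS hdim,
    ⟨CategoricalCenter.centerRibbon S F hS, CategoricalCenter.centerRibbon_θ_hom_f S F hS⟩,
    CategoricalCenter.center_isModular F hS hdim⟩
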